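/- **Conventions.** Let $\Bbbk$ be a field, $N$ an even natural number and $n\ge 0$ an integer; if $n\geq 3$, assume that $\operatorname{char}\Bbbk\neq 3$. Let $H$ be a graded-commutative $\Bbbk$-algebra with product $\bullet$ (for instance $H=H^*(M;\Bbbk)$ for a compact $N$-dimensional manifold $M$). The element $s^{N-1}a$ of the suspension $s^{N-1}H$ has degree $|a|+N-1$. For a graded vector space $V$, the group $\Sigma_m$ acts on $T^m(V)=V^{\otimes m}$ by permutation of the factors with graded signs, and $\Gamma^m(V)\subseteq T^m(V)$ is the subspace of invariants. Let $E_1=(H^{\otimes n}\otimes\bigwedge_{i\ne j}e_{ij})/I$ ($1\le i,j\le n$), where $\bigwedge$ denotes the free graded-commutative algebra, $|e_{ij}|=N-1$, and $I$ is the ideal generated by $e_{ij}^2$, $e_{ij}-(-1)^Ne_{ji}$, $(p_i^*(a)-p_j^*(a))\otimes e_{ij}$ for $a\in H$, and $e_{ij}e_{jl}+e_{jl}e_{li}+e_{li}e_{ij}$ for $i,j,l$ distinct; here $p_i^*(a)=1\otimes\cdots\otimes a\otimes\cdots\otimes1$ with $a$ in place $i$. The group $\Sigma_n$ acts on $E_1$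 by algebra automorphisms with $\sigma(p_i^*(a))=p_{\sigma(i)}^*(a)$ and $\sigma(e_{ij})=e_{\sigma(i)\sigma(j)}$. For $0\le r\le n/2$ let $\mathcal P_r$ be the set of families $I=\{(i_1,j_1),\dots,(i_r,j_r)\}$ of disjoint pairs in $\{1,\dots,n\}$ with $i_u<j_u$ and $i_1<\cdots<i_r$; put $e_I=e_{i_1j_1}\cdots e_{i_rj_r}$. Let $\phi_I:\Gamma^{n-2r}H\to H^{\otimes n}$ insert $1$ in the positions $i_1,\dots,i_r,j_1,\dots,j_r$, and let $\psi_I:\Gamma^r(s^{N-1}H)\to H^{\otimes n}\cdot e_I$ send $s^{N-1}x_1\otimes\cdots\otimes s^{N-1}x_r$ to $(-1)^{(N-1)(|x_1|+2|x_2|+\cdots+r|x_r|)}$ times the tensor with $x_u$ in position $i_u$ and $1$ in all other positions, multiplied by $e_I$. Define $$\Phi:\Gamma_n^H:=\bigoplus_{r=0}^{[n/2]}\Gamma^{n-2r}H\otimes\Gamma^r(s^{N-1}H)\to E_1,\qquad \Phi(\alpha\otimes\beta)=\sum_{I\in\mathcal P_r}\phi_I(\alpha)\,\psi_I(\beta).$$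 **Operations.** Let $*$ be the (graded) shuffle product, $\nabla_{p,q}(x_1\cdots x_{p+q})=x_1\cdots x_p\otimes x_{p+1}\cdots x_{p+q}$, $red:\Gamma^{2r}H\to\Gamma^rH$ the map induced by $x_1\otimes\cdots\otimes x_{2r}\mapsto (x_1\bullet x_2)\otimes\cdots\otimes(x_{2r-1}\bullet x_{2r})$, $\nu$ the graded componentwise product of $T^m(H)$, and $\bar\nu$ the action $$(a_1\otimes\cdots\otimes a_m)\cdot(s^{N-1}b_1\otimes\cdots\otimes s^{N-1}b_m)=(-1)^{\sum_{j\ge2}|a_j|(|b_1|+\cdots+|b_{j-1}|)+\sum_i i|a_i|}\,s^{N-1}(a_1\bullet b_1)\otimes\cdots\otimes s^{N-1}(a_m\bullet b_m).$$ **Theorem.** For $\alpha\otimes\beta\in\Gamma^{n-2r}H\otimes\Gamma^r(s^{N-1}H)$ and $\gamma\otimes\delta\in\Gamma^{n-2s}H\otimes\Gamma^s(s^{N-1}H)$ put $\mu((\alpha\otimes\beta)\otimes(\gamma\otimes\delta))=0$ if $2(r+s)>n$ and otherwise $$\mu((\alpha\otimes\beta)\otimes(\gamma\otimes\delta))=\sum_{i,j}\varepsilon_{ij}\;\nu(\alpha_i\otimes\gamma_j)\otimes\Bigl(\bar\nu(red(\gamma_j')\otimes\beta)*\bar\nu(red(\alpha_i')\otimes\delta)\Bigr),$$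 where $\nabla_{n-2r-2s,2s}(\alpha)=\sum_i\alpha_i\otimes\alpha_i'$ and $\nabla_{n-2r-2s,2r}(\gamma)=\sum_j\gamma_j\otimes\gamma_j'$ with homogeneous terms, and $\varepsilon_{ij}=(-1)^{(|\gamma_j|+|\gamma_j'|)(|\alpha_i'|+|\beta|)+|\alpha_i'||\beta|}$ is the graded sign of the permutation $(\alpha_i,\alpha_i',\beta,\gamma_j,\gamma_j',\delta)\mapsto(\alpha_i,\gamma_j,\gamma_j',\beta,\alpha_i',\delta)$, $|\beta|$ being the degree in $T^r(s^{N-1}H)$. Then $\mu$ is a well-defined multiplication on $\Gamma_n^H$, it makes $\Gamma_n^H$ an associative unital graded algebra, and $\Phi$ is an isomorphism of graded algebras from $(\Gamma_n^H,\mu)$ onto the algebra of invariants $E_1^{\Sigma_n}$. -/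

import Mathlib

open scoped TensorProduct DirectSum

namespace CohenTaylor

noncomputable section

universe u v

/-! ### Signs, graded modules, suspensions -/

/-- The sign `(-1)^d` as a scalar of `k`. -/
def sgn (k : Type u) [Field k] (d : ℤ) : k := ((d.negOnePow : ℤˣ) : ℤ)

/-- Graded commutativity: `a b = (-1)^{|a||b|} b a` for homogeneous `a`, `b`. -/
def IsGradedCommutative {k : Type u} {H : Type v} [Field k] [Ring H] [Algebra k H]
    (𝒜 : ℤ → Submodule k H) : Prop :=
  ∀ (p q : ℤ) (a b : H), a ∈ 𝒜 p → b ∈ 𝒜 q → a * b = sgn k (p * q) • (b * a)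

section Tensors

variable {k : Type u} {V : Type v} [Field k] [AddCommGroup V] [Module k V]

/-- The grading of the suspension `s^c V`: it has the same underlying vector space as `V`
(the element `s^c x` is represented by `x`), and the degree of `s^c x` is `|x| + c`. -/
def susp (𝒱 : ℤ → Submodule k V) (c : ℤ) : ℤ → Submodule k V := fun i => 𝒱 (i - c)

theorem lof_susp_congr (𝒱 : ℤ → Submodule k V) (c : ℤ) {i j : ℤ} (hij : i = j) (x : V)
    (hi : x ∈ susp 𝒱 c i) (hj : x ∈ susp 𝒱 c j) :
    DirectSum.lof k ℤ (fun t => susp 𝒱 c t) i ⟨x, hi⟩ =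
      DirectSum.lof k ℤ (fun t => susp 𝒱 c t) j ⟨x, hj⟩ := by
  subst hij
  rfl

instance suspDecomposition (𝒱 : ℤ → Submodule k V) [DirectSum.Decomposition 𝒱] (c : ℤ) :
    DirectSum.Decomposition (susp 𝒱 c) :=
  DirectSum.Decomposition.ofLinearMap (susp 𝒱 c)
    ((DirectSum.toModule k ℤ (⨁ i, susp 𝒱 c i) fun i =>
        (DirectSum.lof k ℤ (fun j => susp 𝒱 c j) (i + c)).comp
          (LinearMap.codRestrict (susp 𝒱 c (i + c)) (𝒱 i).subtype (fun x => by
            simp [susp]))).comp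
      (DirectSum.decomposeLinearEquiv 𝒱).toLinearMap)
    (by
      ext x
      induction x using DirectSum.Decomposition.inductionOn 𝒱 with
      | zero => simp
      | @homogeneous i y =>
        simp only [LinearMap.comp_apply, LinearEquiv.coe_coe,
          DirectSum.decomposeLinearEquiv_apply, DirectSum.decompose_coe, LinearMap.id_apply]
        rw [← DirectSum.lof_eq_of k, DirectSum.toModule_lof, LinearMap.comp_apply,
          DirectSum.coeLinearMap_lof]
        rfl
      | add a b ha hb => rw [map_add, map_add, ha, hb])
    (by
      apply DirectSum.linearMap_ext
      intro i
      ext1 ⟨x, hx⟩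
      have hx' : x ∈ 𝒱 (i - c) := hx
      simp only [LinearMap.comp_apply, LinearEquiv.coe_coe, LinearMap.id_apply,
        DirectSum.coeLinearMap_lof, DirectSum.decomposeLinearEquiv_apply,
        DirectSum.decompose_of_mem 𝒱 hx']
      rw [← DirectSum.lof_eq_of k, DirectSum.toModule_lof, LinearMap.comp_apply]
      exact lof_susp_congr 𝒱 c (by ring) x _ _)

/-- The projection of a graded vector space onto its part of even (`ε = 0`) or odd (`ε = 1`)
degree. -/
def parityProj (𝒱 : ℤ → Submodule k V) [DirectSum.Decomposition 𝒱] (ε : Fin 2) : V →ₗ[k] V :=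
  (DirectSum.toModule k ℤ V fun i =>
      if i % 2 = ((ε : ℕ) : ℤ) then (𝒱 i).subtype else 0).comp
    (DirectSum.decomposeLinearEquiv 𝒱).toLinearMap

/-- The operator on `T^m(V)` which multiplies `x₁ ⊗ ⋯ ⊗ xₘ`, for `xᵢ` homogeneous of parity
`εᵢ`, by the scalar `w ε`. -/
def weightOp (𝒱 : ℤ → Submodule k V) [DirectSum.Decomposition 𝒱] {m : ℕ}
    (w : (Fin m → Fin 2) → k) : (⨂[k]^m V) →ₗ[k] (⨂[k]^m V) :=
  ∑ ε : Fin m → Fin 2, w ε • PiTensorProduct.map (fun i => parityProj 𝒱 (ε i))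

/-- The Koszul sign of `σ` acting on letters of parities `ε`: one factor `(-1)^{|xᵢ||xⱼ|}` for
each inversion `i < j`, `σ j < σ i`. -/
def koszulSign (k : Type u) [Field k] {m : ℕ} (σ : Equiv.Perm (Fin m)) (ε : Fin m → Fin 2) : k :=
  sgn k (∑ i, ∑ j, if i < j ∧ σ j < σ i then ((ε i : ℕ) : ℤ) * ((ε j : ℕ) : ℤ) else 0)

/-- The action of `σ` on `T^m(V)` by permutation of the factors, with graded signs: the factor in
position `i` is moved to position `σ i`. -/
def permAct (𝒱 : ℤ → Submodule k V) [DirectSum.Decomposition 𝒱] {m : ℕ}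
    (σ : Equiv.Perm (Fin m)) : (⨂[k]^m V) →ₗ[k] (⨂[k]^m V) :=
  (PiTensorProduct.reindex k (fun _ : Fin m => V) σ).toLinearMap.comp
    (weightOp 𝒱 (koszulSign k σ))

/-- `Γ^m(V) ⊆ T^m(V)`, the subspace of `Σₘ`-invariant tensors. -/
def Gam (𝒱 : ℤ → Submodule k V) [DirectSum.Decomposition 𝒱] (m : ℕ) :
    Submodule k (⨂[k]^m V) :=
  ⨅ σ : Equiv.Perm (Fin m), LinearMap.eqLocus (permAct 𝒱 σ) LinearMap.id

/-- The part of total degree `d` of `T^m(V)`. -/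
def tensorDeg (𝒱 : ℤ → Submodule k V) (m : ℕ) (d : ℤ) : Submodule k (⨂[k]^m V) :=
  Submodule.span k {t | ∃ (x : Fin m → V) (e : Fin m → ℤ),
    (∀ i, x i ∈ 𝒱 (e i)) ∧ ∑ i, e i = d ∧ t = PiTensorProduct.tprod k x}

/-- The projection of `T^m(V)` onto its part of total parity `c`. -/
def totalParity (𝒱 : ℤ → Submodule k V) [DirectSum.Decomposition 𝒱] (m : ℕ) (c : Fin 2) :
    (⨂[k]^m V) →ₗ[k] (⨂[k]^m V) :=
  weightOp 𝒱 (fun ε => if (∑ i, (ε i : ℕ)) % 2 = (c : ℕ) then 1 else 0)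

/-- `(p,q)`-shuffles: permutations which are increasing on the first `p` and on the last `q`
positions. -/
def IsShuffle (p q : ℕ) (σ : Equiv.Perm (Fin (p + q))) : Prop :=
  StrictMono (fun i : Fin p => σ (Fin.castAdd q i)) ∧
    StrictMono (fun j : Fin q => σ (Fin.natAdd p j))

open Classical in
/-- The shuffle product `* : T^p(V) ⊗ T^q(V) → T^{p+q}(V)`, with graded signs. -/
def shuffle (𝒱 : ℤ → Submodule k V) [DirectSum.Decomposition 𝒱] (p q : ℕ) :
    (⨂[k]^p V) ⊗[k] (⨂[k]^q V) →ₗ[k] (⨂[k]^(p + q) V) :=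
  (∑ σ ∈ Finset.univ.filter (IsShuffle p q), permAct 𝒱 σ).comp
    (TensorPower.mulEquiv (R := k) (M := V) (n := p) (m := q)).toLinearMap

/-- The component `∇_{p,q} : T^m(V) → T^p(V) ⊗ T^q(V)`, `m = p + q`, of the deconcatenation
coproduct: `x₁ ⋯ xₘ ↦ x₁ ⋯ x_p ⊗ x_{p+1} ⋯ xₘ`. -/
def deconcat (k : Type u) (V : Type v) [Field k] [AddCommGroup V] [Module k V] {m p q : ℕ}
    (h : m = p + q) : (⨂[k]^m V) →ₗ[k] (⨂[k]^p V) ⊗[k] (⨂[k]^q V) :=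
  (TensorPower.mulEquiv (R := k) (M := V) (n := p) (m := q)).symm.toLinearMap.comp
    (TensorPower.cast k V h).toLinearMap

end Tensors

section Multiplication

variable {k : Type u} {H : Type v} [Field k] [Ring H] [Algebra k H]

theorem redMultilinear_key (r : ℕ) (x : Fin (2 * r) → H) (i : Fin (2 * r)) (c : H) :
    (fun j : Fin r =>
      Function.update x i c ⟨2 * (j : ℕ), by omega⟩ *
        Function.update x i c ⟨2 * (j : ℕ) + 1, by omega⟩) =
      Function.update (fun j : Fin r =>
        x ⟨2 * (j : ℕ), by omega⟩ * x ⟨2 * (j : ℕ) + 1, by omega⟩)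
        ⟨(i : ℕ) / 2, by omega⟩
        (if (i : ℕ) % 2 = 0 then c * x ⟨2 * ((i : ℕ) / 2) + 1, by omega⟩
          else x ⟨2 * ((i : ℕ) / 2), by omega⟩ * c) := by
  obtain ⟨i, hi⟩ := i
  funext j
  obtain ⟨j, hj⟩ := j
  simp only [Function.update_apply, Fin.mk.injEq]
  by_cases h0 : 2 * j = i
  · subst h0
    simp
  · by_cases h1 : 2 * j + 1 = i
    · subst h1
      have h2 : (2 * j + 1) / 2 = j := by omega
      have h3 : (2 * j + 1) % 2 = 1 := by omega
      simp [h2, h3]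
    · have h2 : j ≠ i / 2 := by omega
      simp [h0, h1, h2]

/-- The map `(x₁, …, x_{2r}) ↦ (x₁ • x₂) ⊗ ⋯ ⊗ (x_{2r-1} • x_{2r})`. -/
def redMultilinear (k : Type u) (H : Type v) [Field k] [Ring H] [Algebra k H] (r : ℕ) :
    MultilinearMap k (fun _ : Fin (2 * r) => H) (⨂[k]^r H) :=
  MultilinearMap.mk'
    (fun x => PiTensorProduct.tprod k fun j : Fin r =>
      x ⟨2 * (j : ℕ), by omega⟩ * x ⟨2 * (j : ℕ) + 1, by omega⟩)
    (by
      intro x i a b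
      rw [redMultilinear_key, redMultilinear_key, redMultilinear_key]
      split_ifs
      · rw [add_mul, MultilinearMap.map_update_add]
      · rw [mul_add, MultilinearMap.map_update_add])
    (by
      intro x i t a
      rw [redMultilinear_key, redMultilinear_key]
      split_ifs
      · rw [smul_mul_assoc, MultilinearMap.map_update_smul]
      · rw [mul_smul_comm, MultilinearMap.map_update_smul])

/-- The pairwise reduction `red : T^{2r}(H) → T^r(H)`. -/
def red (k : Type u) (H : Type v) [Field k] [Ring H] [Algebra k H] (r : ℕ) :
    (⨂[k]^(2 * r) H) →ₗ[k] (⨂[k]^r H) :=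
  PiTensorProduct.lift (redMultilinear k H r)

/-- The componentwise product `(a₁ ⊗ ⋯ ⊗ aₘ, b₁ ⊗ ⋯ ⊗ bₘ) ↦ w ε δ (a₁ • b₁) ⊗ ⋯ ⊗ (aₘ • bₘ)`, for
`aᵢ`, `bᵢ` homogeneous of parities `εᵢ`, `δᵢ`. -/
def componentwise (𝒜 : ℤ → Submodule k H) [GradedAlgebra 𝒜] {m : ℕ}
    (w : (Fin m → Fin 2) → (Fin m → Fin 2) → k) :
    (⨂[k]^m H) →ₗ[k] (⨂[k]^m H) →ₗ[k] (⨂[k]^m H) :=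
  ∑ ε : Fin m → Fin 2, ∑ δ : Fin m → Fin 2, w ε δ •
    (PiTensorProduct.map₂ (R := k) (fun _ : Fin m => LinearMap.mul k H)).compl₁₂
      (PiTensorProduct.map (fun i => parityProj 𝒜 (ε i)))
      (PiTensorProduct.map (fun i => parityProj 𝒜 (δ i)))

/-- The exponent `∑_j |aⱼ| (|b₁| + ⋯ + |b_{j-1}|)`. -/
def crossExponent {m : ℕ} (ε δ : Fin m → Fin 2) : ℤ :=
  ∑ j, ((ε j : ℕ) : ℤ) * ∑ i, if i < j then ((δ i : ℕ) : ℤ) else 0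

/-- The graded multiplication `ν` of `T^m(H)`, component by component. -/
def nu (𝒜 : ℤ → Submodule k H) [GradedAlgebra 𝒜] (m : ℕ) :
    (⨂[k]^m H) →ₗ[k] (⨂[k]^m H) →ₗ[k] (⨂[k]^m H) :=
  componentwise 𝒜 (fun ε δ => sgn k (crossExponent ε δ))

/-- The action `ν̄` of `T^m(H)` on `T^m(s^{N-1}H)`, for `N` even:
`(a₁ ⊗ ⋯ ⊗ aₘ) · (sb₁ ⊗ ⋯ ⊗ sbₘ) = ± s(a₁ • b₁) ⊗ ⋯ ⊗ s(aₘ • bₘ)`, where the exponent of the sign is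
`∑_j |aⱼ| (|b₁| + ⋯ + |b_{j-1}|) + ∑_i i |aᵢ|` (the degrees `|bᵢ|` are those in `H`). -/
def nuBar (𝒜 : ℤ → Submodule k H) [GradedAlgebra 𝒜] (m : ℕ) :
    (⨂[k]^m H) →ₗ[k] (⨂[k]^m H) →ₗ[k] (⨂[k]^m H) :=
  componentwise 𝒜 (fun ε δ =>
    sgn k (crossExponent ε δ + ∑ i : Fin m, (((i : ℕ) : ℤ) + 1) * ((ε i : ℕ) : ℤ)))

/-- The map `((α ⊗ α') ⊗ β, (γ ⊗ γ') ⊗ δ) ↦ ν(α ⊗ γ) ⊗ (ν̄(red γ' ⊗ β) * ν̄(red α' ⊗ δ))`, without the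
sign of the permutation; `*` is the shuffle product of `T(s^{N-1}H)`. -/
def muUnsigned (𝒜 : ℤ → Submodule k H) [GradedAlgebra 𝒜] (N l r s : ℕ) :
    (((⨂[k]^l H) ⊗[k] (⨂[k]^(2 * s) H)) ⊗[k] (⨂[k]^r H)) →ₗ[k]
      (((⨂[k]^l H) ⊗[k] (⨂[k]^(2 * r) H)) ⊗[k] (⨂[k]^s H)) →ₗ[k]
        ((⨂[k]^l H) ⊗[k] (⨂[k]^(r + s) H)) :=
  TensorProduct.curry <|
    (TensorProduct.map
      (TensorProduct.lift (nu 𝒜 l))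
      ((shuffle (susp 𝒜 ((N : ℤ) - 1)) r s).comp
        ((TensorProduct.map
          (TensorProduct.lift ((nuBar 𝒜 r).comp (red k H r)))
          (TensorProduct.lift ((nuBar 𝒜 s).comp (red k H s)))).comp
        ((TensorProduct.tensorTensorTensorComm k
            (⨂[k]^(2 * r) H) (⨂[k]^(2 * s) H) (⨂[k]^r H) (⨂[k]^s H)).toLinearMap.comp
          (TensorProduct.map (TensorProduct.comm k (⨂[k]^(2 * s) H) (⨂[k]^(2 * r) H)).toLinearMap
            LinearMap.id))))).comp
    ((TensorProduct.assoc k ((⨂[k]^l H) ⊗[k] (⨂[k]^l H))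
        ((⨂[k]^(2 * s) H) ⊗[k] (⨂[k]^(2 * r) H)) ((⨂[k]^r H) ⊗[k] (⨂[k]^s H))).toLinearMap.comp
      ((TensorProduct.map
        (TensorProduct.tensorTensorTensorComm k
          (⨂[k]^l H) (⨂[k]^(2 * s) H) (⨂[k]^l H) (⨂[k]^(2 * r) H)).toLinearMap
        LinearMap.id).comp
      (TensorProduct.tensorTensorTensorComm k
        ((⨂[k]^l H) ⊗[k] (⨂[k]^(2 * s) H)) (⨂[k]^r H)
        ((⨂[k]^l H) ⊗[k] (⨂[k]^(2 * r) H)) (⨂[k]^s H)).toLinearMap))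

theorem muUnsigned_tmul (𝒜 : ℤ → Submodule k H) [GradedAlgebra 𝒜] (N l r s : ℕ)
    (α : ⨂[k]^l H) (α' : ⨂[k]^(2 * s) H) (β : ⨂[k]^r H)
    (γ : ⨂[k]^l H) (γ' : ⨂[k]^(2 * r) H) (δ : ⨂[k]^s H) :
    muUnsigned 𝒜 N l r s ((α ⊗ₜ α') ⊗ₜ β) ((γ ⊗ₜ γ') ⊗ₜ δ) =
      nu 𝒜 l α γ ⊗ₜ shuffle (susp 𝒜 ((N : ℤ) - 1)) r s
        (nuBar 𝒜 r (red k H r γ') β ⊗ₜ nuBar 𝒜 s (red k H s α') δ) := by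
  rfl

/-- The component `[T^{n-2r}H ⊗ T^r(sH)] ⊗ [T^{n-2s}H ⊗ T^s(sH)] → T^{n-2r-2s}H ⊗ T^{r+s}(sH)` of `μ`:
`(α ⊗ β, γ ⊗ δ) ↦ ∑_{ij} ± ν(αᵢ ⊗ γⱼ) ⊗ (ν̄(red γⱼ' ⊗ β) * ν̄(red αᵢ' ⊗ δ))`, where
`∇_{n-2r-2s,2s}(α) = ∑ αᵢ ⊗ αᵢ'` and `∇_{n-2r-2s,2r}(γ) = ∑ γⱼ ⊗ γⱼ'`. The sign is the graded sign of
the permutation `(αᵢ, αᵢ', β, γⱼ, γⱼ', δ) ↦ (αᵢ, γⱼ, γⱼ', β, αᵢ', δ)`, whose exponent is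
`(|γⱼ| + |γⱼ'|)(|αᵢ'| + |β|) + |αᵢ'||β|`, with `|β|` the degree in `T^r(s^{N-1}H)`. -/
def muComponent (𝒜 : ℤ → Submodule k H) [GradedAlgebra 𝒜] (N n r s : ℕ) (h : 2 * (r + s) ≤ n) :
    ((⨂[k]^(n - 2 * r) H) ⊗[k] (⨂[k]^r H)) →ₗ[k]
      ((⨂[k]^(n - 2 * s) H) ⊗[k] (⨂[k]^s H)) →ₗ[k]
        ((⨂[k]^(n - 2 * (r + s)) H) ⊗[k] (⨂[k]^(r + s) H)) :=
  ∑ a' : Fin 2, ∑ b : Fin 2, ∑ c : Fin 2, ∑ c' : Fin 2,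
    sgn k ((((c : ℕ) : ℤ) + ((c' : ℕ) : ℤ)) * (((a' : ℕ) : ℤ) + ((b : ℕ) : ℤ)) +
        ((a' : ℕ) : ℤ) * ((b : ℕ) : ℤ)) •
      (muUnsigned 𝒜 N (n - 2 * (r + s)) r s).compl₁₂
        (TensorProduct.map
          ((TensorProduct.map LinearMap.id (totalParity 𝒜 (2 * s) a')).comp
            (deconcat k H (show n - 2 * r = (n - 2 * (r + s)) + 2 * s by omega)))
          (totalParity (susp 𝒜 ((N : ℤ) - 1)) r b))
        (TensorProduct.map
          ((TensorProduct.map (totalParity 𝒜 (n - 2 * (r + s)) c) (totalParity 𝒜 (2 * r) c')).comp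
            (deconcat k H (show n - 2 * s = (n - 2 * (r + s)) + 2 * r by omega)))
          LinearMap.id)

/-- The ambient space `⨁_{r=0}^{[n/2]} T^{n-2r}H ⊗ T^r(s^{N-1}H)`. -/
abbrev Ambient (k : Type u) (H : Type v) [Field k] [Ring H] [Algebra k H] (n : ℕ) :=
  ⨁ r : Fin (n / 2 + 1), ((⨂[k]^(n - 2 * (r : ℕ)) H) ⊗[k] (⨂[k]^(r : ℕ) H))

/-- The operation `μ` given by the components above; the components with `r + s > [n/2]` are
zero. -/
def mu (𝒜 : ℤ → Submodule k H) [GradedAlgebra 𝒜] (N n : ℕ) :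
    Ambient k H n →ₗ[k] Ambient k H n →ₗ[k] Ambient k H n :=
  DirectSum.toModule k _ _ fun r : Fin (n / 2 + 1) =>
    (DirectSum.toModule k _ _ fun s : Fin (n / 2 + 1) =>
      if h : (r : ℕ) + (s : ℕ) < n / 2 + 1 then
        ((muComponent 𝒜 N n r s (by omega)).compr₂
          (DirectSum.lof k (Fin (n / 2 + 1))
            (fun t => (⨂[k]^(n - 2 * (t : ℕ)) H) ⊗[k] (⨂[k]^(t : ℕ) H))
            ⟨(r : ℕ) + (s : ℕ), h⟩)).flip
      else 0).flip

/-- `Γₙ^H = ⨁_{r=0}^{[n/2]} Γ^{n-2r}(H) ⊗ Γ^r(s^{N-1}H)`. -/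
abbrev GamSum (𝒜 : ℤ → Submodule k H) [GradedAlgebra 𝒜] (N n : ℕ) :=
  ⨁ r : Fin (n / 2 + 1),
    ((Gam 𝒜 (n - 2 * (r : ℕ))) ⊗[k] (Gam (susp 𝒜 ((N : ℤ) - 1)) (r : ℕ)))

/-- The canonical map from `Γₙ^H` to the ambient space, induced by the inclusions `Γ ⊆ T`. -/
def incl (𝒜 : ℤ → Submodule k H) [GradedAlgebra 𝒜] (N n : ℕ) :
    GamSum 𝒜 N n →ₗ[k] Ambient k H n :=
  DirectSum.lmap fun r : Fin (n / 2 + 1) =>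
    TensorProduct.mapIncl (Gam 𝒜 (n - 2 * (r : ℕ))) (Gam (susp 𝒜 ((N : ℤ) - 1)) (r : ℕ))

/-- An operation on `Γₙ^H` is thus determined by its composite with `incl`. -/
theorem incl_injective (𝒜 : ℤ → Submodule k H) [GradedAlgebra 𝒜] (N n : ℕ) :
    Function.Injective (incl 𝒜 N n) := by
  unfold incl
  rw [DirectSum.lmap_injective]
  intro r
  exact Module.Flat.tensorProduct_mapIncl_injective_of_left _ _

/-- The part of total degree `d` of `Γₙ^H`. -/
def gamDeg (𝒜 : ℤ → Submodule k H) [GradedAlgebra 𝒜] (N n : ℕ) (d : ℤ) :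
    Submodule k (GamSum 𝒜 N n) :=
  Submodule.span k {x | ∃ (r : Fin (n / 2 + 1)) (p q : ℤ) (a : Gam 𝒜 (n - 2 * (r : ℕ)))
    (b : Gam (susp 𝒜 ((N : ℤ) - 1)) (r : ℕ)),
    (a : ⨂[k]^(n - 2 * (r : ℕ)) H) ∈ tensorDeg 𝒜 (n - 2 * (r : ℕ)) p ∧
    (b : ⨂[k]^(r : ℕ) H) ∈ tensorDeg (susp 𝒜 ((N : ℤ) - 1)) (r : ℕ) q ∧
    p + q = d ∧
    x = DirectSum.lof k (Fin (n / 2 + 1)) (fun t => (Gam 𝒜 (n - 2 * (t : ℕ))) ⊗[k]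
      (Gam (susp 𝒜 ((N : ℤ) - 1)) (t : ℕ))) r (a ⊗ₜ[k] b)}

end Multiplication

/-! ### The algebra `E₁` -/

section EOne

/-- Generators of `E₁`: `p i a` stands for `p_i^*(a) = 1 ⊗ ⋯ ⊗ a ⊗ ⋯ ⊗ 1` in `H^{⊗n}`, with `a` in the
`i`-th place, and `e i j` for the class `e_{ij}`, `i ≠ j`. -/
inductive Gen (H : Type v) (n : ℕ) : Type v
  | p (i : Fin n) (a : H) : Gen H n
  | e (i j : Fin n) (h : i ≠ j) : Gen H n

variable {k : Type u} {H : Type v} [Field k] [Ring H] [Algebra k H]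

/-- The generator `p_i^*(a)` in the free algebra. -/
abbrev freeP (k : Type u) {H : Type v} [Field k] {n : ℕ} (i : Fin n) (a : H) :
    FreeAlgebra k (Gen H n) :=
  FreeAlgebra.ι k (Gen.p i a)

/-- The generator `e_{ij}` in the free algebra. -/
abbrev freeE (k : Type u) (H : Type v) [Field k] {n : ℕ} (i j : Fin n) (h : i ≠ j) :
    FreeAlgebra k (Gen H n) :=
  FreeAlgebra.ι k (Gen.e i j h)

/-- The relations of `E₁`. The first group presents the graded tensor product
`H^{⊗n} ⊗ ⋀ e_{ij}`: each `p_i^*` is a morphism of unital algebras, and the generators commute in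
the graded sense, `e_{ij}` having degree `N - 1`. The second group generates the ideal `I`. -/
inductive Rel (𝒜 : ℤ → Submodule k H) (N n : ℕ) :
    FreeAlgebra k (Gen H n) → FreeAlgebra k (Gen H n) → Prop
  | p_add (i : Fin n) (a b : H) : Rel 𝒜 N n (freeP k i (a + b)) (freeP k i a + freeP k i b)
  | p_smul (i : Fin n) (c : k) (a : H) : Rel 𝒜 N n (freeP k i (c • a)) (c • freeP k i a)
  | p_one (i : Fin n) : Rel 𝒜 N n (freeP k i 1) 1
  | p_mul (i : Fin n) (a b : H) : Rel 𝒜 N n (freeP k i (a * b)) (freeP k i a * freeP k i b)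
  | p_comm (i j : Fin n) (hij : i ≠ j) (s t : ℤ) (a b : H) (ha : a ∈ 𝒜 s) (hb : b ∈ 𝒜 t) :
      Rel 𝒜 N n (freeP k i a * freeP k j b) (sgn k (s * t) • (freeP k j b * freeP k i a))
  | e_p_comm (i j l : Fin n) (hij : i ≠ j) (s : ℤ) (a : H) (ha : a ∈ 𝒜 s) :
      Rel 𝒜 N n (freeE k H i j hij * freeP k l a)
        (sgn k (((N : ℤ) - 1) * s) • (freeP k l a * freeE k H i j hij))
  | e_comm (i j l m : Fin n) (hij : i ≠ j) (hlm : l ≠ m) :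
      Rel 𝒜 N n (freeE k H i j hij * freeE k H l m hlm)
        (sgn k (((N : ℤ) - 1) * ((N : ℤ) - 1)) • (freeE k H l m hlm * freeE k H i j hij))
  | e_arnold (i j l : Fin n) (hij : i ≠ j) (hjl : j ≠ l) (hli : l ≠ i) :
      Rel 𝒜 N n (freeE k H i j hij * freeE k H j l hjl + freeE k H j l hjl * freeE k H l i hli +
        freeE k H l i hli * freeE k H i j hij) 0
  | e_sq (i j : Fin n) (hij : i ≠ j) : Rel 𝒜 N n (freeE k H i j hij * freeE k H i j hij) 0
  | e_symm (i j : Fin n) (hij : i ≠ j) :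
      Rel 𝒜 N n (freeE k H i j hij) (sgn k (N : ℤ) • freeE k H j i hij.symm)
  | p_e (i j : Fin n) (hij : i ≠ j) (a : H) :
      Rel 𝒜 N n (freeP k i a * freeE k H i j hij) (freeP k j a * freeE k H i j hij)

/-- The `E₁`-term `(H^{⊗n} ⊗ ⋀ e_{ij}) / I`. -/
abbrev EOne (𝒜 : ℤ → Submodule k H) (N n : ℕ) : Type (max u v) := RingQuot (Rel 𝒜 N n)

/-- The class `e_{ij}` in `E₁`. -/
def eGen (𝒜 : ℤ → Submodule k H) (N : ℕ) {n : ℕ} (i j : Fin n) (h : i ≠ j) : EOne 𝒜 N n :=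
  RingQuot.mkAlgHom k (Rel 𝒜 N n) (freeE k H i j h)

/-- The linear map `p_i^* : H → E₁`. -/
def pGen (𝒜 : ℤ → Submodule k H) (N : ℕ) {n : ℕ} (i : Fin n) : H →ₗ[k] EOne 𝒜 N n where
  toFun a := RingQuot.mkAlgHom k (Rel 𝒜 N n) (freeP k i a)
  map_add' a b := by
    rw [← map_add]
    exact RingQuot.mkAlgHom_rel k (Rel.p_add i a b)
  map_smul' c a := by
    rw [RingHom.id_apply, ← map_smul]
    exact RingQuot.mkAlgHom_rel k (Rel.p_smul i c a)

/-- The action of `σ ∈ Σₙ` on the generators: `p_i^*(a) ↦ p_{σ(i)}^*(a)`,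
`e_{ij} ↦ e_{σ(i)σ(j)}`. -/
def permGen (𝒜 : ℤ → Submodule k H) (N : ℕ) {n : ℕ} (σ : Equiv.Perm (Fin n)) :
    Gen H n → EOne 𝒜 N n
  | Gen.p i a => pGen 𝒜 N (σ i) a
  | Gen.e i j h => eGen 𝒜 N (σ i) (σ j) (σ.injective.ne h)

theorem permGen_rel (𝒜 : ℤ → Submodule k H) (N : ℕ) {n : ℕ} (σ : Equiv.Perm (Fin n))
    ⦃x y : FreeAlgebra k (Gen H n)⦄ (h : Rel 𝒜 N n x y) :
    FreeAlgebra.lift k (permGen 𝒜 N σ) x = FreeAlgebra.lift k (permGen 𝒜 N σ) y := by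
  have mk : ∀ {x y : FreeAlgebra k (Gen H n)}, Rel 𝒜 N n x y →
      RingQuot.mkAlgHom k (Rel 𝒜 N n) x = RingQuot.mkAlgHom k (Rel 𝒜 N n) y :=
    fun h => RingQuot.mkAlgHom_rel k h
  have hne : ∀ {i j : Fin n}, i ≠ j → σ i ≠ σ j := fun h => σ.injective.ne h
  cases h with
  | p_add i a b => simpa [permGen, pGen] using mk (Rel.p_add (σ i) a b)
  | p_smul i c a => simpa [permGen, pGen] using mk (Rel.p_smul (σ i) c a)
  | p_one i =>
    simp only [FreeAlgebra.lift_ι_apply, permGen, map_one]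
    exact (mk (Rel.p_one (σ i))).trans (map_one _)
  | p_mul i a b => simpa [permGen, pGen] using mk (Rel.p_mul (σ i) a b)
  | p_comm i j hij s t a b ha hb =>
    simpa [permGen, pGen] using mk (Rel.p_comm (σ i) (σ j) (hne hij) s t a b ha hb)
  | e_p_comm i j l hij s a ha =>
    simpa [permGen, pGen, eGen] using mk (Rel.e_p_comm (σ i) (σ j) (σ l) (hne hij) s a ha)
  | e_comm i j l m hij hlm =>
    simpa [permGen, eGen] using mk (Rel.e_comm (𝒜 := 𝒜) (σ i) (σ j) (σ l) (σ m) (hne hij) (hne hlm))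
  | e_arnold i j l hij hjl hli =>
    simpa [permGen, eGen] using
      mk (Rel.e_arnold (𝒜 := 𝒜) (σ i) (σ j) (σ l) (hne hij) (hne hjl) (hne hli))
  | e_sq i j hij => simpa [permGen, eGen] using mk (Rel.e_sq (𝒜 := 𝒜) (σ i) (σ j) (hne hij))
  | e_symm i j hij => simpa [permGen, eGen] using mk (Rel.e_symm (𝒜 := 𝒜) (σ i) (σ j) (hne hij))
  | p_e i j hij a => simpa [permGen, pGen, eGen] using mk (Rel.p_e (σ i) (σ j) (hne hij) a)

/-- The action of `σ ∈ Σₙ` on `E₁` by algebra morphisms. -/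
def permEOne (𝒜 : ℤ → Submodule k H) (N : ℕ) {n : ℕ} (σ : Equiv.Perm (Fin n)) :
    EOne 𝒜 N n →ₐ[k] EOne 𝒜 N n :=
  RingQuot.liftAlgHom k ⟨FreeAlgebra.lift k (permGen 𝒜 N σ), permGen_rel 𝒜 N σ⟩

/-- The algebra of invariants `E₁^{Σₙ}`. -/
def invariants (𝒜 : ℤ → Submodule k H) (N n : ℕ) : Subalgebra k (EOne 𝒜 N n) :=
  ⨅ σ : Equiv.Perm (Fin n), AlgHom.equalizer (permEOne 𝒜 N σ) (AlgHom.id k (EOne 𝒜 N n))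

/-- `IsMonomial t q x`: `x` is a product of generators `p_i^*(a)` (`a` homogeneous, of bidegree
`(|a|, 0)`) and `e_{ij}` (of bidegree `(0, N - 1)`), of total bidegree `(t, q)`. -/
inductive IsMonomial (𝒜 : ℤ → Submodule k H) (N n : ℕ) : ℤ → ℤ → EOne 𝒜 N n → Prop
  | one : IsMonomial 𝒜 N n 0 0 1
  | p_mul (i : Fin n) (s : ℤ) (a : H) (ha : a ∈ 𝒜 s) (t q : ℤ) (x : EOne 𝒜 N n)
      (hx : IsMonomial 𝒜 N n t q x) : IsMonomial 𝒜 N n (s + t) q (pGen 𝒜 N i a * x)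
  | e_mul (i j : Fin n) (h : i ≠ j) (t q : ℤ) (x : EOne 𝒜 N n)
      (hx : IsMonomial 𝒜 N n t q x) :
      IsMonomial 𝒜 N n t (((N : ℤ) - 1) + q) (eGen 𝒜 N i j h * x)

/-- The part of total degree `d` of `E₁`. -/
def eOneDeg (𝒜 : ℤ → Submodule k H) (N n : ℕ) (d : ℤ) : Submodule k (EOne 𝒜 N n) :=
  Submodule.span k {x | ∃ t q : ℤ, t + q = d ∧ IsMonomial 𝒜 N n t q x}

/-! ### The map `Φ` -/

/-- The set `𝒫_r` of `r`-tuples of disjoint pairs `(i₁, j₁), …, (i_r, j_r)` with `i_u < j_u` and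
`i₁ < ⋯ < i_r`. -/
structure PairTuple (n r : ℕ) where
  i : Fin r → Fin n
  j : Fin r → Fin n
  lt : ∀ u, i u < j u
  strictMono_i : StrictMono i
  injective_j : Function.Injective j
  disjoint : ∀ u v, i u ≠ j v

instance (n r : ℕ) : Finite (PairTuple n r) :=
  Finite.of_injective (fun I : PairTuple n r => (I.i, I.j)) (by
    rintro ⟨i, j, _, _, _, _⟩ ⟨i', j', _, _, _, _⟩ h
    simp only [Prod.mk.injEq] at h
    obtain ⟨rfl, rfl⟩ := h
    rfl)

instance (n r : ℕ) : Fintype (PairTuple n r) := Fintype.ofFinite _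

/-- The complement of `I' = {i₁, …, i_r, j₁, …, j_r}`. -/
def PairTuple.compl {n r : ℕ} (I : PairTuple n r) : Finset (Fin n) :=
  (Finset.univ.image I.i ∪ Finset.univ.image I.j)ᶜ

theorem PairTuple.card_compl {n r : ℕ} (I : PairTuple n r) : I.compl.card = n - 2 * r := by
  have hd : Disjoint (Finset.univ.image I.i) (Finset.univ.image I.j) := by
    rw [Finset.disjoint_left]
    intro x hx hx'
    simp only [Finset.mem_image, Finset.mem_univ, true_and] at hx hx'
    obtain ⟨u, rfl⟩ := hx
    obtain ⟨v, hv⟩ := hx'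
    exact I.disjoint u v hv.symm
  rw [PairTuple.compl, Finset.card_compl, Finset.card_union_of_disjoint hd,
    Finset.card_image_of_injective _ I.strictMono_i.injective,
    Finset.card_image_of_injective _ I.injective_j]
  simp [two_mul]

/-- The map `x₁ ⊗ ⋯ ⊗ xₘ ↦ p_{c(1)}^*(x₁) ⋯ p_{c(m)}^*(xₘ)`; for `c` increasing this is the tensor of
`H^{⊗n}` obtained by inserting `1` in the positions that are not values of `c`. -/
def place (𝒜 : ℤ → Submodule k H) (N : ℕ) {n m : ℕ} (c : Fin m → Fin n) :
    (⨂[k]^m H) →ₗ[k] EOne 𝒜 N n :=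
  PiTensorProduct.lift
    ((MultilinearMap.mkPiAlgebraFin k m (EOne 𝒜 N n)).compLinearMap fun u => pGen 𝒜 N (c u))

/-- `φ_I`: insertion of `1` in the positions belonging to `I'`. -/
def phi (𝒜 : ℤ → Submodule k H) (N : ℕ) {n r : ℕ} (I : PairTuple n r) :
    (⨂[k]^(n - 2 * r) H) →ₗ[k] EOne 𝒜 N n :=
  place 𝒜 N (I.compl.orderEmbOfFin I.card_compl)

/-- `e_I = e_{i₁j₁} ⋯ e_{i_rj_r}`. -/
def eProd (𝒜 : ℤ → Submodule k H) (N : ℕ) {n r : ℕ} (I : PairTuple n r) : EOne 𝒜 N n :=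
  (List.ofFn fun u => eGen 𝒜 N (I.i u) (I.j u) (I.lt u).ne).prod

/-- `ψ_I`: the map `γ_I`, which sends `sx₁ ⊗ ⋯ ⊗ sx_r` to
`(-1)^{(N-1)(|x₁| + 2|x₂| + ⋯ + r|x_r|)} x₁ ⊗ ⋯ ⊗ x_r · e_I`, followed by insertion of `1` in the
positions different from `i₁, …, i_r`. -/
def psi (𝒜 : ℤ → Submodule k H) [GradedAlgebra 𝒜] (N : ℕ) {n r : ℕ} (I : PairTuple n r) :
    (⨂[k]^r H) →ₗ[k] EOne 𝒜 N n :=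
  (LinearMap.mulRight k (eProd 𝒜 N I)).comp
    ((place 𝒜 N I.i).comp
      (weightOp 𝒜 fun ε =>
        sgn k (((N : ℤ) - 1) * ∑ u : Fin r, (((u : ℕ) : ℤ) + 1) * ((ε u : ℕ) : ℤ))))

/-- `Φ_r(α ⊗ β) = ∑_{I ∈ 𝒫_r} φ_I(α) · ψ_I(β)`. -/
def PhiComponent (𝒜 : ℤ → Submodule k H) [GradedAlgebra 𝒜] (N n r : ℕ) :
    (Gam 𝒜 (n - 2 * r)) ⊗[k] (Gam (susp 𝒜 ((N : ℤ) - 1)) r) →ₗ[k] EOne 𝒜 N n :=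
  TensorProduct.lift (∑ I : PairTuple n r,
    (LinearMap.mul k (EOne 𝒜 N n)).compl₁₂
      ((phi 𝒜 N I).comp (Gam 𝒜 (n - 2 * r)).subtype)
      ((psi 𝒜 N I).comp (Gam (susp 𝒜 ((N : ℤ) - 1)) r).subtype))

/-- `Φ = ⨁_r Φ_r : Γₙ^H → E₁`. -/
def Phi (𝒜 : ℤ → Submodule k H) [GradedAlgebra 𝒜] (N n : ℕ) :
    GamSum 𝒜 N n →ₗ[k] EOne 𝒜 N n :=
  DirectSum.toModule k _ _ fun r => PhiComponent 𝒜 N n r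

end EOne

end

end CohenTaylor

/-!
The proof compares everything inside `E₁`, and uses no basis of `E₁`. Write `e_I` for the product of
the classes `e_{ij}` over a tuple `I` of disjoint pairs.

*Invariant classes only involve disjoint pairs.* For two points `a`, `b` there is a residue
`res a b` on `E₁`, the twisted derivation which takes `e_{ab}` to `1` and makes the points collide. By
the three-term relation each class is recovered from its residues along the collisions with a given
point `b` and from its part without the classes `e_{ib}` (`eq_keep_add_sum_res`). The cyclic sum of
iterated residues at three points vanishes (`res_res_cyclic_sum`); on an invariant class its three
terms are equal, so that the iterated residue itself vanishes if `3` is invertible, and it does not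
occur if `n ≤ 2`. By induction on the set of points an invariant class is then a combination of
classes `y · e_I`, with `y` a polynomial in the classes `p_i^*(a)` (`keep_mem_pairSpan`).

*Independence.* The part of such a combination belonging to a given `I` is cut out by the
endomorphism which kills the classes `e_{ij}` outside the pairs of `I`, followed by the projection
to the right number of factors (`extract`). The map `α ⊗ β ↦ φ_I(α) ψ_I(β)` is injective
(`summand_injective`): residues cancel `e_I`, and the polynomial in the `p_i^*(a)` which is left is
recognized by its action on tensors, where `p_i^*(a)` multiplies the factor `i` with the sign from
passing the factors before it (`placeC_injective`). Hence `Φ` is injective. An invariant class is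
determined by its parts belonging to one tuple of each length, and the permutations preserving this
tuple show that these parts come from invariant tensors; so it is a value of `Φ`
(`exists_PhiAmb_incl_eq`).

*The product.* As `Φ` is injective onto a subalgebra, there is one bilinear operation on `Γₙ^H` for
which `Φ` is multiplicative, and it is associative and unital. That it is `μ` may be checked on the
parts belonging to the tuple `K` of the last `t` pairs. There only the summands of complementary
sub-tuples of `K` contribute, and these correspond to shuffles (`extract_sum_mul_sum`). The
complement of a sub-tuple consists of the first `n - 2t` points followed by the points of the
complementary pairs, which explains the deconcatenation; the two points of a pair become equal on
`e_I`, which explains `red`. All signs come from reordering factors in the graded commutative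
algebra `E₁` (`six_factors`, `placeC_mul_placeC`, `placeC_mul_edgeC`).

*Degrees.* The gradings of `E₁` are coactions `E₁ → E₁[T, T⁻¹]`; invariant tensors are sums of
homogeneous invariant tensors, so that `Φ`, which preserves degrees, also reflects them.
-/

open scoped TensorProduct DirectSum

namespace CohenTaylor

noncomputable section

universe u v

/-! ### Signs and parities -/

section Sgn

variable {k : Type u} [Field k]

theorem sgn_add (a b : ℤ) : sgn k (a + b) = sgn k a * sgn k b := by
  simp [sgn, Int.negOnePow_add]

theorem sgn_of_even {a : ℤ} (h : Even a) : sgn k a = 1 := by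
  simp [sgn, Int.negOnePow_even a h]

theorem sgn_of_odd {a : ℤ} (h : Odd a) : sgn k a = -1 := by
  simp [sgn, Int.negOnePow_odd a h]

@[simp] theorem sgn_zero : sgn k 0 = 1 := sgn_of_even Even.zero

@[simp] theorem sgn_one : sgn k 1 = -1 := sgn_of_odd odd_one

theorem sgn_congr {a b : ℤ} (h : Even (a - b)) : sgn k a = sgn k b := by
  rw [← sub_add_cancel a b, sgn_add, sgn_of_even h, one_mul]

theorem sgn_mul_self (a : ℤ) : sgn k a * sgn k a = 1 := by
  rw [← sgn_add, sgn_of_even ⟨a, rfl⟩]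

theorem sgn_sq_smul {M : Type*} [AddCommGroup M] [Module k M] (a : ℤ) (x : M) :
    sgn k a • sgn k a • x = x := by
  rw [smul_smul, sgn_mul_self, one_smul]

end Sgn

section Parity

variable {k : Type u} {V : Type v} [Field k] [AddCommGroup V] [Module k V]
  (𝒱 : ℤ → Submodule k V) [DirectSum.Decomposition 𝒱]

theorem parityProj_of_mem {i : ℤ} {x : V} (hx : x ∈ 𝒱 i) (ε : Fin 2) :
    parityProj 𝒱 ε x = if i % 2 = ((ε : ℕ) : ℤ) then x else 0 := by
  rw [parityProj, LinearMap.comp_apply, LinearEquiv.coe_coe,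
    DirectSum.decomposeLinearEquiv_apply, DirectSum.decompose_of_mem 𝒱 hx,
    ← DirectSum.lof_eq_of k, DirectSum.toModule_lof]
  split_ifs <;> rfl

/-- Linear maps agree if they agree on homogeneous vectors. -/
theorem linearMap_ext_homogeneous {M : Type*} [AddCommGroup M] [Module k M] {f g : V →ₗ[k] M}
    (h : ∀ i, ∀ x ∈ 𝒱 i, f x = g x) : f = g := by
  ext x
  induction x using DirectSum.Decomposition.inductionOn 𝒱 with
  | zero => simp
  | homogeneous y => exact h _ _ y.2
  | add a b ha hb => rw [map_add, map_add, ha, hb]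

theorem parityProj_add (x : V) : parityProj 𝒱 0 x + parityProj 𝒱 1 x = x := by
  have : parityProj 𝒱 0 + parityProj 𝒱 1 = LinearMap.id := by
    refine linearMap_ext_homogeneous 𝒱 fun i x hx => ?_
    rw [LinearMap.add_apply, parityProj_of_mem 𝒱 hx, parityProj_of_mem 𝒱 hx]
    rcases Int.emod_two_eq_zero_or_one i with h | h <;> simp [h]
  exact LinearMap.congr_fun this x

theorem parityProj_parityProj (ε δ : Fin 2) (x : V) :
    parityProj 𝒱 ε (parityProj 𝒱 δ x) = if ε = δ then parityProj 𝒱 δ x else 0 := by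
  have : (parityProj 𝒱 ε).comp (parityProj 𝒱 δ) = if ε = δ then parityProj 𝒱 δ else 0 := by
    refine linearMap_ext_homogeneous 𝒱 fun i x hx => ?_
    have h2 : ∀ a b : Fin 2, (((a : ℕ) : ℤ) = ((b : ℕ) : ℤ)) ↔ a = b := by decide
    rw [LinearMap.comp_apply, parityProj_of_mem 𝒱 hx δ]
    by_cases h : i % 2 = ((δ : ℕ) : ℤ)
    · rw [if_pos h, parityProj_of_mem 𝒱 hx, h]
      split_ifs with h3 h4 h5
      · rw [parityProj_of_mem 𝒱 hx, if_pos h]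
      · exact absurd ((h2 _ _).1 h3).symm h4
      · exact absurd ((h2 _ _).2 h5.symm) h3
      · rfl
    · rw [if_neg h, map_zero]
      split_ifs
      · rw [parityProj_of_mem 𝒱 hx, if_neg h]
      · rfl
  have h := LinearMap.congr_fun this x
  rw [LinearMap.comp_apply] at h
  rw [h]
  split_ifs <;> rfl

/-- `x` lies in the part of parity `ε`. -/
def HasParity (ε : Fin 2) (x : V) : Prop := parityProj 𝒱 ε x = x

theorem hasParity_parityProj (ε : Fin 2) (x : V) : HasParity 𝒱 ε (parityProj 𝒱 ε x) := by
  rw [HasParity, parityProj_parityProj, if_pos rfl]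

variable {𝒱}

theorem HasParity.proj {ε : Fin 2} {x : V} (h : HasParity 𝒱 ε x) (δ : Fin 2) :
    parityProj 𝒱 δ x = if δ = ε then x else 0 := by
  rw [← h, parityProj_parityProj]

theorem hasParity_of_mem {i : ℤ} {x : V} (hx : x ∈ 𝒱 i) {ε : Fin 2}
    (h : i % 2 = ((ε : ℕ) : ℤ)) : HasParity 𝒱 ε x := by
  rw [HasParity, parityProj_of_mem 𝒱 hx, if_pos h]

/-- A linear identity on vectors of parity `ε` may be checked on homogeneous vectors. -/
theorem HasParity.linear_ext {M : Type*} [AddCommGroup M] [Module k M] {f g : V →ₗ[k] M}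
    {ε : Fin 2} (h : ∀ i x, x ∈ 𝒱 i → i % 2 = ((ε : ℕ) : ℤ) → f x = g x) {x : V}
    (hx : HasParity 𝒱 ε x) : f x = g x := by
  have : f.comp (parityProj 𝒱 ε) = g.comp (parityProj 𝒱 ε) := by
    refine linearMap_ext_homogeneous 𝒱 fun i x hx => ?_
    rw [LinearMap.comp_apply, LinearMap.comp_apply, parityProj_of_mem 𝒱 hx]
    split_ifs with h'
    · exact h i x hx h'
    · simp
  rw [← hx]
  exact LinearMap.congr_fun this x

variable (𝒱)

/-- Linear maps on `T^m(V)` agree if they agree on pure tensors of vectors of pure parity. -/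
theorem tensor_ext_parity {m : ℕ} {M : Type*} [AddCommGroup M] [Module k M]
    {f g : (⨂[k]^m V) →ₗ[k] M}
    (h : ∀ (ε : Fin m → Fin 2) (x : Fin m → V), (∀ i, HasParity 𝒱 (ε i) (x i)) →
      f (PiTensorProduct.tprod k x) = g (PiTensorProduct.tprod k x)) : f = g := by
  refine PiTensorProduct.ext (MultilinearMap.ext fun x => ?_)
  have hx : x = fun i => ∑ ε : Fin 2, parityProj 𝒱 ε (x i) := by
    funext i
    rw [Fin.sum_univ_two, parityProj_add]
  rw [hx, MultilinearMap.map_sum, MultilinearMap.map_sum]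
  exact Finset.sum_congr rfl fun ε _ => h ε _ fun i => hasParity_parityProj 𝒱 _ _

/-- `T^m(V)` is spanned by the pure tensors of homogeneous vectors. -/
theorem span_tprod_homogeneous (m : ℕ) :
    Submodule.span k {t : ⨂[k]^m V | ∃ (e : Fin m → ℤ) (x : Fin m → V),
      (∀ i, x i ∈ 𝒱 (e i)) ∧ t = PiTensorProduct.tprod k x} = ⊤ := by
  classical
  rw [eq_top_iff, ← PiTensorProduct.span_tprod_eq_top, Submodule.span_le]
  rintro _ ⟨x, rfl⟩
  have hx : x = fun i => ∑ e ∈ (DirectSum.decompose 𝒱 (x i)).support,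
      (DirectSum.decompose 𝒱 (x i) e : V) := by
    funext i
    rw [DirectSum.sum_support_decompose]
  rw [hx, MultilinearMap.map_sum_finset]
  refine Submodule.sum_mem _ fun e _ => Submodule.subset_span ⟨e, _, fun i => ?_, rfl⟩
  exact SetLike.coe_mem _

variable {𝒱}

theorem weightOp_tprod {m : ℕ} (w : (Fin m → Fin 2) → k) {ε : Fin m → Fin 2} {x : Fin m → V}
    (hx : ∀ i, HasParity 𝒱 (ε i) (x i)) :
    weightOp 𝒱 w (PiTensorProduct.tprod k x) = w ε • PiTensorProduct.tprod k x := by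
  rw [weightOp, LinearMap.sum_apply, Finset.sum_eq_single ε]
  · rw [LinearMap.smul_apply, PiTensorProduct.map_tprod]
    congr 2
    exact funext fun i => hx i
  · intro δ _ hδ
    obtain ⟨i, hi⟩ := Function.ne_iff.1 hδ
    rw [LinearMap.smul_apply, PiTensorProduct.map_tprod,
      MultilinearMap.map_coord_zero (m := fun i => parityProj 𝒱 (δ i) (x i)) _ i
        (by rw [(hx i).proj, if_neg hi]), smul_zero]
  · simp

theorem permAct_tprod {m : ℕ} (σ : Equiv.Perm (Fin m)) {ε : Fin m → Fin 2} {x : Fin m → V}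
    (hx : ∀ i, HasParity 𝒱 (ε i) (x i)) :
    permAct 𝒱 σ (PiTensorProduct.tprod k x) =
      koszulSign k σ ε • PiTensorProduct.tprod k fun i => x (σ.symm i) := by
  rw [permAct, LinearMap.comp_apply, weightOp_tprod _ hx, map_smul, LinearEquiv.coe_coe,
    PiTensorProduct.reindex_tprod]

end Parity

section Componentwise

variable {k : Type u} {H : Type v} [Field k] [Ring H] [Algebra k H]
  {𝒜 : ℤ → Submodule k H} [GradedAlgebra 𝒜]

theorem componentwise_tprod {m : ℕ} (w : (Fin m → Fin 2) → (Fin m → Fin 2) → k)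
    {ε δ : Fin m → Fin 2} {x y : Fin m → H} (hx : ∀ i, HasParity 𝒜 (ε i) (x i))
    (hy : ∀ i, HasParity 𝒜 (δ i) (y i)) :
    componentwise 𝒜 w (PiTensorProduct.tprod k x) (PiTensorProduct.tprod k y) =
      w ε δ • PiTensorProduct.tprod k fun i => x i * y i := by
  have key : ∀ (ε : Fin m → Fin 2) (x : Fin m → H) (δ : Fin m → Fin 2),
      (∀ i, HasParity 𝒜 (ε i) (x i)) → PiTensorProduct.map (fun i => parityProj 𝒜 (δ i))
        (PiTensorProduct.tprod k x) = if δ = ε then PiTensorProduct.tprod k x else 0 := by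
    intro ε x δ hx
    rw [PiTensorProduct.map_tprod]
    split_ifs with h
    · subst h
      congr 1
      exact funext fun i => hx i
    · obtain ⟨i, hi⟩ := Function.ne_iff.1 h
      exact MultilinearMap.map_coord_zero (m := fun i => parityProj 𝒜 (δ i) (x i)) _ i
        (by rw [(hx i).proj, if_neg hi])
  rw [componentwise, LinearMap.sum_apply, LinearMap.sum_apply, Finset.sum_eq_single ε,
    LinearMap.sum_apply, LinearMap.sum_apply, Finset.sum_eq_single δ]
  · rw [LinearMap.smul_apply, LinearMap.smul_apply, LinearMap.compl₁₂_apply, key ε x ε hx,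
      key δ y δ hy, if_pos rfl, if_pos rfl, PiTensorProduct.map₂_tprod_tprod]
    rfl
  · intro δ' _ h
    rw [LinearMap.smul_apply, LinearMap.smul_apply, LinearMap.compl₁₂_apply, key δ y δ' hy,
      if_neg h, map_zero, smul_zero]
  · simp
  · intro ε' _ h
    rw [LinearMap.sum_apply, LinearMap.sum_apply]
    refine Finset.sum_eq_zero fun δ' _ => ?_
    rw [LinearMap.smul_apply, LinearMap.smul_apply, LinearMap.compl₁₂_apply, key ε x ε' hx,
      if_neg h, map_zero, LinearMap.zero_apply, smul_zero]
  · simp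

end Componentwise

/-! ### Ordered products of letters which commute up to sign -/

section Ordered

variable {k : Type u} {B : Type v} [Field k] [Ring B] [Algebra k B]

theorem ofFn_prod_mul_comm {m : ℕ} (a : Fin m → B) (b : B) (s : Fin m → ℤ)
    (h : ∀ i, a i * b = sgn k (s i) • (b * a i)) :
    (List.ofFn a).prod * b = sgn k (∑ i, s i) • (b * (List.ofFn a).prod) := by
  induction m with
  | zero => simp
  | succ m ih =>
    rw [List.ofFn_succ, List.prod_cons, mul_assoc, ih _ (fun i => s i.succ) fun i => h _,
      mul_smul_comm, ← mul_assoc, h, smul_mul_assoc, smul_smul, mul_assoc, Fin.sum_univ_succ,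
      sgn_add, mul_comm]

/-- The product of `a₁ ⋯ aₘ` and `b₁ ⋯ bₘ`: the sign comes from moving each `bᵢ` to the left of the
`aⱼ` with `i < j`. -/
theorem ofFn_prod_mul_ofFn_prod {m : ℕ} (a b : Fin m → B) (s : Fin m → Fin m → ℤ)
    (h : ∀ i j, i < j → a j * b i = sgn k (s i j) • (b i * a j)) :
    (List.ofFn a).prod * (List.ofFn b).prod =
      sgn k (∑ j, ∑ i, if i < j then s i j else 0) • (List.ofFn fun i => a i * b i).prod := by
  induction m with
  | zero => simp
  | succ m ih =>
    have h1 := ofFn_prod_mul_comm (fun i : Fin m => a i.succ) (b 0) (fun i => s 0 i.succ)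
      fun i => h _ _ (Fin.succ_pos i)
    have h2 := ih (fun i => a i.succ) (fun i => b i.succ) (fun i j => s i.succ j.succ)
      fun i j hij => h _ _ (Fin.succ_lt_succ_iff.2 hij)
    simp only [List.ofFn_succ, List.prod_cons]
    rw [mul_assoc, ← mul_assoc _ (b 0), h1, smul_mul_assoc, mul_smul_comm, mul_assoc, h2,
      mul_smul_comm, mul_smul_comm, smul_smul, ← sgn_add, ← mul_assoc]
    congr 2
    simp [Fin.sum_univ_succ, Finset.sum_add_distrib]

/-- The letter in position `p` is moved to the front of the product. -/
theorem ofFn_prod_pull {m : ℕ} (a : Fin (m + 1) → B) (p : Fin (m + 1)) (s : Fin (m + 1) → ℤ)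
    (h : ∀ i, i < p → a i * a p = sgn k (s i) • (a p * a i)) :
    (List.ofFn a).prod =
      sgn k (∑ i, if i < p then s i else 0) •
        (a p * (List.ofFn fun i => a (p.succAbove i)).prod) := by
  induction m with
  | zero =>
    obtain rfl : p = 0 := Fin.ext (by omega)
    simp
  | succ m ih =>
    rw [List.ofFn_succ, List.prod_cons]
    refine Fin.cases ?_ (fun p h => ?_) p h
    · intro _
      simp
    · rw [ih (fun i => a i.succ) p (fun i => s i.succ)
        fun i hi => h _ (Fin.succ_lt_succ_iff.2 hi), mul_smul_comm, ← mul_assoc,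
        h 0 (Fin.succ_pos p), smul_mul_assoc, smul_smul, ← sgn_add, mul_assoc]
      congr 2
      · simp [Fin.sum_univ_succ, add_comm]
      · rw [List.ofFn_succ, List.prod_cons]
        simp

/-- Removing the position which `τ` moves to the front leaves a permutation of one letter less. -/
theorem exists_perm_succAbove {m : ℕ} (τ : Equiv.Perm (Fin (m + 1))) :
    ∃ τ' : Equiv.Perm (Fin m), ∀ i, τ ((τ.symm 0).succAbove i) = (τ' i).succ := by
  have hne : ∀ i, τ ((τ.symm 0).succAbove i) ≠ 0 := fun i h => by
    rw [← Equiv.eq_symm_apply] at h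
    exact Fin.succAbove_ne _ _ h
  refine ⟨Equiv.ofBijective (fun i => (τ ((τ.symm 0).succAbove i)).pred (hne i))
    (Finite.injective_iff_bijective.1 fun i j hij => ?_), fun i => ?_⟩
  · have := τ.injective (Fin.pred_inj.1 hij)
    exact Fin.succAbove_right_injective this
  · simp

/-- Reordering a product of letters `a₁ ⋯ aₘ` which commute up to sign produces the Koszul
sign. -/
theorem ofFn_prod_perm {m : ℕ} (τ : Equiv.Perm (Fin m)) (a : Fin m → B) (ε : Fin m → Fin 2)
    (h : ∀ i j, i ≠ j → a i * a j =
      sgn k (((ε i : ℕ) : ℤ) * ((ε j : ℕ) : ℤ)) • (a j * a i)) :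
    (List.ofFn a).prod = koszulSign k τ ε • (List.ofFn fun j => a (τ.symm j)).prod := by
  induction m with
  | zero => simp [koszulSign]
  | succ m ih =>
    -- The letter which comes first after the permutation is moved to the front; the inversions of
    -- `τ` are those which involve this letter, and those of the remaining permutation.
    obtain ⟨τ', hτ'⟩ := exists_perm_succAbove τ
    have h1 : τ (τ.symm 0) = 0 := τ.apply_symm_apply 0
    have h2 : ∀ j, τ.symm j.succ = (τ.symm 0).succAbove (τ'.symm j) := fun j => by
      rw [Equiv.symm_apply_eq, hτ', Equiv.apply_symm_apply]
    rw [ofFn_prod_pull a (τ.symm 0) _ fun i hi => h i _ hi.ne,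
      ih τ' (fun i => a ((τ.symm 0).succAbove i)) (fun i => ε ((τ.symm 0).succAbove i))
        fun i j hij => h _ _ (Fin.succAbove_right_injective.ne hij),
      mul_smul_comm, smul_smul, List.ofFn_succ, List.prod_cons]
    simp only [h2]
    congr 1
    rw [koszulSign, koszulSign, ← sgn_add]
    congr 1
    conv_rhs => rw [Fin.sum_univ_succAbove _ (τ.symm 0)]
    conv_lhs =>
      enter [1]
      rw [Fin.sum_univ_succAbove _ (τ.symm 0)]
    simp only [h1, Fin.not_lt_zero, and_false, if_false, Finset.sum_const_zero, zero_add,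
      lt_self_iff_false]
    rw [← Finset.sum_add_distrib]
    refine Finset.sum_congr rfl fun i _ => ?_
    rw [Fin.sum_univ_succAbove _ (τ.symm 0)]
    simp only [h1, hτ', Fin.succ_pos, and_true, Fin.succ_lt_succ_iff,
      Fin.succAbove_lt_succAbove_iff]

end Ordered

/-! ### Evaluating a tensor on letters -/

section Letters

variable {k : Type u} {V : Type v} {B : Type*} [Field k] [AddCommGroup V] [Module k V] [Ring B]
  [Algebra k B]

/-- The map `x₁ ⊗ ⋯ ⊗ xₘ ↦ g₁(x₁) ⋯ gₘ(xₘ)` to an algebra. -/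
def letters {m : ℕ} (g : Fin m → V →ₗ[k] B) : (⨂[k]^m V) →ₗ[k] B :=
  PiTensorProduct.lift ((MultilinearMap.mkPiAlgebraFin k m B).compLinearMap g)

theorem letters_tprod {m : ℕ} (g : Fin m → V →ₗ[k] B) (x : Fin m → V) :
    letters g (PiTensorProduct.tprod k x) = (List.ofFn fun i => g i (x i)).prod := by
  rw [letters, PiTensorProduct.lift.tprod, MultilinearMap.compLinearMap_apply,
    MultilinearMap.mkPiAlgebraFin_apply]

theorem algHom_letters {B' : Type*} [Ring B'] [Algebra k B'] (f : B →ₐ[k] B') {m : ℕ}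
    (g : Fin m → V →ₗ[k] B) (t : ⨂[k]^m V) :
    f (letters g t) = letters (fun i => f.toLinearMap.comp (g i)) t := by
  have : f.toLinearMap.comp (letters g) = letters (fun i => f.toLinearMap.comp (g i)) := by
    refine PiTensorProduct.ext (MultilinearMap.ext fun x => ?_)
    simp only [LinearMap.compMultilinearMap_apply, LinearMap.comp_apply, letters_tprod,
      AlgHom.toLinearMap_apply, map_list_prod, List.map_ofFn]
    rfl
  exact LinearMap.congr_fun this t

/-- Permuting letters which commute up to sign amounts to acting on the tensor. -/
theorem letters_perm (𝒱 : ℤ → Submodule k V) [DirectSum.Decomposition 𝒱] {m : ℕ}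
    (g : Fin m → V →ₗ[k] B)
    (hg : ∀ i j, i ≠ j → ∀ (ε δ : Fin 2) (x y : V), HasParity 𝒱 ε x → HasParity 𝒱 δ y →
      g i x * g j y = sgn k (((ε : ℕ) : ℤ) * ((δ : ℕ) : ℤ)) • (g j y * g i x))
    (τ : Equiv.Perm (Fin m)) (t : ⨂[k]^m V) :
    letters (fun i => g (τ i)) t = letters g (permAct 𝒱 τ t) := by
  have : letters (fun i => g (τ i)) = (letters g).comp (permAct 𝒱 τ) := by
    refine tensor_ext_parity 𝒱 fun ε x hx => ?_
    rw [LinearMap.comp_apply, permAct_tprod τ hx, map_smul, letters_tprod, letters_tprod,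
      ofFn_prod_perm τ _ ε fun i j hij => hg _ _ (τ.injective.ne hij) _ _ _ _ (hx i) (hx j)]
    simp
  exact LinearMap.congr_fun this t

theorem letters_mulEquiv {p q : ℕ} (g : Fin (p + q) → V →ₗ[k] B) (s : ⨂[k]^p V) (t : ⨂[k]^q V) :
    letters g (TensorPower.mulEquiv (s ⊗ₜ[k] t)) =
      letters (fun i => g (Fin.castAdd q i)) s * letters (fun j => g (Fin.natAdd p j)) t := by
  have : (TensorProduct.mk k _ _).compr₂
        ((letters g).comp (TensorPower.mulEquiv (R := k) (M := V) (n := p) (m := q)).toLinearMap) =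
      (LinearMap.mul k B).compl₁₂ (letters fun i => g (Fin.castAdd q i))
        (letters fun j => g (Fin.natAdd p j)) := by
    refine PiTensorProduct.ext (MultilinearMap.ext fun x =>
      PiTensorProduct.ext (MultilinearMap.ext fun y => ?_))
    simp only [LinearMap.compMultilinearMap_apply, LinearMap.compr₂_apply,
      TensorProduct.mk_apply, LinearMap.comp_apply, LinearEquiv.coe_coe,
      LinearMap.compl₁₂_apply, LinearMap.mul_apply', letters_tprod]
    rw [← TensorPower.gMul_def, TensorPower.tprod_mul_tprod, letters_tprod, List.ofFn_add,
      List.prod_append]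
    simp
    rfl
  exact LinearMap.congr_fun (LinearMap.congr_fun this s) t

theorem letters_deconcat {m p q : ℕ} (h : m = p + q) (g : Fin m → V →ₗ[k] B)
    (t : ⨂[k]^m V) :
    LinearMap.mul' k B (TensorProduct.map (letters fun i => g (Fin.cast h.symm (Fin.castAdd q i)))
      (letters fun j => g (Fin.cast h.symm (Fin.natAdd p j))) (deconcat k V h t)) =
      letters g t := by
  subst h
  obtain ⟨t, rfl⟩ := (TensorPower.mulEquiv (R := k) (M := V) (n := p) (m := q)).surjective t
  rw [deconcat, LinearMap.comp_apply, LinearEquiv.coe_coe, TensorPower.cast_refl,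
    LinearEquiv.coe_coe, LinearEquiv.refl_apply, LinearEquiv.symm_apply_apply]
  induction t with
  | zero => simp
  | tmul s t =>
    rw [TensorProduct.map_tmul, LinearMap.mul'_apply, letters_mulEquiv]
    rfl
  | add a b ha hb => simp only [map_add, ha, hb]

end Letters

/-! ### The algebra `E₁`: relations and universal property -/

section Relations

variable {k : Type u} {H : Type v} [Field k] [Ring H] [Algebra k H]
  {𝒜 : ℤ → Submodule k H} {N n : ℕ}

variable (𝒜 N n) in
/-- The algebra `E₁`, as a type of its own: a copy of `EOne` whose ring structure is not unfolded
by instance search. -/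
def CT : Type (max u v) := EOne 𝒜 N n

instance : Ring (CT 𝒜 N n) := inferInstanceAs (Ring (EOne 𝒜 N n))

instance : Algebra k (CT 𝒜 N n) := inferInstanceAs (Algebra k (EOne 𝒜 N n))

variable (𝒜 N n) in
/-- The identification of `EOne` with its copy `CT`. -/
def toCT : EOne 𝒜 N n ≃ₐ[k] CT 𝒜 N n where
  toFun x := x
  invFun x := x
  left_inv _ := rfl
  right_inv _ := rfl
  map_mul' _ _ := rfl
  map_add' _ _ := rfl
  commutes' _ := rfl

variable (𝒜 N n) in
/-- The quotient map from the free algebra. -/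
def mkCT : FreeAlgebra k (Gen H n) →ₐ[k] CT 𝒜 N n :=
  (toCT 𝒜 N n).toAlgHom.comp (RingQuot.mkAlgHom k (Rel 𝒜 N n))

theorem mkCT_rel {x y : FreeAlgebra k (Gen H n)} (h : Rel 𝒜 N n x y) :
    mkCT 𝒜 N n x = mkCT 𝒜 N n y :=
  congrArg (toCT 𝒜 N n) (RingQuot.mkAlgHom_rel k h)

theorem mkCT_surjective : Function.Surjective (mkCT 𝒜 N n) :=
  (toCT 𝒜 N n).surjective.comp (RingQuot.mkAlgHom_surjective k _)

variable (𝒜 N) in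
/-- The linear map `p_i^* : H → E₁`. -/
def pt (i : Fin n) : H →ₗ[k] CT 𝒜 N n := (toCT 𝒜 N n).toLinearMap.comp (pGen 𝒜 N i)

theorem pt_eq (i : Fin n) (a : H) : pt 𝒜 N i a = mkCT 𝒜 N n (freeP k i a) := rfl

theorem pt_one (i : Fin n) : pt 𝒜 N i 1 = 1 := (mkCT_rel (Rel.p_one i)).trans (map_one _)

theorem pt_mul (i : Fin n) (a b : H) : pt 𝒜 N i (a * b) = pt 𝒜 N i a * pt 𝒜 N i b :=
  (mkCT_rel (Rel.p_mul i a b)).trans (map_mul _ _ _)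

variable (𝒜 N) in
/-- `p_i^*` as a morphism of algebras. -/
def pHom (i : Fin n) : H →ₐ[k] CT 𝒜 N n :=
  AlgHom.ofLinearMap (pt 𝒜 N i) (pt_one i) (pt_mul i)

@[simp] theorem pHom_apply (i : Fin n) (a : H) : pHom 𝒜 N i a = pt 𝒜 N i a := rfl

variable (𝒜 N) in
/-- The class `e_{ij}`, extended by `e_{ii} = 0`. With this convention the relations of `E₁` hold
without restriction on the indices. -/
def eg (i j : Fin n) : CT 𝒜 N n := if h : i ≠ j then mkCT 𝒜 N n (freeE k H i j h) else 0

theorem eg_of_ne {i j : Fin n} (h : i ≠ j) : eg 𝒜 N i j = mkCT 𝒜 N n (freeE k H i j h) :=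
  dif_pos h

@[simp] theorem eg_self (i : Fin n) : eg 𝒜 N i i = 0 := dif_neg (by simp)

theorem eg_sq (i j : Fin n) : eg 𝒜 N i j * eg 𝒜 N i j = 0 := by
  by_cases h : i = j
  · simp [h]
  · rw [eg_of_ne h]
    simpa using mkCT_rel (Rel.e_sq (𝒜 := 𝒜) (N := N) i j h)

theorem pt_mul_eg (i j : Fin n) (a : H) :
    pt 𝒜 N i a * eg 𝒜 N i j = pt 𝒜 N j a * eg 𝒜 N i j := by
  by_cases h : i = j
  · simp [h]
  · rw [eg_of_ne h, pt_eq, pt_eq]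
    simpa using mkCT_rel (Rel.p_e (𝒜 := 𝒜) (N := N) i j h a)

section Even

variable [hN : Fact (Even N)]

theorem odd_pred (N : ℕ) [hN : Fact (Even N)] : Odd ((N : ℤ) - 1) :=
  Even.sub_odd ((Int.even_coe_nat N).2 hN.out) odd_one

theorem eg_symm (i j : Fin n) : eg 𝒜 N i j = eg 𝒜 N j i := by
  by_cases h : i = j
  · simp [h]
  · rw [eg_of_ne h, eg_of_ne (Ne.symm h)]
    have := mkCT_rel (Rel.e_symm (𝒜 := 𝒜) (N := N) i j h)
    rw [sgn_of_even ((Int.even_coe_nat N).2 hN.out), one_smul] at this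
    exact this

theorem eg_comm (i j l m : Fin n) :
    eg 𝒜 N i j * eg 𝒜 N l m = -(eg 𝒜 N l m * eg 𝒜 N i j) := by
  by_cases h : i = j
  · simp [h]
  by_cases h' : l = m
  · simp [h']
  rw [eg_of_ne h, eg_of_ne h']
  have := mkCT_rel (Rel.e_comm (𝒜 := 𝒜) (N := N) i j l m h h')
  rw [sgn_of_odd ((odd_pred N).mul (odd_pred N))] at this
  simpa using this

theorem eg_mul_pt (i j l : Fin n) {s : ℤ} {a : H} (ha : a ∈ 𝒜 s) :
    eg 𝒜 N i j * pt 𝒜 N l a = sgn k s • (pt 𝒜 N l a * eg 𝒜 N i j) := by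
  by_cases h : i = j
  · simp [h]
  rw [eg_of_ne h]
  have := mkCT_rel (Rel.e_p_comm (𝒜 := 𝒜) (N := N) i j l h s a ha)
  have h2 : sgn k (((N : ℤ) - 1) * s) = sgn k s := sgn_congr (by
    obtain ⟨c, hc⟩ := odd_pred N
    rw [hc]
    exact ⟨c * s, by ring⟩)
  rw [h2] at this
  simpa [pt_eq] using this

theorem eg_arnold (i j l : Fin n) :
    eg 𝒜 N i j * eg 𝒜 N j l + eg 𝒜 N j l * eg 𝒜 N l i + eg 𝒜 N l i * eg 𝒜 N i j = 0 := by
  by_cases h : i = j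
  · subst h
    rw [eg_symm l i]
    simp [eg_sq]
  by_cases h' : j = l
  · subst h'
    rw [eg_symm j i]
    simp [eg_sq]
  by_cases h'' : l = i
  · subst h''
    rw [eg_symm j l]
    simp [eg_sq]
  rw [eg_of_ne h, eg_of_ne h', eg_of_ne h'']
  simpa using mkCT_rel (Rel.e_arnold (𝒜 := 𝒜) (N := N) i j l h h' h'')

end Even

theorem pt_comm [hH : Fact (IsGradedCommutative 𝒜)] (i j : Fin n) {s t : ℤ} {a b : H}
    (ha : a ∈ 𝒜 s) (hb : b ∈ 𝒜 t) :
    pt 𝒜 N i a * pt 𝒜 N j b = sgn k (s * t) • (pt 𝒜 N j b * pt 𝒜 N i a) := by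
  by_cases h : i = j
  · subst h
    rw [← pt_mul, hH.out s t a b ha hb, map_smul, pt_mul]
  · simpa [pt_eq] using mkCT_rel (Rel.p_comm (𝒜 := 𝒜) (N := N) i j h s t a b ha hb)

end Relations

section Universal

variable {k : Type u} {H : Type v} [Field k] [Ring H] [Algebra k H]
  {𝒜 : ℤ → Submodule k H} {N n : ℕ} {B : Type*} [Ring B] [Algebra k B]

variable (𝒜) in
/-- The relations of `E₁`, for `N` even, imposed on elements of an algebra `B`. -/
structure IsRep (P : Fin n → H →ₐ[k] B) (e : Fin n → Fin n → B) : Prop where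
  p_comm : ∀ i j, i ≠ j → ∀ (s t : ℤ) (a b : H), a ∈ 𝒜 s → b ∈ 𝒜 t →
    P i a * P j b = sgn k (s * t) • (P j b * P i a)
  e_p : ∀ i j l, i ≠ j → ∀ (s : ℤ) (a : H), a ∈ 𝒜 s → e i j * P l a = sgn k s • (P l a * e i j)
  e_comm : ∀ i j l m, i ≠ j → l ≠ m → e i j * e l m = -(e l m * e i j)
  arnold : ∀ i j l, i ≠ j → j ≠ l → l ≠ i → e i j * e j l + e j l * e l i + e l i * e i j = 0
  sq : ∀ i j, i ≠ j → e i j * e i j = 0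
  symm : ∀ i j, i ≠ j → e i j = e j i
  p_e : ∀ i j, i ≠ j → ∀ a, P i a * e i j = P j a * e i j

variable {P : Fin n → H →ₐ[k] B} {e : Fin n → Fin n → B}

/-- The values on generators of the morphism defined by a representation of the relations. -/
def rept (P : Fin n → H →ₐ[k] B) (e : Fin n → Fin n → B) : Gen H n → B
  | Gen.p i a => P i a
  | Gen.e i j _ => e i j

variable (N) in
/-- The morphism of algebras from `E₁` given by the images of the generators. -/
def liftE [hN : Fact (Even N)] (h : IsRep 𝒜 P e) : CT 𝒜 N n →ₐ[k] B :=
  RingQuot.liftAlgHom k ⟨FreeAlgebra.lift k (rept P e), by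
    intro x y hxy
    cases hxy with
    | p_add i a b => simp [rept]
    | p_smul i c a => simp [rept]
    | p_one i => simp [rept]
    | p_mul i a b => simp [rept]
    | p_comm i j hij s t a b ha hb => simpa [rept] using h.p_comm i j hij s t a b ha hb
    | e_p_comm i j l hij s a ha =>
      have h2 : sgn k (((N : ℤ) - 1) * s) = sgn k s := sgn_congr (by
        obtain ⟨c, hc⟩ := odd_pred N
        rw [hc]
        exact ⟨c * s, by ring⟩)
      rw [h2]
      simpa [rept] using h.e_p i j l hij s a ha
    | e_comm i j l m hij hlm =>
      rw [sgn_of_odd ((odd_pred N).mul (odd_pred N))]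
      simpa [rept] using h.e_comm i j l m hij hlm
    | e_arnold i j l hij hjl hli => simpa [rept] using h.arnold i j l hij hjl hli
    | e_sq i j hij => simpa [rept] using h.sq i j hij
    | e_symm i j hij =>
      rw [sgn_of_even ((Int.even_coe_nat N).2 hN.out), one_smul]
      simpa [rept] using h.symm i j hij
    | p_e i j hij a => simpa [rept] using h.p_e i j hij a⟩

/-- `E₁` is spanned by what arises from `1` by left multiplication by generators. -/
theorem eOne_induction [GradedAlgebra 𝒜] {C : CT 𝒜 N n → Prop} (one : C 1)
    (add : ∀ x y, C x → C y → C (x + y)) (smul : ∀ (c : k) x, C x → C (c • x))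
    (p_mul : ∀ (i : Fin n) (s : ℤ) (a : H), a ∈ 𝒜 s → ∀ x, C x → C (pt 𝒜 N i a * x))
    (e_mul : ∀ i j : Fin n, i ≠ j → ∀ x, C x → C (eg 𝒜 N i j * x)) (x : CT 𝒜 N n) : C x := by
  obtain ⟨y, rfl⟩ := mkCT_surjective x
  suffices h : ∀ z, C z → C (mkCT 𝒜 N n y * z) by
    simpa using h 1 one
  induction y using FreeAlgebra.induction with
  | grade0 c =>
    intro z hz
    rw [AlgHom.commutes, ← Algebra.smul_def]
    exact smul c z hz
  | grade1 g =>
    intro z hz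
    cases g with
    | p i a =>
      change C (pt 𝒜 N i a * z)
      induction a using DirectSum.Decomposition.inductionOn 𝒜 with
      | zero => simpa using smul 0 _ one
      | homogeneous a => exact p_mul i _ a a.2 z hz
      | add a b ha hb =>
        rw [map_add, add_mul]
        exact add _ _ ha hb
    | e i j h =>
      have := e_mul i j h z hz
      rwa [eg_of_ne h] at this
  | mul a b ha hb =>
    intro z hz
    rw [map_mul, mul_assoc]
    exact ha _ (hb z hz)
  | add a b ha hb =>
    intro z hz
    rw [map_add, add_mul]
    exact add _ _ (ha z hz) (hb z hz)

theorem eOne_algHom_ext [GradedAlgebra 𝒜] {f g : CT 𝒜 N n →ₐ[k] B}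
    (hp : ∀ i s, ∀ a ∈ 𝒜 s, f (pt 𝒜 N i a) = g (pt 𝒜 N i a))
    (he : ∀ i j, i ≠ j → f (eg 𝒜 N i j) = g (eg 𝒜 N i j)) : f = g := by
  ext x
  induction x using eOne_induction with
  | one => rw [map_one, map_one]
  | add x y hx hy => rw [map_add, map_add, hx, hy]
  | smul c x hx => rw [map_smul, map_smul, hx]
  | p_mul i s a ha x hx => rw [map_mul, map_mul, hx, hp i s a ha]
  | e_mul i j h x hx => rw [map_mul, map_mul, hx, he i j h]

variable [hN : Fact (Even N)]

@[simp] theorem liftE_pt (h : IsRep 𝒜 P e) (i : Fin n) (a : H) :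
    liftE N h (pt 𝒜 N i a) = P i a := by
  refine (RingQuot.liftAlgHom_mkAlgHom_apply ..).trans ?_
  simp [rept]

theorem liftE_eg (h : IsRep 𝒜 P e) {i j : Fin n} (hij : i ≠ j) :
    liftE N h (eg 𝒜 N i j) = e i j := by
  rw [eg_of_ne hij]
  refine (RingQuot.liftAlgHom_mkAlgHom_apply ..).trans ?_
  simp [rept]

theorem liftE_eg' (h : IsRep 𝒜 P e) (he : ∀ i, e i i = 0) (i j : Fin n) :
    liftE N h (eg 𝒜 N i j) = e i j := by
  by_cases hij : i = j
  · subst hij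
    rw [eg_self, map_zero, he]
  · exact liftE_eg h hij

end Universal

section ParityInvolution

variable {k : Type u} {H : Type v} [Field k] [Ring H] [Algebra k H]
  {𝒜 : ℤ → Submodule k H} [GradedAlgebra 𝒜]

variable (𝒜) in
/-- The involution of `H` which is `(-1)^s` in degree `s`. -/
def parityInv : H →ₐ[k] H :=
  AlgHom.ofLinearMap (parityProj 𝒜 0 - parityProj 𝒜 1)
    (by
      have h : (1 : H) ∈ 𝒜 0 := SetLike.GradedOne.one_mem
      rw [LinearMap.sub_apply, parityProj_of_mem 𝒜 h, parityProj_of_mem 𝒜 h]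
      simp)
    (by
      have key : ∀ s, ∀ a ∈ 𝒜 s, (parityProj 𝒜 0 - parityProj 𝒜 1) a = sgn k s • a := by
        intro s a ha
        rw [LinearMap.sub_apply, parityProj_of_mem 𝒜 ha, parityProj_of_mem 𝒜 ha]
        rcases Int.even_or_odd s with h | h
        · simp [sgn_of_even h, Int.even_iff.1 h]
        · simp [sgn_of_odd h, Int.odd_iff.1 h]
      suffices h : (LinearMap.mul k H).compr₂ (parityProj 𝒜 0 - parityProj 𝒜 1) =
          (LinearMap.mul k H).compl₁₂ (parityProj 𝒜 0 - parityProj 𝒜 1)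
            (parityProj 𝒜 0 - parityProj 𝒜 1) from
        fun x y => LinearMap.congr_fun (LinearMap.congr_fun h x) y
      refine linearMap_ext_homogeneous 𝒜 fun s a ha => linearMap_ext_homogeneous 𝒜
        fun t b hb => ?_
      rw [LinearMap.compr₂_apply, LinearMap.compl₁₂_apply, LinearMap.mul_apply',
        LinearMap.mul_apply', key _ _ ha, key _ _ hb,
        key _ _ (SetLike.GradedMul.mul_mem ha hb), sgn_add, smul_mul_smul_comm])

theorem parityInv_of_mem {s : ℤ} {a : H} (ha : a ∈ 𝒜 s) : parityInv 𝒜 a = sgn k s • a := by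
  change (parityProj 𝒜 0 - parityProj 𝒜 1) a = sgn k s • a
  rw [LinearMap.sub_apply, parityProj_of_mem 𝒜 ha, parityProj_of_mem 𝒜 ha]
  rcases Int.even_or_odd s with h | h
  · simp [sgn_of_even h, Int.even_iff.1 h]
  · simp [sgn_of_odd h, Int.odd_iff.1 h]

end ParityInvolution

/-! ### Morphisms between the algebras `E₁` -/

section Morphisms

variable {k : Type u} {H : Type v} [Field k] [Ring H] [Algebra k H]
  {𝒜 : ℤ → Submodule k H} {N n : ℕ} [hN : Fact (Even N)] [hH : Fact (IsGradedCommutative 𝒜)]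

theorem isRep_relabel (f : Fin n → Fin n) :
    IsRep 𝒜 (fun i => pHom 𝒜 N (f i)) (fun i j => eg 𝒜 N (f i) (f j)) where
  p_comm _ _ _ _ _ _ _ ha hb := pt_comm _ _ ha hb
  e_p _ _ _ _ _ _ ha := eg_mul_pt _ _ _ ha
  e_comm _ _ _ _ _ _ := eg_comm _ _ _ _
  arnold _ _ _ _ _ _ := eg_arnold _ _ _
  sq _ _ _ := eg_sq _ _
  symm _ _ _ := eg_symm _ _
  p_e _ _ _ _ := pt_mul_eg _ _ _

variable (𝒜 N) in
/-- The endomorphism of `E₁` induced by an arbitrary self-map `f` of the set of points: points with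
the same image are made to collide, `e_{ij}` becoming `0` if `f i = f j`. -/
def relabel (f : Fin n → Fin n) : CT 𝒜 N n →ₐ[k] CT 𝒜 N n := liftE N (isRep_relabel f)

@[simp] theorem relabel_pt (f : Fin n → Fin n) (i : Fin n) (a : H) :
    relabel 𝒜 N f (pt 𝒜 N i a) = pt 𝒜 N (f i) a := by simp [relabel]

@[simp] theorem relabel_eg (f : Fin n → Fin n) (i j : Fin n) :
    relabel 𝒜 N f (eg 𝒜 N i j) = eg 𝒜 N (f i) (f j) := liftE_eg' _ (by simp) i j

theorem toCT_permEOne [GradedAlgebra 𝒜] (σ : Equiv.Perm (Fin n)) (x : EOne 𝒜 N n) :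
    toCT 𝒜 N n (permEOne 𝒜 N σ x) = relabel 𝒜 N σ (toCT 𝒜 N n x) := by
  have : ((toCT 𝒜 N n).toAlgHom.comp (permEOne 𝒜 N σ)).comp (toCT 𝒜 N n).symm.toAlgHom =
      relabel 𝒜 N σ := by
    refine eOne_algHom_ext (fun i s a _ => ?_) (fun i j h => ?_)
    · rw [relabel_pt]
      refine (congrArg (toCT 𝒜 N n) (RingQuot.liftAlgHom_mkAlgHom_apply ..)).trans ?_
      rw [FreeAlgebra.lift_ι_apply]
      rfl
    · rw [relabel_eg, eg_of_ne h, eg_of_ne (σ.injective.ne h)]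
      refine (congrArg (toCT 𝒜 N n) (RingQuot.liftAlgHom_mkAlgHom_apply ..)).trans ?_
      rw [FreeAlgebra.lift_ι_apply]
      rfl
  exact AlgHom.congr_fun this (toCT 𝒜 N n x)

theorem relabel_relabel [GradedAlgebra 𝒜] (f g : Fin n → Fin n) (x : CT 𝒜 N n) :
    relabel 𝒜 N f (relabel 𝒜 N g x) = relabel 𝒜 N (f ∘ g) x := by
  have : (relabel 𝒜 N f).comp (relabel 𝒜 N g) = relabel 𝒜 N (f ∘ g) :=
    eOne_algHom_ext (fun i s a _ => by simp) (fun i j h => by simp)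
  exact AlgHom.congr_fun this x

theorem relabel_id [GradedAlgebra 𝒜] (x : CT 𝒜 N n) : relabel 𝒜 N id x = x := by
  have : relabel 𝒜 N (n := n) id = AlgHom.id k _ :=
    eOne_algHom_ext (fun i s a _ => by simp) (fun i j h => by simp)
  exact AlgHom.congr_fun this x

/-- A symmetric relation on the points which is transitive on distinct points. -/
structure IsBlockRel (c : Fin n → Fin n → Prop) : Prop where
  symm : ∀ i j, c i j → c j i
  trans : ∀ i j l, i ≠ l → c i j → c j l → c i l

open Classical in
theorem isRep_restrict {c : Fin n → Fin n → Prop} (hc : IsBlockRel c) :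
    IsRep 𝒜 (pHom 𝒜 N) (fun i j => if c i j then eg 𝒜 N i j else 0) where
  p_comm _ _ _ _ _ _ _ ha hb := pt_comm _ _ ha hb
  e_p i j _ _ _ _ ha := by
    split_ifs
    · exact eg_mul_pt _ _ _ ha
    · simp
  e_comm i j l m _ _ := by
    split_ifs
    · exact eg_comm _ _ _ _
    all_goals simp
  arnold i j l hij hjl hli := by
    by_cases h1 : c i j <;> by_cases h2 : c j l <;> by_cases h3 : c l i <;>
      simp only [h1, h2, h3, if_true, if_false, mul_zero, zero_mul, add_zero]
    · exact eg_arnold _ _ _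
    · exact absurd (hc.symm _ _ (hc.trans _ _ _ hli.symm h1 h2)) h3
    · exact absurd (hc.symm _ _ (hc.trans _ _ _ hjl.symm h3 h1)) h2
    · exact absurd (hc.symm _ _ (hc.trans _ _ _ hij.symm h2 h3)) h1
  sq i j _ := by
    split_ifs
    · exact eg_sq _ _
    · simp
  symm i j _ := by
    have : c i j ↔ c j i := ⟨hc.symm _ _, hc.symm _ _⟩
    simp only [this, eg_symm i j]
  p_e i j _ a := by
    split_ifs
    · exact pt_mul_eg _ _ _
    · simp

variable (𝒜 N) in
/-- The endomorphism of `E₁` which kills the classes `e_{ij}` with `¬ c i j`. -/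
def restrict {c : Fin n → Fin n → Prop} (hc : IsBlockRel c) : CT 𝒜 N n →ₐ[k] CT 𝒜 N n :=
  liftE N (isRep_restrict hc)

@[simp] theorem restrict_pt {c : Fin n → Fin n → Prop} (hc : IsBlockRel c) (i : Fin n) (a : H) :
    restrict 𝒜 N hc (pt 𝒜 N i a) = pt 𝒜 N i a := by simp [restrict]

open Classical in
@[simp] theorem restrict_eg {c : Fin n → Fin n → Prop} (hc : IsBlockRel c) (i j : Fin n) :
    restrict 𝒜 N hc (eg 𝒜 N i j) = if c i j then eg 𝒜 N i j else 0 :=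
  liftE_eg' _ (by simp) i j

variable [GradedAlgebra 𝒜]

theorem isRep_inv : IsRep 𝒜 (fun i => (pHom 𝒜 N i).comp (parityInv 𝒜))
    (fun i j : Fin n => -eg 𝒜 N i j) where
  p_comm i j _ s t a b ha hb := by
    simp only [AlgHom.comp_apply, parityInv_of_mem ha, parityInv_of_mem hb, map_smul, pHom_apply,
      smul_mul_smul_comm, pt_comm i j ha hb]
    rw [smul_comm, mul_comm (sgn k s)]
  e_p i j l _ s a ha := by
    simp only [AlgHom.comp_apply, parityInv_of_mem ha, map_smul, pHom_apply, neg_mul, mul_neg,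
      mul_smul_comm, smul_mul_assoc, eg_mul_pt i j l ha, smul_neg]
  e_comm _ _ _ _ _ _ := by rw [neg_mul_neg, neg_mul_neg, eg_comm]
  arnold _ _ _ _ _ _ := by simp only [neg_mul_neg, eg_arnold]
  sq _ _ _ := by rw [neg_mul_neg, eg_sq]
  symm i j _ := by rw [eg_symm i j]
  p_e i j _ a := by
    rw [mul_neg, mul_neg, AlgHom.comp_apply, AlgHom.comp_apply, pHom_apply, pHom_apply,
      pt_mul_eg]

variable (𝒜 N n) in
/-- The involution of `E₁` which is `(-1)^d` in total degree `d`. -/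
def inv : CT 𝒜 N n →ₐ[k] CT 𝒜 N n := liftE N isRep_inv

theorem inv_pt (i : Fin n) {s : ℤ} {a : H} (ha : a ∈ 𝒜 s) :
    inv 𝒜 N n (pt 𝒜 N i a) = sgn k s • pt 𝒜 N i a := by
  simp [inv, parityInv_of_mem ha]

@[simp] theorem inv_eg (i j : Fin n) : inv 𝒜 N n (eg 𝒜 N i j) = -eg 𝒜 N i j :=
  liftE_eg' _ (by simp) i j

theorem inv_inv (x : CT 𝒜 N n) : inv 𝒜 N n (inv 𝒜 N n x) = x := by
  have : (inv 𝒜 N n).comp (inv 𝒜 N n) = AlgHom.id k _ :=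
    eOne_algHom_ext (fun i s a ha => by
      simp [inv_pt _ ha, sgn_sq_smul])
      (fun i j h => by simp)
  exact AlgHom.congr_fun this x

theorem inv_relabel (f : Fin n → Fin n) (x : CT 𝒜 N n) :
    inv 𝒜 N n (relabel 𝒜 N f x) = relabel 𝒜 N f (inv 𝒜 N n x) := by
  have : (inv 𝒜 N n).comp (relabel 𝒜 N f) = (relabel 𝒜 N f).comp (inv 𝒜 N n) :=
    eOne_algHom_ext (fun i s a ha => by simp [inv_pt _ ha])
      (fun i j h => by simp)
  exact AlgHom.congr_fun this x

theorem inv_restrict {c : Fin n → Fin n → Prop} (hc : IsBlockRel c) (x : CT 𝒜 N n) :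
    inv 𝒜 N n (restrict 𝒜 N hc x) = restrict 𝒜 N hc (inv 𝒜 N n x) := by
  have : (inv 𝒜 N n).comp (restrict 𝒜 N hc) = (restrict 𝒜 N hc).comp (inv 𝒜 N n) :=
    eOne_algHom_ext (fun i s a ha => by simp [inv_pt _ ha])
      (fun i j h => by
        rw [AlgHom.comp_apply, AlgHom.comp_apply, restrict_eg, inv_eg, map_neg, restrict_eg]
        split_ifs <;> simp)
  exact AlgHom.congr_fun this x

/-! ### Graded commutativity of `E₁` -/

variable (𝒜 N n) in
/-- The power `inv ^ d` of the involution. -/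
def invPow (d : ℤ) : CT 𝒜 N n →ₐ[k] CT 𝒜 N n :=
  if Even d then AlgHom.id k _ else inv 𝒜 N n

theorem invPow_congr {d d' : ℤ} (h : Even (d - d')) : invPow 𝒜 N n d = invPow 𝒜 N n d' := by
  have : Even d ↔ Even d' := by rwa [Int.even_sub] at h
  simp only [invPow, this]

theorem invPow_add (d d' : ℤ) (x : CT 𝒜 N n) :
    invPow 𝒜 N n (d + d') x = invPow 𝒜 N n d (invPow 𝒜 N n d' x) := by
  by_cases h : Even d <;> by_cases h' : Even d' <;> simp [invPow, Int.even_add, h, h', inv_inv]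

variable (𝒜 N n) in
/-- `x` behaves like an element of parity `d` of a graded commutative algebra. -/
structure IsSuper (d : ℤ) (x : CT 𝒜 N n) : Prop where
  mul_eq : ∀ y, x * y = invPow 𝒜 N n d y * x
  inv_eq : inv 𝒜 N n x = sgn k d • x

namespace IsSuper

variable {d d' : ℤ} {x y : CT 𝒜 N n}

theorem congr (h : Even (d - d')) (hx : IsSuper 𝒜 N n d x) : IsSuper 𝒜 N n d' x where
  mul_eq y := by rw [hx.mul_eq, invPow_congr h]
  inv_eq := by rw [hx.inv_eq, sgn_congr h]

theorem add (hx : IsSuper 𝒜 N n d x) (hy : IsSuper 𝒜 N n d y) : IsSuper 𝒜 N n d (x + y) where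
  mul_eq z := by rw [add_mul, hx.mul_eq, hy.mul_eq, mul_add]
  inv_eq := by rw [map_add, hx.inv_eq, hy.inv_eq, smul_add]

theorem smul (c : k) (hx : IsSuper 𝒜 N n d x) : IsSuper 𝒜 N n d (c • x) where
  mul_eq z := by rw [smul_mul_assoc, hx.mul_eq, mul_smul_comm]
  inv_eq := by rw [map_smul, hx.inv_eq, smul_comm]

theorem zero : IsSuper 𝒜 N n d 0 where
  mul_eq z := by simp
  inv_eq := by simp

theorem one : IsSuper 𝒜 N n 0 1 where
  mul_eq z := by simp [invPow]
  inv_eq := by simp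

theorem mul (hx : IsSuper 𝒜 N n d x) (hy : IsSuper 𝒜 N n d' y) :
    IsSuper 𝒜 N n (d + d') (x * y) where
  mul_eq z := by
    rw [mul_assoc, hy.mul_eq, ← mul_assoc, hx.mul_eq, invPow_add, mul_assoc]
  inv_eq := by rw [map_mul, hx.inv_eq, hy.inv_eq, smul_mul_smul_comm, sgn_add]

theorem comm (hx : IsSuper 𝒜 N n d x) (hy : IsSuper 𝒜 N n d' y) :
    x * y = sgn k (d * d') • (y * x) := by
  rw [hx.mul_eq, invPow]
  split_ifs with h
  · rw [sgn_of_even (h.mul_right d'), one_smul]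
    rfl
  · rw [hy.inv_eq, smul_mul_assoc]
    congr 1
    refine sgn_congr ?_
    obtain ⟨c, rfl⟩ := Int.not_even_iff_odd.1 h
    exact ⟨-c * d', by ring⟩

end IsSuper

theorem isSuper_eg (i j : Fin n) : IsSuper 𝒜 N n 1 (eg 𝒜 N i j) where
  mul_eq y := by
    rw [invPow, if_neg (by decide)]
    induction y using eOne_induction with
    | one => simp
    | add x y hx hy => rw [mul_add, hx, hy, map_add, add_mul]
    | smul c x hx => rw [mul_smul_comm, hx, map_smul, smul_mul_assoc]
    | p_mul l s a ha x hx =>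
      rw [← mul_assoc, eg_mul_pt i j l ha, map_mul, inv_pt _ ha, mul_assoc, ← smul_mul_assoc,
        mul_assoc, ← hx]
    | e_mul l m _ x hx =>
      rw [← mul_assoc, eg_comm, map_mul, inv_eg, mul_assoc (-_), ← hx, neg_mul, neg_mul, mul_assoc]
  inv_eq := by simp

theorem isSuper_pt_of_mem (i : Fin n) {s : ℤ} {a : H} (ha : a ∈ 𝒜 s) :
    IsSuper 𝒜 N n s (pt 𝒜 N i a) where
  mul_eq y := by
    rw [invPow]
    split_ifs with h
    · change _ = y * _
      induction y using eOne_induction with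
      | one => simp
      | add x y hx hy => rw [mul_add, hx, hy, add_mul]
      | smul c x hx => rw [mul_smul_comm, hx, smul_mul_assoc]
      | p_mul l t b hb x hx =>
        rw [← mul_assoc, pt_comm i l ha hb, sgn_of_even (h.mul_right t), one_smul, mul_assoc, hx,
          mul_assoc]
      | e_mul l m _ x hx =>
        have := eg_mul_pt (N := N) l m i ha
        rw [sgn_of_even h, one_smul] at this
        rw [← mul_assoc, ← this, mul_assoc, hx, mul_assoc]
    · rw [Int.not_even_iff_odd] at h
      induction y using eOne_induction with
      | one => simp
      | add x y hx hy => rw [mul_add, hx, hy, map_add, add_mul]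
      | smul c x hx => rw [mul_smul_comm, hx, map_smul, smul_mul_assoc]
      | p_mul l t b hb x hx =>
        rw [← mul_assoc, pt_comm i l ha hb, map_mul, inv_pt _ hb, mul_assoc (_ • _), ← hx]
        rw [sgn_congr (a := s * t) (b := t) (by
          obtain ⟨c, rfl⟩ := h
          exact ⟨c * t, by ring⟩)]
        simp only [smul_mul_assoc, mul_assoc]
      | e_mul l m _ x hx =>
        have := eg_mul_pt (N := N) l m i ha
        rw [sgn_of_odd h, neg_one_smul] at this
        rw [← mul_assoc, ← neg_neg (pt 𝒜 N i a * _), ← this, map_mul, inv_eg, mul_assoc (-_),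
          ← hx]
        simp only [neg_mul, mul_assoc]
  inv_eq := inv_pt i ha

theorem isSuper_pt (i : Fin n) {ε : Fin 2} {a : H} (ha : HasParity 𝒜 ε a) :
    IsSuper 𝒜 N n ((ε : ℕ) : ℤ) (pt 𝒜 N i a) where
  mul_eq y := by
    refine HasParity.linear_ext (𝒱 := 𝒜) (f := (LinearMap.mulRight k y).comp (pt 𝒜 N i))
      (g := (LinearMap.mulLeft k (invPow 𝒜 N n ((ε : ℕ) : ℤ) y)).comp (pt 𝒜 N i))
      (fun s a ha hs => ?_) ha
    have := ((isSuper_pt_of_mem (N := N) i ha).congr (d' := ((ε : ℕ) : ℤ)) (by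
      rw [← hs]; exact ⟨s / 2, by omega⟩)).mul_eq y
    exact this
  inv_eq := by
    refine HasParity.linear_ext (𝒱 := 𝒜) (f := (inv 𝒜 N n).toLinearMap.comp (pt 𝒜 N i))
      (g := sgn k ((ε : ℕ) : ℤ) • pt 𝒜 N i)
      (fun s a ha hs => ?_) ha
    have := ((isSuper_pt_of_mem (N := N) i ha).congr (d' := ((ε : ℕ) : ℤ)) (by
      rw [← hs]; exact ⟨s / 2, by omega⟩)).inv_eq
    exact this

theorem pt_mul_mul_eg (i j : Fin n) (a : H) (y : CT 𝒜 N n) :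
    pt 𝒜 N i a * (y * eg 𝒜 N i j) = pt 𝒜 N j a * (y * eg 𝒜 N i j) := by
  suffices h : (LinearMap.mulRight k (y * eg 𝒜 N i j)).comp (pt 𝒜 N i) =
      (LinearMap.mulRight k (y * eg 𝒜 N i j)).comp (pt 𝒜 N j) from LinearMap.congr_fun h a
  refine linearMap_ext_homogeneous 𝒜 fun s a ha => ?_
  simp only [LinearMap.comp_apply, LinearMap.mulRight_apply]
  rw [← mul_assoc, (isSuper_pt_of_mem i ha).mul_eq, mul_assoc, pt_mul_eg, ← mul_assoc,
    ← (isSuper_pt_of_mem j ha).mul_eq, mul_assoc]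

end Morphisms

/-! ### Residues -/

section Residues

variable {k : Type u} {H : Type v} [Field k] [Ring H] [Algebra k H]
  {𝒜 : ℤ → Submodule k H} {N n : ℕ} [hN : Fact (Even N)] [hH : Fact (IsGradedCommutative 𝒜)]
  [GradedAlgebra 𝒜]

/-- The self-map of the set of points which makes `b` collide with `a`. -/
def collapse (a b : Fin n) : Fin n → Fin n := Function.update id b a

theorem collapse_self (a b : Fin n) : collapse a b b = a := by simp [collapse]

theorem collapse_of_ne {a b i : Fin n} (h : i ≠ b) : collapse a b i = i := by simp [collapse, h]

theorem collapse_left (a b : Fin n) : collapse a b a = a := by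
  by_cases h : a = b
  · subst h; exact collapse_self _ _
  · exact collapse_of_ne h

variable (𝒜 N) in
/-- The residue of `e_{ij}` along the collision of `a` and `b`: it is `1` if `{i, j} = {a, b}`, and
`0` otherwise. -/
def delta (a b i j : Fin n) : CT 𝒜 N n := if (i = a ∧ j = b) ∨ (i = b ∧ j = a) then 1 else 0

theorem tri_mul {R : Type*} [Ring R] (x y z x' y' z' : R) :
    !![x, y; 0, z] * !![x', y'; 0, z'] = !![x * x', x * y' + y * z'; 0, z * z'] := by
  simp

theorem tri_add {R : Type*} [Ring R] (x y z x' y' z' : R) :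
    !![x, y; 0, z] + !![x', y'; 0, z'] = !![x + x', y + y'; 0, z + z'] := by
  ext i j; fin_cases i <;> fin_cases j <;> simp

theorem tri_neg {R : Type*} [Ring R] (x y z : R) :
    -!![x, y; 0, z] = !![-x, -y; 0, -z] := by
  ext i j; fin_cases i <;> fin_cases j <;> simp

theorem tri_smul {R : Type*} [Ring R] [Algebra k R] (c : k) (x y z : R) :
    c • !![x, y; 0, z] = !![c • x, c • y; 0, c • z] := by
  ext i j; fin_cases i <;> fin_cases j <;> simp

variable (𝒜 N n) in
/-- The diagonal morphism `x ↦ diag(x, inv x)`. -/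
def diagHom : CT 𝒜 N n →ₐ[k] Matrix (Fin 2) (Fin 2) (CT 𝒜 N n) where
  toFun x := !![x, 0; 0, inv 𝒜 N n x]
  map_one' := by rw [map_one]; exact Matrix.one_fin_two.symm
  map_mul' x y := by rw [tri_mul, map_mul]; simp
  map_zero' := by ext i j; fin_cases i <;> fin_cases j <;> simp
  map_add' x y := by rw [tri_add, map_add]; simp
  commutes' c := by
    rw [AlgHom.commutes]
    ext i j; fin_cases i <;> fin_cases j <;> simp [Matrix.algebraMap_matrix_apply]

theorem diagHom_apply (x : CT 𝒜 N n) : diagHom 𝒜 N n x = !![x, 0; 0, inv 𝒜 N n x] := rfl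

omit hN hH [GradedAlgebra 𝒜] in
theorem delta_symm (a b i j : Fin n) : delta 𝒜 N a b i j = delta 𝒜 N a b j i := by
  simp only [delta]
  congr 1
  simp only [eq_iff_iff]
  tauto

omit hN hH [GradedAlgebra 𝒜] in
theorem delta_comm (a b i j : Fin n) (x : CT 𝒜 N n) :
    delta 𝒜 N a b i j * x = x * delta 𝒜 N a b i j := by
  unfold delta
  split_ifs <;> simp

omit hN hH [GradedAlgebra 𝒜] in
theorem delta_eq_zero_or (a b i j : Fin n) :
    delta 𝒜 N a b i j = 0 ∨ collapse a b i = collapse a b j := by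
  unfold delta
  split_ifs with h
  · right
    rcases h with ⟨rfl, rfl⟩ | ⟨rfl, rfl⟩ <;> rw [collapse_self, collapse_left]
  · exact Or.inl rfl

theorem isRep_res (a b : Fin n) :
    IsRep 𝒜 (fun i => (diagHom 𝒜 N n).comp (pHom 𝒜 N (collapse a b i)))
      (fun i j => !![eg 𝒜 N (collapse a b i) (collapse a b j), delta 𝒜 N a b i j;
        0, -eg 𝒜 N (collapse a b i) (collapse a b j)]) where
  p_comm i j _ s t x y hx hy := by
    simp only [AlgHom.comp_apply, ← map_mul, ← map_smul, pHom_apply]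
    rw [pt_comm _ _ hx hy]
  e_p i j l _ s x hx := by
    simp only [AlgHom.comp_apply, diagHom_apply, tri_mul, tri_smul, pHom_apply, inv_pt _ hx,
      eg_mul_pt _ _ _ hx, delta_comm, mul_zero, zero_mul, add_zero, zero_add, neg_mul, mul_neg,
      smul_mul_assoc, mul_smul_comm, smul_neg, sgn_sq_smul, neg_zero]
  e_comm i j l m _ _ := by
    simp only [tri_mul, tri_neg, mul_neg, neg_mul, neg_neg, delta_comm]
    rw [eg_comm (collapse a b i), neg_add, neg_neg, add_comm]
  arnold i j l _ _ _ := by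
    have key : ∀ i j l : Fin n, delta 𝒜 N a b i j * eg 𝒜 N (collapse a b l) (collapse a b i) =
        delta 𝒜 N a b i j * eg 𝒜 N (collapse a b j) (collapse a b l) := fun i j l => by
      rcases delta_eq_zero_or (𝒜 := 𝒜) (N := N) a b i j with h | h
      · simp [h]
      · rw [h, eg_symm]
    have h := eg_arnold (𝒜 := 𝒜) (N := N) (collapse a b i) (collapse a b j) (collapse a b l)
    simp only [tri_mul, tri_add, neg_mul_neg, h]
    have h' : eg 𝒜 N (collapse a b i) (collapse a b j) * delta 𝒜 N a b j l +
        delta 𝒜 N a b i j * -eg 𝒜 N (collapse a b j) (collapse a b l) +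
        (eg 𝒜 N (collapse a b j) (collapse a b l) * delta 𝒜 N a b l i +
        delta 𝒜 N a b j l * -eg 𝒜 N (collapse a b l) (collapse a b i)) +
        (eg 𝒜 N (collapse a b l) (collapse a b i) * delta 𝒜 N a b i j +
        delta 𝒜 N a b l i * -eg 𝒜 N (collapse a b i) (collapse a b j)) = 0 := by
      rw [← delta_comm a b j l, ← delta_comm a b l i, ← delta_comm a b i j, mul_neg, mul_neg,
        mul_neg, key i j l, key j l i, key l i j]
      abel
    rw [h']
    ext i j; fin_cases i <;> fin_cases j <;> simp
  sq i j _ := by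
    simp only [tri_mul, eg_sq, delta_comm, neg_mul, mul_neg, neg_neg, add_neg_cancel]
    ext i j; fin_cases i <;> fin_cases j <;> rfl
  symm i j _ := by rw [delta_symm, eg_symm]
  p_e i j _ x := by
    simp only [AlgHom.comp_apply, diagHom_apply, tri_mul, pHom_apply, pt_mul_eg (collapse a b i)]
    have h1 : pt 𝒜 N (collapse a b i) x * delta 𝒜 N a b i j =
        pt 𝒜 N (collapse a b j) x * delta 𝒜 N a b i j := by
      rcases delta_eq_zero_or (𝒜 := 𝒜) (N := N) a b i j with h | h
      · simp [h]
      · rw [h]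
    have h2 : inv 𝒜 N n (pt 𝒜 N (collapse a b i) x) *
          -eg 𝒜 N (collapse a b i) (collapse a b j) =
        inv 𝒜 N n (pt 𝒜 N (collapse a b j) x) *
          -eg 𝒜 N (collapse a b i) (collapse a b j) := by
      rw [← inv_eg, ← map_mul, ← map_mul, pt_mul_eg]
    rw [h1, h2]

/-- The morphism to triangular matrices whose off-diagonal entry is the residue: that a twisted
derivation is well defined on a quotient amounts to the relations between these matrices. -/
def resHom (a b : Fin n) : CT 𝒜 N n →ₐ[k] Matrix (Fin 2) (Fin 2) (CT 𝒜 N n) :=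
  liftE N (isRep_res a b)

variable (𝒜 N) in
/-- The residue of a class along the collision of the points `a` and `b`. It is the twisted
derivation, with respect to the morphism `relabel (collapse a b)` on the left and its composite with
`inv` on the right, whose value is `1` on `e_{ab}` and `0` on the other generators. -/
def res (a b : Fin n) : CT 𝒜 N n →ₗ[k] CT 𝒜 N n where
  toFun x := resHom a b x 0 1
  map_add' x y := by rw [map_add]; rfl
  map_smul' c x := by rw [map_smul]; rfl

theorem resHom_eg (a b i j : Fin n) : resHom a b (eg 𝒜 N i j) =
    if i = j then 0 else !![eg 𝒜 N (collapse a b i) (collapse a b j), delta 𝒜 N a b i j;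
        0, -eg 𝒜 N (collapse a b i) (collapse a b j)] := by
  split_ifs with h
  · rw [h, eg_self, map_zero]
  · exact liftE_eg _ h

theorem resHom_apply (a b : Fin n) (x : CT 𝒜 N n) :
    resHom a b x = !![relabel 𝒜 N (collapse a b) x, res 𝒜 N a b x;
      0, inv 𝒜 N n (relabel 𝒜 N (collapse a b) x)] := by
  have h : resHom a b x 0 0 = relabel 𝒜 N (collapse a b) x ∧ resHom a b x 1 0 = 0 ∧
      resHom a b x 1 1 = inv 𝒜 N n (relabel 𝒜 N (collapse a b) x) := by
    induction x using eOne_induction with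
    | one => simp
    | add x y hx hy => simp [hx, hy]
    | smul c x hx => simp [hx]
    | p_mul i s y hy x hx =>
      have : resHom a b (pt 𝒜 N i y) = !![pt 𝒜 N (collapse a b i) y, 0; 0,
        inv 𝒜 N n (pt 𝒜 N (collapse a b i) y)] := liftE_pt (isRep_res a b) i y
      simp only [map_mul, Matrix.mul_apply, Fin.sum_univ_two, hx, this]
      simp
    | e_mul i j hij x hx =>
      simp only [map_mul, Matrix.mul_apply, Fin.sum_univ_two, hx, resHom_eg, if_neg hij]
      simp
  obtain ⟨h1, h2, h3⟩ := h
  ext i j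
  fin_cases i <;> fin_cases j
  · exact h1
  · rfl
  · exact h2
  · exact h3

theorem res_mul (a b : Fin n) (x y : CT 𝒜 N n) :
    res 𝒜 N a b (x * y) = relabel 𝒜 N (collapse a b) x * res 𝒜 N a b y +
      res 𝒜 N a b x * inv 𝒜 N n (relabel 𝒜 N (collapse a b) y) := by
  have : resHom a b (x * y) 0 1 = (resHom a b x * resHom a b y) 0 1 := by rw [map_mul]
  rw [resHom_apply a b x, resHom_apply a b y, tri_mul] at this
  exact this

@[simp] theorem res_one (a b : Fin n) : res 𝒜 N a b 1 = 0 := by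
  change resHom a b 1 0 1 = 0
  simp

@[simp] theorem res_pt (a b i : Fin n) (x : H) : res 𝒜 N a b (pt 𝒜 N i x) = 0 := by
  have : resHom a b (pt 𝒜 N i x) = !![pt 𝒜 N (collapse a b i) x, 0; 0,
        inv 𝒜 N n (pt 𝒜 N (collapse a b i) x)] := liftE_pt (isRep_res a b) i x
  change resHom a b (pt 𝒜 N i x) 0 1 = 0
  rw [this]
  simp

theorem res_eg (a b i j : Fin n) (hij : i ≠ j) :
    res 𝒜 N a b (eg 𝒜 N i j) = delta 𝒜 N a b i j := by
  change resHom a b (eg 𝒜 N i j) 0 1 = _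
  rw [resHom_eg, if_neg hij]
  simp

theorem res_pt_mul (a b i : Fin n) (x : H) (y : CT 𝒜 N n) :
    res 𝒜 N a b (pt 𝒜 N i x * y) = pt 𝒜 N (collapse a b i) x * res 𝒜 N a b y := by
  rw [res_mul, relabel_pt, res_pt, zero_mul, add_zero]

theorem res_eg_mul (a b i j : Fin n) (hij : i ≠ j) (y : CT 𝒜 N n) :
    res 𝒜 N a b (eg 𝒜 N i j * y) = eg 𝒜 N (collapse a b i) (collapse a b j) * res 𝒜 N a b y +
      delta 𝒜 N a b i j * inv 𝒜 N n (relabel 𝒜 N (collapse a b) y) := by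
  rw [res_mul, relabel_eg, res_eg _ _ _ _ hij]

theorem inv_delta (a b i j : Fin n) : inv 𝒜 N n (delta 𝒜 N a b i j) = delta 𝒜 N a b i j := by
  unfold delta
  split_ifs <;> simp

theorem res_inv (a b : Fin n) (x : CT 𝒜 N n) :
    res 𝒜 N a b (inv 𝒜 N n x) = -inv 𝒜 N n (res 𝒜 N a b x) := by
  induction x using eOne_induction with
  | one => simp
  | add x y hx hy => rw [map_add, map_add, hx, hy, map_add, map_add, neg_add]
  | smul c x hx => rw [map_smul, map_smul, hx, map_smul, map_smul, smul_neg]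
  | p_mul i s y hy x hx =>
    rw [map_mul, inv_pt _ hy, smul_mul_assoc, map_smul, res_pt_mul, res_pt_mul, hx, map_mul,
      inv_pt _ hy, smul_mul_assoc, mul_neg, smul_neg]
  | e_mul i j hij x hx =>
    rw [map_mul, inv_eg, neg_mul, map_neg, res_eg_mul _ _ _ _ hij, res_eg_mul _ _ _ _ hij, hx,
      map_add, map_mul, map_mul, inv_eg, inv_delta, inv_relabel]
    simp only [mul_neg, neg_mul]
    rw [inv_relabel, inv_relabel]

theorem collapse_perm (σ : Equiv.Perm (Fin n)) (a b i : Fin n) :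
    collapse (σ a) (σ b) (σ i) = σ (collapse a b i) := by
  by_cases h : i = b
  · subst h; rw [collapse_self, collapse_self]
  · rw [collapse_of_ne h, collapse_of_ne (σ.injective.ne h)]

omit [GradedAlgebra 𝒜] in
theorem relabel_delta (σ : Equiv.Perm (Fin n)) (a b i j : Fin n) :
    delta 𝒜 N (σ a) (σ b) (σ i) (σ j) = relabel 𝒜 N σ (delta 𝒜 N a b i j) := by
  simp only [delta, σ.injective.eq_iff]
  split_ifs <;> simp

theorem res_relabel (σ : Equiv.Perm (Fin n)) (a b : Fin n) (x : CT 𝒜 N n) :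
    res 𝒜 N (σ a) (σ b) (relabel 𝒜 N σ x) = relabel 𝒜 N σ (res 𝒜 N a b x) := by
  induction x using eOne_induction with
  | one => simp
  | add x y hx hy => rw [map_add, map_add, hx, hy, map_add, map_add]
  | smul c x hx => rw [map_smul, map_smul, hx, map_smul, map_smul]
  | p_mul i s y hy x hx =>
    rw [map_mul, relabel_pt, res_pt_mul, hx, res_pt_mul, map_mul, relabel_pt, collapse_perm]
  | e_mul i j hij x hx =>
    rw [map_mul, relabel_eg, res_eg_mul _ _ _ _ (σ.injective.ne hij), hx, res_eg_mul _ _ _ _ hij,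
      map_add, map_mul, map_mul, relabel_eg, collapse_perm, collapse_perm, relabel_delta,
      ← inv_relabel, relabel_relabel, relabel_relabel]
    congr 5
    ext l
    simp [collapse_perm]

end Residues

/-! ### Reconstruction of a class from its residues -/

section Reconstruction

variable {k : Type u} {H : Type v} [Field k] [Ring H] [Algebra k H]
  {𝒜 : ℤ → Submodule k H} {N n : ℕ} [hN : Fact (Even N)] [hH : Fact (IsGradedCommutative 𝒜)]

theorem isBlockRel_mem (S : Finset (Fin n)) : IsBlockRel (fun i j => i ∈ S ∧ j ∈ S) where
  symm _ _ h := ⟨h.2, h.1⟩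
  trans _ _ _ _ h h' := ⟨h.1, h'.2⟩

variable (𝒜 N) in
/-- The endomorphism of `E₁` which kills the classes `e_{ij}` unless `i` and `j` belong to `S`. -/
def keep (S : Finset (Fin n)) : CT 𝒜 N n →ₐ[k] CT 𝒜 N n := restrict 𝒜 N (isBlockRel_mem S)

@[simp] theorem keep_pt (S : Finset (Fin n)) (i : Fin n) (a : H) :
    keep 𝒜 N S (pt 𝒜 N i a) = pt 𝒜 N i a := restrict_pt _ _ _

theorem keep_eg (S : Finset (Fin n)) (i j : Fin n) :
    keep 𝒜 N S (eg 𝒜 N i j) = if i ∈ S ∧ j ∈ S then eg 𝒜 N i j else 0 := by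
  rw [keep, restrict_eg]
  split_ifs <;> rfl

theorem keep_delta (S : Finset (Fin n)) (a b i j : Fin n) :
    keep 𝒜 N S (delta 𝒜 N a b i j) = delta 𝒜 N a b i j := by
  unfold delta
  split_ifs <;> simp

theorem relabel_delta_any (f : Fin n → Fin n) (a b i j : Fin n) :
    relabel 𝒜 N f (delta 𝒜 N a b i j) = delta 𝒜 N a b i j := by
  unfold delta
  split_ifs <;> simp

variable [GradedAlgebra 𝒜]

theorem keep_keep (S T : Finset (Fin n)) (x : CT 𝒜 N n) :
    keep 𝒜 N S (keep 𝒜 N T x) = keep 𝒜 N (S ∩ T) x := by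
  have : (keep 𝒜 N S).comp (keep 𝒜 N T) = keep 𝒜 N (S ∩ T) :=
    eOne_algHom_ext (fun i s a _ => by simp) (fun i j h => by
      rw [AlgHom.comp_apply, keep_eg, keep_eg]
      simp only [Finset.mem_inter]
      split_ifs with h1 h2 h2
      · rw [keep_eg, if_pos (by tauto)]
      · rw [keep_eg, if_neg (by tauto)]
      · exact absurd ⟨h2.1.2, h2.2.2⟩ h1
      · rw [map_zero])
  exact AlgHom.congr_fun this x

theorem inv_keep (S : Finset (Fin n)) (x : CT 𝒜 N n) :
    inv 𝒜 N n (keep 𝒜 N S x) = keep 𝒜 N S (inv 𝒜 N n x) := inv_restrict _ x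

theorem collapse_ne {a b : Fin n} (hab : a ≠ b) (i : Fin n) : collapse a b i ≠ b := by
  by_cases h : i = b
  · rwa [h, collapse_self]
  · rwa [collapse_of_ne h]

theorem keep_relabel_collapse {a b : Fin n} (hab : a ≠ b) (x : CT 𝒜 N n) :
    keep 𝒜 N (Finset.univ.erase b) (relabel 𝒜 N (collapse a b) x) =
      relabel 𝒜 N (collapse a b) x := by
  have : (keep 𝒜 N (Finset.univ.erase b)).comp (relabel 𝒜 N (collapse a b)) =
      relabel 𝒜 N (collapse a b) :=
    eOne_algHom_ext (fun i s a _ => by simp) (fun i j h => by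
      rw [AlgHom.comp_apply, relabel_eg, keep_eg, if_pos]
      simp [collapse_ne hab])
  exact AlgHom.congr_fun this x

theorem keep_res {a b : Fin n} (hab : a ≠ b) (x : CT 𝒜 N n) :
    keep 𝒜 N (Finset.univ.erase b) (res 𝒜 N a b x) = res 𝒜 N a b x := by
  induction x using eOne_induction with
  | one => simp
  | add x y hx hy => rw [map_add, map_add, hx, hy]
  | smul c x hx => rw [map_smul, map_smul, hx]
  | p_mul i s y hy x hx => rw [res_pt_mul, map_mul, hx, keep_pt]
  | e_mul i j hij x hx =>
    rw [res_eg_mul _ _ _ _ hij, map_add, map_mul, map_mul, hx, keep_delta, ← inv_keep,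
      keep_relabel_collapse hab, keep_eg, if_pos]
    simp [collapse_ne hab]

theorem relabel_res_of_ne {a b : Fin n} (hab : a ≠ b) (i : Fin n) (x : CT 𝒜 N n) :
    relabel 𝒜 N (collapse i b) (res 𝒜 N a b x) = res 𝒜 N a b x := by
  have h1 : ∀ l, collapse i b (collapse a b l) = collapse a b l := fun l =>
    collapse_of_ne (collapse_ne hab l)
  have h2 : collapse i b ∘ collapse a b = collapse a b := funext h1
  induction x using eOne_induction with
  | one => simp
  | add x y hx hy => rw [map_add, map_add, hx, hy]
  | smul c x hx => rw [map_smul, map_smul, hx]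
  | p_mul i s y hy x hx => rw [res_pt_mul, map_mul, hx, relabel_pt, h1]
  | e_mul i j hij x hx =>
    rw [res_eg_mul _ _ _ _ hij, map_add, map_mul, map_mul, hx, relabel_delta_any, ← inv_relabel,
      relabel_relabel, h2, relabel_eg, h1, h1]

theorem eg_mul_relabel_keep (i b : Fin n) (x : CT 𝒜 N n) :
    eg 𝒜 N i b * relabel 𝒜 N (collapse i b) (keep 𝒜 N (Finset.univ.erase b) x) =
      eg 𝒜 N i b * keep 𝒜 N (Finset.univ.erase b) x := by
  induction x using eOne_induction with
  | one => simp
  | add x y hx hy => simp only [map_add, mul_add, hx, hy]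
  | smul c x hx => simp only [map_smul, mul_smul_comm, hx]
  | p_mul l s a ha x hx =>
    rw [map_mul, map_mul, keep_pt, relabel_pt, ← mul_assoc, ← mul_assoc, eg_mul_pt _ _ _ ha,
      eg_mul_pt _ _ _ ha]
    have : pt 𝒜 N (collapse i b l) a * eg 𝒜 N i b = pt 𝒜 N l a * eg 𝒜 N i b := by
      by_cases h : l = b
      · rw [h, collapse_self, pt_mul_eg]
      · rw [collapse_of_ne h]
    rw [this, smul_mul_assoc, smul_mul_assoc, mul_assoc, mul_assoc, hx]
  | e_mul l m _ x hx =>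
    rw [map_mul, keep_eg]
    split_ifs with h
    · simp only [Finset.mem_erase, Finset.mem_univ, and_true] at h
      rw [map_mul, relabel_eg, collapse_of_ne h.1, collapse_of_ne h.2, ← mul_assoc, eg_comm,
        neg_mul, mul_assoc, hx, ← mul_assoc, ← mul_assoc, eg_comm l m, neg_mul, neg_neg]
    · simp

/-- A class is recovered from its residues along the collisions of a point `b` with the other
points, and from its part not involving the classes `e_{ib}`. -/
theorem eq_keep_add_sum_res (b : Fin n) (x : CT 𝒜 N n) :
    x = keep 𝒜 N (Finset.univ.erase b) x +
      ∑ a ∈ Finset.univ.erase b, res 𝒜 N a b x * eg 𝒜 N a b := by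
  induction x using eOne_induction with
  | one => simp
  | add x y hx hy =>
    simp only [map_add, add_mul, Finset.sum_add_distrib]
    conv_lhs => rw [hx, hy]
    abel
  | smul c x hx =>
    simp only [map_smul, smul_mul_assoc, ← Finset.smul_sum, ← smul_add]
    rw [← hx]
  | p_mul l s h hh x hx =>
    conv_lhs => rw [hx]
    rw [mul_add, map_mul, keep_pt, Finset.mul_sum]
    congr 1
    refine Finset.sum_congr rfl fun a _ => ?_
    rw [res_pt_mul, mul_assoc]
    by_cases hl : l = b
    · rw [hl, collapse_self, pt_mul_mul_eg a b]
    · rw [collapse_of_ne hl]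
  | e_mul l m hlm x hx =>
    -- The only generators whose residues along collisions with `b` do not vanish are the `e_{ib}`.
    -- For these, the formula for `e_{ib} x` follows from the formula for `x` by the three-term
    -- relation for the points `i`, `b`, `a`.
    have key : ∀ i, i ≠ b → eg 𝒜 N i b * x = keep 𝒜 N (Finset.univ.erase b) (eg 𝒜 N i b * x) +
        ∑ a ∈ Finset.univ.erase b, res 𝒜 N a b (eg 𝒜 N i b * x) * eg 𝒜 N a b := by
      intro i hi
      have h1 : ∀ a ∈ Finset.univ.erase b, res 𝒜 N a b (eg 𝒜 N i b * x) * eg 𝒜 N a b =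
          eg 𝒜 N i a * (res 𝒜 N a b x * eg 𝒜 N a b) +
            if i = a then inv 𝒜 N n (relabel 𝒜 N (collapse a b) x) * eg 𝒜 N a b else 0 := by
        intro a _
        rw [res_eg_mul _ _ _ _ hi, collapse_of_ne hi, collapse_self, add_mul, mul_assoc]
        congr 1
        simp [delta, hi]
      have h2 : ∀ a ∈ Finset.univ.erase b, eg 𝒜 N i b * (res 𝒜 N a b x * eg 𝒜 N a b) =
          eg 𝒜 N i a * (res 𝒜 N a b x * eg 𝒜 N a b) +
            eg 𝒜 N i b * (res 𝒜 N a b x * eg 𝒜 N a i) := by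
        intro a _
        have hc : ∀ (l m l' m' : Fin n) (y : CT 𝒜 N n), eg 𝒜 N l m * (y * eg 𝒜 N l' m') =
            inv 𝒜 N n y * (eg 𝒜 N l m * eg 𝒜 N l' m') := fun l m l' m' y => by
          rw [← mul_assoc, (isSuper_eg l m).mul_eq, mul_assoc]
          rfl
        rw [hc, hc, hc, ← mul_add]
        congr 1
        have h := eg_arnold (𝒜 := 𝒜) (N := N) i b a
        rw [eg_symm b a, eg_symm a i, eg_comm a b i a, eg_comm i a i b] at h
        rw [eg_symm a i]
        have h' : eg 𝒜 N i b * eg 𝒜 N a b -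
            (eg 𝒜 N i a * eg 𝒜 N a b + eg 𝒜 N i b * eg 𝒜 N i a) = 0 := by
          rw [← h]
          abel
        exact sub_eq_zero.1 h'
      rw [Finset.sum_congr rfl h1, Finset.sum_add_distrib, Finset.sum_ite_eq, if_pos (by simpa),
        map_mul, keep_eg, if_neg (by simp), zero_mul, zero_add]
      have h3 : inv 𝒜 N n (relabel 𝒜 N (collapse i b) x) * eg 𝒜 N i b =
          eg 𝒜 N i b * relabel 𝒜 N (collapse i b) x := ((isSuper_eg i b).mul_eq _).symm
      rw [h3]
      conv_rhs => rw [hx]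
      conv_lhs => rw [hx]
      rw [mul_add, map_add, mul_add, eg_mul_relabel_keep, map_sum, Finset.mul_sum,
        Finset.mul_sum, Finset.sum_congr rfl h2, Finset.sum_add_distrib, ← hx]
      have h4 : ∀ a ∈ Finset.univ.erase b, eg 𝒜 N i b * relabel 𝒜 N (collapse i b)
          (res 𝒜 N a b x * eg 𝒜 N a b) = eg 𝒜 N i b * (res 𝒜 N a b x * eg 𝒜 N a i) := by
        intro a ha
        have ha' : a ≠ b := Finset.ne_of_mem_erase ha
        rw [map_mul, relabel_res_of_ne ha', relabel_eg, collapse_of_ne ha', collapse_self]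
      rw [Finset.sum_congr rfl h4]
      abel
    by_cases hm : m = b
    · subst hm
      exact key l hlm
    by_cases hl : l = b
    · subst hl
      rw [eg_symm l m]
      exact key m hlm.symm
    conv_lhs => rw [hx]
    rw [mul_add, map_mul, keep_eg, if_pos (by simp [hl, hm]), Finset.mul_sum]
    congr 1
    refine Finset.sum_congr rfl fun a _ => ?_
    rw [res_eg_mul _ _ _ _ hlm, collapse_of_ne hl, collapse_of_ne hm]
    simp [delta, hl, hm, mul_assoc]

theorem res_keep_of_mem {S : Finset (Fin n)} {a b : Fin n} (ha : a ∈ S) (hb : b ∈ S)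
    (x : CT 𝒜 N n) : res 𝒜 N a b (keep 𝒜 N S x) = keep 𝒜 N S (res 𝒜 N a b x) := by
  have hc : ∀ i, collapse a b i ∈ S ↔ i ∈ S := fun i => by
    by_cases h : i = b
    · subst h; rw [collapse_self]; exact ⟨fun _ => hb, fun _ => ha⟩
    · rw [collapse_of_ne h]
  have hr : ∀ y : CT 𝒜 N n, relabel 𝒜 N (collapse a b) (keep 𝒜 N S y) =
      keep 𝒜 N S (relabel 𝒜 N (collapse a b) y) := by
    intro y
    have : (relabel 𝒜 N (collapse a b)).comp (keep 𝒜 N S) =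
        (keep 𝒜 N S).comp (relabel 𝒜 N (collapse a b)) :=
      eOne_algHom_ext (fun i s a _ => by simp) (fun i j h => by
        rw [AlgHom.comp_apply, AlgHom.comp_apply, relabel_eg, keep_eg, keep_eg]
        simp only [hc]
        split_ifs <;> simp)
    exact AlgHom.congr_fun this y
  induction x using eOne_induction with
  | one => simp
  | add x y hx hy => simp only [map_add, hx, hy]
  | smul c x hx => simp only [map_smul, hx]
  | p_mul i s y hy x hx => rw [map_mul, keep_pt, res_pt_mul, res_pt_mul, map_mul, keep_pt, hx]
  | e_mul i j hij x hx =>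
    rw [map_mul, keep_eg, res_eg_mul _ _ _ _ hij, map_add, map_mul (keep 𝒜 N S),
      map_mul (keep 𝒜 N S), keep_eg, keep_delta]
    simp only [hc]
    split_ifs with h
    · rw [res_eg_mul _ _ _ _ hij, hx, hr, inv_keep]
    · have : delta 𝒜 N a b i j = 0 := by
        rw [delta, if_neg]
        rintro (⟨rfl, rfl⟩ | ⟨rfl, rfl⟩)
        · exact h ⟨ha, hb⟩
        · exact h ⟨hb, ha⟩
      simp [this]

theorem res_keep_of_notMem {S : Finset (Fin n)} {a b : Fin n} (h : a ∉ S) (x : CT 𝒜 N n) :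
    res 𝒜 N a b (keep 𝒜 N S x) = 0 := by
  induction x using eOne_induction with
  | one => simp
  | add x y hx hy => simp only [map_add, hx, hy, add_zero]
  | smul c x hx => simp only [map_smul, hx, smul_zero]
  | p_mul i s y hy x hx => rw [map_mul, keep_pt, res_pt_mul, hx, mul_zero]
  | e_mul i j hij x hx =>
    rw [map_mul, keep_eg]
    split_ifs with h'
    · rw [res_eg_mul _ _ _ _ hij, hx, mul_zero, zero_add, delta, if_neg, zero_mul]
      rintro (⟨rfl, rfl⟩ | ⟨rfl, rfl⟩)
      · exact h h'.1
      · exact h h'.2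
    · simp

/-! ### The three-term relation for residues -/

/-- The rule for the residue of `e_{ij} y` also holds for `i = j`, where both sides vanish. -/
theorem res_eg_mul' {a b : Fin n} (hab : a ≠ b) (i j : Fin n) (y : CT 𝒜 N n) :
    res 𝒜 N a b (eg 𝒜 N i j * y) = eg 𝒜 N (collapse a b i) (collapse a b j) * res 𝒜 N a b y +
      delta 𝒜 N a b i j * inv 𝒜 N n (relabel 𝒜 N (collapse a b) y) := by
  by_cases hij : i = j
  · subst hij
    have : delta 𝒜 N a b i i = 0 := by
      rw [delta, if_neg]
      rintro (⟨rfl, rfl⟩ | ⟨rfl, rfl⟩) <;> exact hab rfl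
    simp [this]
  · exact res_eg_mul _ _ _ _ hij _

/-- The cyclic permutation `a ↦ b ↦ j ↦ a`. -/
def cyc (a b j : Fin n) : Equiv.Perm (Fin n) := Equiv.swap a b * Equiv.swap b j

section ThreeTerm

variable {a b j : Fin n}

theorem cyc_apply (hab : a ≠ b) (hbj : b ≠ j) (hja : j ≠ a) (i : Fin n) :
    cyc a b j i = if i = a then b else if i = b then j else if i = j then a else i := by
  simp only [cyc, Equiv.Perm.mul_apply]
  split_ifs with h1 h2 h3
  · rw [h1, Equiv.swap_apply_of_ne_of_ne hab hja.symm, Equiv.swap_apply_left]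
  · rw [h2, Equiv.swap_apply_left, Equiv.swap_apply_of_ne_of_ne hja hbj.symm]
  · rw [h3, Equiv.swap_apply_right, Equiv.swap_apply_right]
  · rw [Equiv.swap_apply_of_ne_of_ne h2 h3, Equiv.swap_apply_of_ne_of_ne h1 h2]

theorem cyc_cyc_cyc (hab : a ≠ b) (hbj : b ≠ j) (hja : j ≠ a) (i : Fin n) :
    cyc a b j (cyc a b j (cyc a b j i)) = i := by
  simp only [cyc_apply hab hbj hja]
  grind

theorem collapse_cyc (hab : a ≠ b) (hbj : b ≠ j) (hja : j ≠ a) (i : Fin n) :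
    collapse j a (collapse a b (cyc a b j i)) = collapse j a (collapse a b i) := by
  simp only [cyc_apply hab hbj hja, collapse, Function.update_apply, id]
  grind

omit hN hH [GradedAlgebra 𝒜] in
theorem delta_cyc (hab : a ≠ b) (hbj : b ≠ j) (hja : j ≠ a) (i l : Fin n) :
    delta 𝒜 N j a (collapse a b i) (collapse a b l) =
      delta 𝒜 N a b (cyc a b j i) (cyc a b j l) +
        delta 𝒜 N a b (cyc a b j (cyc a b j i)) (cyc a b j (cyc a b j l)) := by
  simp only [delta, cyc_apply hab hbj hja, collapse, Function.update_apply, id]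
  by_cases hi1 : i = a <;> by_cases hi2 : i = b <;> by_cases hi3 : i = j <;>
  by_cases hl1 : l = a <;> by_cases hl2 : l = b <;> by_cases hl3 : l = j <;>
  simp_all [eq_comm]

theorem relabel_cyc (hab : a ≠ b) (hbj : b ≠ j) (hja : j ≠ a) (x : CT 𝒜 N n) :
    relabel 𝒜 N (cyc a b j) (relabel 𝒜 N (cyc a b j) (relabel 𝒜 N (cyc a b j) x)) = x := by
  rw [relabel_relabel, relabel_relabel]
  have : (⇑(cyc a b j) ∘ ⇑(cyc a b j)) ∘ ⇑(cyc a b j) = id :=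
    funext fun i => cyc_cyc_cyc hab hbj hja i
  rw [this, relabel_id]

theorem relabel_collapse_cyc (hab : a ≠ b) (hbj : b ≠ j) (hja : j ≠ a) (x : CT 𝒜 N n) :
    relabel 𝒜 N (collapse j a) (relabel 𝒜 N (collapse a b) (relabel 𝒜 N (cyc a b j) x)) =
      relabel 𝒜 N (collapse j a) (relabel 𝒜 N (collapse a b) x) := by
  rw [relabel_relabel, relabel_relabel, relabel_relabel]
  have : (collapse j a ∘ collapse a b) ∘ ⇑(cyc a b j) = collapse j a ∘ collapse a b :=
    funext fun i => collapse_cyc hab hbj hja i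
  rw [this]

/-- After the collision of `a` and `b`, a class `e_{jx}` with `x` the collision point comes from
`e_{ja}` or from `e_{jb}`. This gives two terms, written as cyclic images of residues at `a`, `b`.
-/
theorem res_relabel_collapse (hab : a ≠ b) (hbj : b ≠ j) (hja : j ≠ a) (x : CT 𝒜 N n) :
    res 𝒜 N j a (relabel 𝒜 N (collapse a b) x) =
      relabel 𝒜 N (collapse j a) (res 𝒜 N a b (relabel 𝒜 N (cyc a b j) x)) +
      relabel 𝒜 N (collapse j a)
        (res 𝒜 N a b (relabel 𝒜 N (cyc a b j) (relabel 𝒜 N (cyc a b j) x))) := by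
  induction x using eOne_induction with
  | one => simp
  | add x y hx hy =>
    simp only [map_add, hx, hy]
    abel
  | smul c x hx => simp only [map_smul, hx, smul_add]
  | p_mul i s y hy x hx =>
    simp only [map_mul, relabel_pt, res_pt_mul, hx, collapse_cyc hab hbj hja, mul_add]
  | e_mul i l hil x hx =>
    simp only [map_mul, map_add, relabel_eg, res_eg_mul' hja, res_eg_mul' hab, hx,
      collapse_cyc hab hbj hja, relabel_delta_any, ← inv_relabel,
      relabel_collapse_cyc hab hbj hja, delta_cyc hab hbj hja]
    rw [mul_add, add_mul]
    abel

/-- The cyclic sum of the iterated residues along three points vanishes. This is the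
dual form of the Jacobi identity. -/
theorem res_res_cyclic_sum (hab : a ≠ b) (hbj : b ≠ j) (hja : j ≠ a) (x : CT 𝒜 N n) :
    res 𝒜 N j a (res 𝒜 N a b x) +
      res 𝒜 N j a (res 𝒜 N a b (relabel 𝒜 N (cyc a b j) x)) +
      res 𝒜 N j a (res 𝒜 N a b (relabel 𝒜 N (cyc a b j) (relabel 𝒜 N (cyc a b j) x))) = 0 := by
  have hδ : ∀ (i l : Fin n) (y : CT 𝒜 N n), res 𝒜 N j a (delta 𝒜 N a b i l * y) =
      delta 𝒜 N a b i l * res 𝒜 N j a y := by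
    intro i l y
    unfold delta
    split_ifs <;> simp
  induction x using eOne_induction with
  | one => simp
  | add x y hx hy =>
    simp only [map_add]
    rw [← add_zero (0 : CT 𝒜 N n)]
    nth_rewrite 1 [← hx]
    rw [← hy]
    abel
  | smul c x hx => simp only [map_smul, ← smul_add, hx, smul_zero]
  | p_mul i s y hy x hx =>
    simp only [map_mul, relabel_pt, res_pt_mul, collapse_cyc hab hbj hja, ← mul_add, hx, mul_zero]
  | e_mul i l hil x hx =>
    simp only [map_mul, map_add, relabel_eg, res_eg_mul' hja, res_eg_mul' hab,
      collapse_cyc hab hbj hja, hδ, res_inv, delta_cyc hab hbj hja,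
      cyc_cyc_cyc hab hbj hja, res_relabel_collapse hab hbj hja, relabel_cyc hab hbj hja]
    -- The terms where no residue of `e_{il}` is taken cancel by induction, the others cancel in
    -- pairs: the sign is the anticommutation of residues with `inv`.
    have h := congrArg (fun z => eg 𝒜 N (collapse j a (collapse a b i))
      (collapse j a (collapse a b l)) * z) hx
    simp only [mul_add, mul_zero] at h
    rw [← h]
    simp only [add_mul, mul_add, mul_neg, neg_add]
    abel

/-- For a class invariant under cyclic permutation the three terms of the cyclic sum are equal; this
is where the characteristic has to be different from `3`. -/
theorem res_res_eq_zero (h3 : (3 : k) ≠ 0) (hab : a ≠ b) (hbj : b ≠ j) (hja : j ≠ a)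
    {x : CT 𝒜 N n} (hx : relabel 𝒜 N (cyc a b j) x = x) :
    res 𝒜 N j a (res 𝒜 N a b x) = 0 := by
  have h := res_res_cyclic_sum hab hbj hja x
  rw [hx, hx] at h
  have h' : (3 : k) • res 𝒜 N j a (res 𝒜 N a b x) = 0 := by
    rw [show (3 : k) = 1 + 1 + 1 by norm_num, add_smul, add_smul, one_smul, h]
  exact (smul_eq_zero.1 h').resolve_left h3

end ThreeTerm

end Reconstruction

/-! ### Invariant classes involve only disjoint pairs -/

section Invariants

variable {k : Type u} {H : Type v} [Field k] [Ring H] [Algebra k H]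
  {𝒜 : ℤ → Submodule k H} {N n : ℕ}

variable (𝒜 N) in
/-- `e_I = e_{i₁j₁} ⋯ e_{i_rj_r}`. -/
def eP {r : ℕ} (I : PairTuple n r) : CT 𝒜 N n :=
  (List.ofFn fun u => eg 𝒜 N (I.i u) (I.j u)).prod

variable (𝒜 N n) in
/-- The subalgebra of `E₁` generated by the classes `p_i^*(a)`. -/
def pAlg : Subalgebra k (CT 𝒜 N n) := Algebra.adjoin k {x | ∃ i a, x = pt 𝒜 N i a}

theorem pt_mem_pAlg (i : Fin n) (a : H) : pt 𝒜 N i a ∈ pAlg 𝒜 N n :=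
  Algebra.subset_adjoin ⟨i, a, rfl⟩

variable (𝒜 N) in
/-- The span of the classes `y · e_I` with `y` a polynomial in the classes `p_i^*(a)`, and `I` a
tuple of disjoint pairs contained in `S`. -/
def pairSpan (S : Finset (Fin n)) : Submodule k (CT 𝒜 N n) :=
  Submodule.span k {z | ∃ (r : ℕ) (I : PairTuple n r), (∀ u, I.i u ∈ S ∧ I.j u ∈ S) ∧
    ∃ y ∈ pAlg 𝒜 N n, z = y * eP 𝒜 N I}

theorem pairSpan_mono {S T : Finset (Fin n)} (h : S ⊆ T) : pairSpan 𝒜 N S ≤ pairSpan 𝒜 N T :=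
  Submodule.span_mono fun _ ⟨r, I, hI, hy⟩ => ⟨r, I, fun u => ⟨h (hI u).1, h (hI u).2⟩, hy⟩

/-- The tuple without pairs. -/
def PairTuple.nil (n : ℕ) : PairTuple n 0 where
  i := Fin.elim0
  j := Fin.elim0
  lt u := u.elim0
  strictMono_i u := u.elim0
  injective_j u := u.elim0
  disjoint u := u.elim0

/-- The tuple obtained by adding a pair in front. -/
def PairTuple.cons {r : ℕ} (I : PairTuple n r) (b a : Fin n) (hba : b < a) (hb : ∀ u, b < I.i u)
    (hai : ∀ u, a ≠ I.i u) (haj : ∀ u, a ≠ I.j u) : PairTuple n (r + 1) where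
  i := Fin.cons b I.i
  j := Fin.cons a I.j
  lt u := by
    refine Fin.cases ?_ (fun u => ?_) u
    · simpa
    · simpa using I.lt u
  strictMono_i := by
    intro u v huv
    induction u using Fin.cases with
    | zero =>
      induction v using Fin.cases with
      | zero => exact absurd huv (lt_irrefl _)
      | succ v => simpa using hb v
    | succ u =>
      induction v using Fin.cases with
      | zero => exact absurd huv (by simp)
      | succ v => simpa using I.strictMono_i (Fin.succ_lt_succ_iff.1 huv)
  injective_j := by
    intro u v huv
    induction u using Fin.cases with
    | zero =>
      induction v using Fin.cases with
      | zero => rfl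
      | succ v => exact absurd huv (by simpa using haj v)
    | succ u =>
      induction v using Fin.cases with
      | zero => exact absurd huv.symm (by simpa using haj u)
      | succ v => exact congrArg _ (I.injective_j (by simpa using huv))
  disjoint u v := by
    induction u using Fin.cases with
    | zero =>
      induction v using Fin.cases with
      | zero => simpa using hba.ne
      | succ v => simpa using ((hb v).trans (I.lt v)).ne
    | succ u =>
      induction v using Fin.cases with
      | zero => simpa using (hai u).symm
      | succ v => simpa using I.disjoint u v

variable [hN : Fact (Even N)] [hH : Fact (IsGradedCommutative 𝒜)] [GradedAlgebra 𝒜]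

theorem isSuper_list_prod {l : List (CT 𝒜 N n)} (h : ∀ x ∈ l, IsSuper 𝒜 N n 1 x) :
    IsSuper 𝒜 N n l.length l.prod := by
  induction l with
  | nil => exact IsSuper.one
  | cons x l ih =>
    rw [List.prod_cons]
    exact ((h x (by simp)).mul (ih fun y hy => h y (by simp [hy]))).congr
      (by rw [List.length_cons]; push_cast; exact ⟨0, by ring⟩)

theorem isSuper_eP {r : ℕ} (I : PairTuple n r) : IsSuper 𝒜 N n r (eP 𝒜 N I) := by
  have := isSuper_list_prod (𝒜 := 𝒜) (N := N) (l := List.ofFn fun u => eg 𝒜 N (I.i u) (I.j u))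
    (by
      intro x hx
      obtain ⟨u, rfl⟩ := (List.mem_ofFn' _ _).1 hx
      exact isSuper_eg _ _)
  rwa [List.length_ofFn] at this

theorem pairSpan_mul_eg {S : Finset (Fin n)} {b a : Fin n} (hS : ∀ c ∈ S, b < c) (hba : b < a)
    (ha : a ∉ S) {z : CT 𝒜 N n} (hz : z ∈ pairSpan 𝒜 N S) :
    z * eg 𝒜 N b a ∈ pairSpan 𝒜 N (insert b (insert a S)) := by
  induction hz using Submodule.span_induction with
  | mem z hz =>
    obtain ⟨r, I, hI, y, hy, rfl⟩ := hz
    rw [mul_assoc, (isSuper_eP I).comm (isSuper_eg b a), mul_smul_comm]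
    refine Submodule.smul_mem _ _ (Submodule.subset_span ⟨r + 1, I.cons b a hba
      (fun u => hS _ (hI u).1) (fun u h => ha (h ▸ (hI u).1)) (fun u h => ha (h ▸ (hI u).2)),
      fun u => ?_, y, hy, ?_⟩)
    · induction u using Fin.cases with
      | zero => simp [PairTuple.cons]
      | succ u => simp [PairTuple.cons, hI u]
    · congr 1
      symm
      rw [eP, List.ofFn_succ, List.prod_cons]
      rfl
  | zero => simp
  | add x y _ _ hx hy => rw [add_mul]; exact add_mem hx hy
  | smul c x _ hx => rw [smul_mul_assoc]; exact Submodule.smul_mem _ _ hx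

theorem keep_empty_mem_pAlg (x : CT 𝒜 N n) : keep 𝒜 N ∅ x ∈ pAlg 𝒜 N n := by
  induction x using eOne_induction with
  | one => rw [map_one]; exact one_mem _
  | add x y hx hy => rw [map_add]; exact add_mem hx hy
  | smul c x hx => rw [map_smul]; exact Subalgebra.smul_mem _ hx _
  | p_mul i s a ha x hx => rw [map_mul, keep_pt]; exact mul_mem (pt_mem_pAlg i a) hx
  | e_mul i j h x hx => rw [map_mul, keep_eg, if_neg (by simp), zero_mul]; exact zero_mem _

/-- A class invariant under the permutations of the points of `S` involves, among the points of
`S`, only products `e_I` over disjoint pairs. By induction on `S`, using the reconstruction of a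
class from its residues at a point `b`: by the three-term relation and invariance, the residue at
`a`, `b` has itself no residues at the point `a`. -/
theorem keep_mem_pairSpan (h3 : (3 : k) ≠ 0 ∨ n ≤ 2) (S : Finset (Fin n)) (x : CT 𝒜 N n)
    (hx : ∀ σ : Equiv.Perm (Fin n), (∀ i, i ∉ S → σ i = i) → relabel 𝒜 N σ x = x) :
    keep 𝒜 N S x ∈ pairSpan 𝒜 N S := by
  induction S using Finset.strongInduction generalizing x with
  | H S ih =>
  rcases S.eq_empty_or_nonempty with rfl | hS
  · refine Submodule.subset_span ⟨0, PairTuple.nil n, fun u => u.elim0, _,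
      keep_empty_mem_pAlg x, ?_⟩
    simp [eP]
  · set b := S.min' hS with hb
    -- The smallest point of `S` is split off, so that the new pair comes in front of the others.
    have hbS : b ∈ S := S.min'_mem hS
    have hlt : ∀ c ∈ S.erase b, b < c := fun c hc =>
      lt_of_le_of_ne (S.min'_le c (Finset.mem_of_mem_erase hc)) (Finset.ne_of_mem_erase hc).symm
    have hinter : ∀ (T : Finset (Fin n)) (c : Fin n), Finset.univ.erase c ∩ T = T.erase c := by
      intro T c
      ext i
      simp
    rw [eq_keep_add_sum_res b (keep 𝒜 N S x), keep_keep, hinter]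
    refine add_mem (pairSpan_mono (S.erase_subset b) (ih _ (Finset.erase_ssubset hbS) x
      fun σ hσ => hx σ fun i hi => hσ i fun hi' => hi (Finset.mem_of_mem_erase hi')))
      (Submodule.sum_mem _ fun a ha => ?_)
    have hab : a ≠ b := Finset.ne_of_mem_erase ha
    by_cases haS : a ∈ S
    swap
    · rw [res_keep_of_notMem haS, zero_mul]
      exact zero_mem _
    have haS' : a ∈ S.erase b := Finset.mem_erase.2 ⟨hab, haS⟩
    -- The residue at `a`, `b` involves no class `e_{ja}`: its own residues along collisions with
    -- `a` vanish.
    have key : res 𝒜 N a b (keep 𝒜 N S x) =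
        keep 𝒜 N ((S.erase b).erase a) (res 𝒜 N a b x) := by
      have hz : ∀ j ∈ Finset.univ.erase a, res 𝒜 N j a (keep 𝒜 N S (res 𝒜 N a b x)) = 0 := by
        intro j hj
        have hja : j ≠ a := Finset.ne_of_mem_erase hj
        by_cases hjS : j ∈ S
        swap
        · exact res_keep_of_notMem hjS _
        rw [res_keep_of_mem hjS haS]
        by_cases hjb : j = b
        · rw [← keep_res hab, res_keep_of_notMem (by simp [hjb]), map_zero]
        -- There are three distinct points here, so that `n ≤ 2` is excluded.
        · have h3' : (3 : k) ≠ 0 := h3.resolve_right fun h => by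
            have h1 := a.2
            have h2 := b.2
            have h3 := j.2
            have e1 : (a : ℕ) ≠ b := fun h => hab (Fin.ext h)
            have e2 : (j : ℕ) ≠ a := fun h => hja (Fin.ext h)
            have e3 : (j : ℕ) ≠ b := fun h => hjb (Fin.ext h)
            omega
          rw [res_res_eq_zero h3' hab (Ne.symm hjb) hja (hx _ fun i hi => ?_), map_zero]
          rw [cyc_apply hab (Ne.symm hjb) hja, if_neg, if_neg, if_neg]
          · rintro rfl; exact hi hjS
          · rintro rfl; exact hi hbS
          · rintro rfl; exact hi haS
      rw [res_keep_of_mem haS hbS, eq_keep_add_sum_res a (keep 𝒜 N S (res 𝒜 N a b x)),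
        Finset.sum_eq_zero fun j hj => by rw [hz j hj, zero_mul], add_zero, ← keep_res hab,
        keep_keep, keep_keep, keep_keep]
      congr 2
      ext i
      simp only [Finset.mem_inter, Finset.mem_erase, Finset.mem_univ]
      tauto
    rw [key, eg_symm]
    -- The residue is invariant under the permutations of the remaining points, which fix `a` and
    -- `b`.
    have hmem := ih ((S.erase b).erase a)
      ((Finset.erase_ssubset haS').trans (Finset.erase_ssubset hbS)) (res 𝒜 N a b x)
      fun σ hσ => by
        have h1 : σ a = a := hσ a (by simp)
        have h2 : σ b = b := hσ b (by simp)
        rw [← res_relabel, h1, h2, hx σ fun i hi => hσ i fun hi' =>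
          hi (Finset.mem_of_mem_erase (Finset.mem_of_mem_erase hi'))]
    have := pairSpan_mul_eg (fun c hc => hlt c (Finset.mem_of_mem_erase hc)) (hlt a haS')
      (Finset.notMem_erase _ _) hmem
    rwa [Finset.insert_erase haS', Finset.insert_erase hbS] at this

theorem mem_pairSpan_of_invariant (h3 : (3 : k) ≠ 0 ∨ n ≤ 2) {x : CT 𝒜 N n}
    (hx : ∀ σ : Equiv.Perm (Fin n), relabel 𝒜 N σ x = x) : x ∈ pairSpan 𝒜 N Finset.univ := by
  have h := keep_mem_pairSpan h3 Finset.univ x fun σ _ => hx σ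
  have : keep 𝒜 N (n := n) Finset.univ = AlgHom.id k _ :=
    eOne_algHom_ext (fun i s a _ => by simp) (fun i j h => by simp [keep_eg])
  rwa [this] at h

end Invariants

/-! ### Gradings of `E₁` -/

section Grading

variable {k : Type u} {H : Type v} [Field k] [Ring H] [Algebra k H]
  {𝒜 : ℤ → Submodule k H} {N n : ℕ} [GradedAlgebra 𝒜]

variable (𝒜 N) in
/-- The coaction `a ↦ ∑_s p_i^*(a_s) T^{ws}` on the class `p_i^*(a)`. -/
def gradePt (w : ℤ) (i : Fin n) : H →ₗ[k] AddMonoidAlgebra (CT 𝒜 N n) ℤ :=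
  (DirectSum.toModule k ℤ _ fun s =>
    (AddMonoidAlgebra.lsingle (w * s)).comp ((pt 𝒜 N i).comp (𝒜 s).subtype)).comp
    (DirectSum.decomposeLinearEquiv 𝒜).toLinearMap

theorem gradePt_of_mem (w : ℤ) (i : Fin n) {s : ℤ} {a : H} (ha : a ∈ 𝒜 s) :
    gradePt 𝒜 N w i a = AddMonoidAlgebra.single (w * s) (pt 𝒜 N i a) := by
  rw [gradePt, LinearMap.comp_apply, LinearEquiv.coe_coe,
    DirectSum.decomposeLinearEquiv_apply, DirectSum.decompose_of_mem 𝒜 ha,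
    ← DirectSum.lof_eq_of k, DirectSum.toModule_lof]
  rfl

variable (𝒜 N) in
/-- The coaction on `p_i^*`, as a morphism of algebras. -/
def gradePtHom (w : ℤ) (i : Fin n) : H →ₐ[k] AddMonoidAlgebra (CT 𝒜 N n) ℤ :=
  AlgHom.ofLinearMap (gradePt 𝒜 N w i)
    (by
      rw [gradePt_of_mem w i (SetLike.GradedOne.one_mem : (1 : H) ∈ 𝒜 0), pt_one, mul_zero]
      rfl)
    (by
      suffices h : (LinearMap.mul k H).compr₂ (gradePt 𝒜 N w i) =
          (LinearMap.mul k _).compl₁₂ (gradePt 𝒜 N w i) (gradePt 𝒜 N w i) from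
        fun x y => LinearMap.congr_fun (LinearMap.congr_fun h x) y
      refine linearMap_ext_homogeneous 𝒜 fun s a ha => linearMap_ext_homogeneous 𝒜
        fun t b hb => ?_
      rw [LinearMap.compr₂_apply, LinearMap.compl₁₂_apply, LinearMap.mul_apply',
        LinearMap.mul_apply', gradePt_of_mem w i ha, gradePt_of_mem w i hb,
        gradePt_of_mem w i (SetLike.GradedMul.mul_mem ha hb), AddMonoidAlgebra.single_mul_single,
        mul_add, pt_mul])

theorem gradePtHom_of_mem (w : ℤ) (i : Fin n) {s : ℤ} {a : H} (ha : a ∈ 𝒜 s) :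
    gradePtHom 𝒜 N w i a = AddMonoidAlgebra.single (w * s) (pt 𝒜 N i a) := gradePt_of_mem w i ha

theorem gradePtHom_zero (i : Fin n) (a : H) :
    gradePtHom 𝒜 N 0 i a = AddMonoidAlgebra.single 0 (pt 𝒜 N i a) := by
  have : gradePt 𝒜 N 0 i = (AddMonoidAlgebra.lsingle 0).comp (pt 𝒜 N i) :=
    linearMap_ext_homogeneous 𝒜 fun s a ha => by
      rw [gradePt_of_mem _ _ ha, zero_mul]
      rfl
  exact LinearMap.congr_fun this a

variable [hN : Fact (Even N)] [hH : Fact (IsGradedCommutative 𝒜)]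

theorem isRep_grade (w v : ℤ) :
    IsRep 𝒜 (gradePtHom 𝒜 N w) (fun i j : Fin n => AddMonoidAlgebra.single v (eg 𝒜 N i j)) where
  p_comm i j _ s t a b ha hb := by
    rw [gradePtHom_of_mem _ _ ha, gradePtHom_of_mem _ _ hb, AddMonoidAlgebra.single_mul_single,
      AddMonoidAlgebra.single_mul_single, AddMonoidAlgebra.smul_single, ← pt_comm _ _ ha hb,
      add_comm]
  e_p i j l _ s a ha := by
    rw [gradePtHom_of_mem _ _ ha, AddMonoidAlgebra.single_mul_single,
      AddMonoidAlgebra.single_mul_single, AddMonoidAlgebra.smul_single, ← eg_mul_pt _ _ _ ha,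
      add_comm]
  e_comm i j l m _ _ := by
    rw [AddMonoidAlgebra.single_mul_single, AddMonoidAlgebra.single_mul_single, eg_comm,
      AddMonoidAlgebra.single_neg]
  arnold i j l _ _ _ := by
    simp only [AddMonoidAlgebra.single_mul_single, ← AddMonoidAlgebra.single_add, eg_arnold,
      AddMonoidAlgebra.single_zero]
  sq i j _ := by rw [AddMonoidAlgebra.single_mul_single, eg_sq, AddMonoidAlgebra.single_zero]
  symm i j _ := by rw [eg_symm]
  p_e i j _ a := by
    have : (LinearMap.mulRight k (AddMonoidAlgebra.single v (eg 𝒜 N i j))).comp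
          (gradePtHom 𝒜 N w i).toLinearMap =
        (LinearMap.mulRight k (AddMonoidAlgebra.single v (eg 𝒜 N i j))).comp
          (gradePtHom 𝒜 N w j).toLinearMap :=
      linearMap_ext_homogeneous 𝒜 fun s a ha => by
        simp only [LinearMap.comp_apply, AlgHom.toLinearMap_apply, LinearMap.mulRight_apply]
        rw [gradePtHom_of_mem _ _ ha, gradePtHom_of_mem _ _ ha,
          AddMonoidAlgebra.single_mul_single, AddMonoidAlgebra.single_mul_single, pt_mul_eg]
    exact LinearMap.congr_fun this a

variable (𝒜 N n) in
/-- The coaction which defines the grading of `E₁` in which `p_i^*(a)` has degree `w|a|` and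
`e_{ij}` has degree `v`. -/
def gradeHom (w v : ℤ) : CT 𝒜 N n →ₐ[k] AddMonoidAlgebra (CT 𝒜 N n) ℤ :=
  liftE N (isRep_grade w v)

variable (𝒜 N n) in
/-- The part of degree `d` in the grading of `E₁` in which `p_i^*(a)` has degree `w|a|` and `e_{ij}`
has degree `v`. -/
def homog (w v d : ℤ) : Submodule k (CT 𝒜 N n) :=
  LinearMap.eqLocus (gradeHom 𝒜 N n w v).toLinearMap (AddMonoidAlgebra.lsingle d)

theorem mem_homog {w v d : ℤ} {x : CT 𝒜 N n} :
    x ∈ homog 𝒜 N n w v d ↔ gradeHom 𝒜 N n w v x = AddMonoidAlgebra.single d x := Iff.rfl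

theorem pt_mem_homog (w v : ℤ) (i : Fin n) {s : ℤ} {a : H} (ha : a ∈ 𝒜 s) :
    pt 𝒜 N i a ∈ homog 𝒜 N n w v (w * s) := by
  rw [mem_homog, gradeHom, liftE_pt, gradePtHom_of_mem _ _ ha]

theorem pt_mem_homog_zero (v : ℤ) (i : Fin n) (a : H) : pt 𝒜 N i a ∈ homog 𝒜 N n 0 v 0 := by
  rw [mem_homog, gradeHom, liftE_pt, gradePtHom_zero]

theorem eg_mem_homog (w v : ℤ) (i j : Fin n) : eg 𝒜 N i j ∈ homog 𝒜 N n w v v := by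
  rw [mem_homog, gradeHom, liftE_eg' _ (by simp)]

theorem one_mem_homog (w v : ℤ) : (1 : CT 𝒜 N n) ∈ homog 𝒜 N n w v 0 := by
  rw [mem_homog, map_one]
  rfl

theorem mul_mem_homog {w v d d' : ℤ} {x y : CT 𝒜 N n} (hx : x ∈ homog 𝒜 N n w v d)
    (hy : y ∈ homog 𝒜 N n w v d') : x * y ∈ homog 𝒜 N n w v (d + d') := by
  rw [mem_homog] at *
  rw [map_mul, hx, hy, AddMonoidAlgebra.single_mul_single]

theorem list_prod_mem_homog {w v d : ℤ} {l : List (CT 𝒜 N n)}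
    (h : ∀ x ∈ l, x ∈ homog 𝒜 N n w v d) : l.prod ∈ homog 𝒜 N n w v (l.length * d) := by
  induction l with
  | nil => simpa using one_mem_homog w v
  | cons x l ih =>
    rw [List.prod_cons, List.length_cons]
    have := mul_mem_homog (h x (by simp)) (ih fun y hy => h y (by simp [hy]))
    convert this using 1
    push_cast
    ring_nf

variable (𝒜 N n) in
/-- The projection of `E₁` onto its part of degree `d`. -/
def homogProj (w v d : ℤ) : CT 𝒜 N n →ₗ[k] CT 𝒜 N n where
  toFun x := (gradeHom 𝒜 N n w v x).coeff d
  map_add' x y := by rw [map_add]; rfl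
  map_smul' c x := by rw [map_smul]; rfl

theorem homogProj_of_mem {w v d : ℤ} {x : CT 𝒜 N n} (hx : x ∈ homog 𝒜 N n w v d) (d' : ℤ) :
    homogProj 𝒜 N n w v d' x = if d = d' then x else 0 := by
  change (gradeHom 𝒜 N n w v x).coeff d' = _
  rw [mem_homog.1 hx, AddMonoidAlgebra.coeff_single, Finsupp.single_apply]

end Grading

/-! ### Tensors as elements of `E₁` -/

section Placement

variable {k : Type u} {H : Type v} [Field k] [Ring H] [Algebra k H]
  {𝒜 : ℤ → Submodule k H} {N n : ℕ}

variable (𝒜 N) in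
/-- The map `x₁ ⊗ ⋯ ⊗ xₘ ↦ p_{c(1)}^*(x₁) ⋯ p_{c(m)}^*(xₘ)`. -/
def placeC {m : ℕ} (c : Fin m → Fin n) : (⨂[k]^m H) →ₗ[k] CT 𝒜 N n :=
  letters fun u => pt 𝒜 N (c u)

variable (𝒜 N) in
/-- The suspended class `e_{ij} p_i^*(x)`, of degree `|x| + N - 1`. -/
def edge (i j : Fin n) : H →ₗ[k] CT 𝒜 N n := (LinearMap.mulLeft k (eg 𝒜 N i j)).comp (pt 𝒜 N i)

theorem edge_apply (i j : Fin n) (x : H) : edge 𝒜 N i j x = eg 𝒜 N i j * pt 𝒜 N i x := rfl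

variable (𝒜 N) in
/-- The map `x₁ ⊗ ⋯ ⊗ x_r ↦ ∏_u e_{i_uj_u} p_{i_u}^*(x_u)`. -/
def edgeC {r : ℕ} (i j : Fin r → Fin n) : (⨂[k]^r H) →ₗ[k] CT 𝒜 N n :=
  letters fun u => edge 𝒜 N (i u) (j u)

variable (𝒜 N) in
/-- The bilinear extension of `(α, β) ↦ φ_I(α) ψ_I(β)` to all tensors. -/
def summand {r : ℕ} (I : PairTuple n r) : (⨂[k]^(n - 2 * r) H) ⊗[k] (⨂[k]^r H) →ₗ[k] CT 𝒜 N n :=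
  (LinearMap.mul' k (CT 𝒜 N n)).comp (TensorProduct.map
    (placeC 𝒜 N (I.compl.orderEmbOfFin I.card_compl)) (edgeC 𝒜 N I.i I.j))

theorem summand_tmul {r : ℕ} (I : PairTuple n r) (α : ⨂[k]^(n - 2 * r) H) (β : ⨂[k]^r H) :
    summand 𝒜 N I (α ⊗ₜ β) =
      placeC 𝒜 N (I.compl.orderEmbOfFin I.card_compl) α * edgeC 𝒜 N I.i I.j β := by
  rw [summand, LinearMap.comp_apply, TensorProduct.map_tmul, LinearMap.mul'_apply]

theorem toCT_phi {r : ℕ} (I : PairTuple n r) (α : ⨂[k]^(n - 2 * r) H) :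
    toCT 𝒜 N n (phi 𝒜 N I α) = placeC 𝒜 N (I.compl.orderEmbOfFin I.card_compl) α :=
  algHom_letters (toCT 𝒜 N n).toAlgHom _ α

variable [hN : Fact (Even N)] [hH : Fact (IsGradedCommutative 𝒜)] [GradedAlgebra 𝒜]

theorem isSuper_edge (i j : Fin n) {ε : Fin 2} {x : H} (hx : HasParity 𝒜 ε x) :
    IsSuper 𝒜 N n (((ε : ℕ) : ℤ) + 1) (edge 𝒜 N i j x) := by
  rw [add_comm]
  exact (isSuper_eg i j).mul (isSuper_pt i hx)

omit hN [GradedAlgebra 𝒜] hH in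
theorem ofFn_smul_prod {B : Type*} [Ring B] [Algebra k B] {m : ℕ} (s : Fin m → ℤ)
    (a : Fin m → B) : (List.ofFn fun u => sgn k (s u) • a u).prod =
      sgn k (∑ u, s u) • (List.ofFn a).prod := by
  induction m with
  | zero => simp
  | succ m ih =>
    rw [List.ofFn_succ, List.ofFn_succ, List.prod_cons, List.prod_cons, ih, smul_mul_smul_comm,
      Fin.sum_univ_succ, sgn_add]

/-- Insertion of tensors in `E₁` is multiplicative. -/
theorem placeC_mul_placeC {m : ℕ} (c : Fin m → Fin n) (α γ : ⨂[k]^m H) :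
    placeC 𝒜 N c α * placeC 𝒜 N c γ = placeC 𝒜 N c (nu 𝒜 m α γ) := by
  suffices h : (LinearMap.mul k _).compl₁₂ (placeC 𝒜 N c) (placeC 𝒜 N c) =
      (nu 𝒜 m).compr₂ (placeC 𝒜 N c) from LinearMap.congr_fun (LinearMap.congr_fun h α) γ
  refine tensor_ext_parity 𝒜 fun ε x hx => tensor_ext_parity 𝒜 fun δ y hy => ?_
  rw [LinearMap.compl₁₂_apply, LinearMap.compr₂_apply, LinearMap.mul_apply', nu,
    componentwise_tprod _ hx hy, map_smul, placeC, letters_tprod, letters_tprod, letters_tprod,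
    ofFn_prod_mul_ofFn_prod _ _ (fun i j => ((ε j : ℕ) : ℤ) * ((δ i : ℕ) : ℤ))
      fun i j _ => (isSuper_pt _ (hx j)).comm (isSuper_pt _ (hy i))]
  congr 1
  · congr 1
    simp only [crossExponent, Finset.mul_sum, mul_ite, mul_zero]
  · simp only [pt_mul]

/-- The signs of `ν̄` are those which come from the multiplication of `E₁`. -/
theorem placeC_mul_edgeC {r : ℕ} (i j : Fin r → Fin n) (α β : ⨂[k]^r H) :
    placeC 𝒜 N i α * edgeC 𝒜 N i j β = edgeC 𝒜 N i j (nuBar 𝒜 r α β) := by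
  suffices h : (LinearMap.mul k _).compl₁₂ (placeC 𝒜 N i) (edgeC 𝒜 N i j) =
      (nuBar 𝒜 r).compr₂ (edgeC 𝒜 N i j) from LinearMap.congr_fun (LinearMap.congr_fun h α) β
  refine tensor_ext_parity 𝒜 fun ε x hx => tensor_ext_parity 𝒜 fun δ y hy => ?_
  have hm : ∀ u, pt 𝒜 N (i u) (x u) * edge 𝒜 N (i u) (j u) (y u) =
      sgn k ((ε u : ℕ) : ℤ) • edge 𝒜 N (i u) (j u) (x u * y u) := by
    intro u
    rw [edge_apply, edge_apply, pt_mul, ← mul_assoc, ← mul_assoc,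
      (isSuper_pt (i u) (hx u)).comm (isSuper_eg (i u) (j u)), mul_one, smul_mul_assoc]
  have hcard : ∀ v : Fin r, (∑ u : Fin r, if u < v then (1 : ℤ) else 0) = ((v : ℕ) : ℤ) := by
    intro v
    rw [Finset.sum_boole]
    congr 1
    rw [show (Finset.univ.filter fun u : Fin r => u < v) = Finset.Iio v by ext; simp,
      Fin.card_Iio]
  rw [LinearMap.compl₁₂_apply, LinearMap.compr₂_apply, LinearMap.mul_apply', nuBar,
    componentwise_tprod _ hx hy, map_smul, placeC, edgeC, letters_tprod, letters_tprod,
    letters_tprod,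
    ofFn_prod_mul_ofFn_prod _ _ (fun u v => ((ε v : ℕ) : ℤ) * (((δ u : ℕ) : ℤ) + 1))
      fun u v _ => (isSuper_pt _ (hx v)).comm (isSuper_edge _ _ (hy u))]
  simp only [hm]
  rw [ofFn_smul_prod, smul_smul, ← sgn_add]
  congr 2
  rw [crossExponent, ← Finset.sum_add_distrib, ← Finset.sum_add_distrib]
  refine Finset.sum_congr rfl fun v _ => ?_
  have : ∀ u : Fin r, (if u < v then ((ε v : ℕ) : ℤ) * (((δ u : ℕ) : ℤ) + 1) else 0) =
      ((ε v : ℕ) : ℤ) * (if u < v then ((δ u : ℕ) : ℤ) else 0) +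
        ((ε v : ℕ) : ℤ) * (if u < v then (1 : ℤ) else 0) := by
    intro u
    split_ifs <;> ring
  simp only [this, Finset.sum_add_distrib, ← Finset.mul_sum, hcard]
  ring

omit hN hH in
theorem hasParity_one : HasParity 𝒜 0 (1 : H) :=
  hasParity_of_mem (SetLike.GradedOne.one_mem : (1 : H) ∈ 𝒜 0) rfl

theorem toCT_psi {r : ℕ} (I : PairTuple n r) (β : ⨂[k]^r H) :
    toCT 𝒜 N n (psi 𝒜 N I β) = edgeC 𝒜 N I.i I.j β := by
  suffices h : (toCT 𝒜 N n).toLinearMap.comp (psi 𝒜 N I) = edgeC 𝒜 N I.i I.j from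
    LinearMap.congr_fun h β
  refine tensor_ext_parity 𝒜 fun ε x hx => ?_
  have h1 : toCT 𝒜 N n (eProd 𝒜 N I) = edgeC 𝒜 N I.i I.j (PiTensorProduct.tprod k fun _ => 1) := by
    rw [eProd, map_list_prod, List.map_ofFn, edgeC, letters_tprod]
    congr 2
    funext u
    rw [edge_apply, pt_one, mul_one, eg_of_ne (I.lt u).ne]
    rfl
  have h2 : ∀ t, toCT 𝒜 N n (place 𝒜 N I.i t) = placeC 𝒜 N I.i t := fun t =>
    algHom_letters (toCT 𝒜 N n).toAlgHom _ t
  rw [LinearMap.comp_apply, psi, LinearMap.comp_apply, LinearMap.comp_apply, weightOp_tprod _ hx,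
    map_smul, map_smul, map_smul, LinearMap.mulRight_apply, AlgEquiv.toLinearMap_apply, map_mul,
    h1, h2, placeC_mul_edgeC, nuBar, componentwise_tprod _ hx (fun _ => hasParity_one), map_smul,
    smul_smul, ← sgn_add, sgn_of_even, one_smul]
  · simp
  · obtain ⟨c, hc⟩ := odd_pred N
    rw [hc]
    simp only [crossExponent, Fin.val_zero, Nat.cast_zero, ite_self, Finset.sum_const_zero,
      mul_zero, zero_add]
    exact ⟨(c + 1) * ∑ u : Fin r, (((u : ℕ) : ℤ) + 1) * ((ε u : ℕ) : ℤ), by ring⟩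

end Placement

/-! ### Separating the summands indexed by tuples of pairs -/

section Extraction

variable {k : Type u} {H : Type v} [Field k] [Ring H] [Algebra k H]
  {𝒜 : ℤ → Submodule k H} {N n : ℕ}

namespace PairTuple

variable {r : ℕ} (I : PairTuple n r)

/-- The relation between two points of being a pair of `I`. -/
def rel (x y : Fin n) : Prop := ∃ u, (x = I.i u ∧ y = I.j u) ∨ (x = I.j u ∧ y = I.i u)

theorem isBlockRel_rel : IsBlockRel I.rel where
  symm := by
    rintro x y ⟨u, h | h⟩
    · exact ⟨u, Or.inr h.symm⟩
    · exact ⟨u, Or.inl h.symm⟩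
  trans := by
    rintro x y z hxz ⟨u, ⟨rfl, rfl⟩ | ⟨rfl, rfl⟩⟩ ⟨v, ⟨h, rfl⟩ | ⟨h, rfl⟩⟩
    · exact absurd h.symm (I.disjoint _ _)
    · rw [I.injective_j h] at hxz
      exact absurd rfl hxz
    · rw [I.strictMono_i.injective h] at hxz
      exact absurd rfl hxz
    · exact absurd h (I.disjoint _ _)

theorem two_mul_le {n r : ℕ} (I : PairTuple n r) : 2 * r ≤ n := by
  have h : Function.Injective (Sum.elim I.i I.j) :=
    Function.Injective.sumElim I.strictMono_i.injective I.injective_j I.disjoint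
  have := Fintype.card_le_of_injective _ h
  simp only [Fintype.card_sum, Fintype.card_fin] at this
  omega

@[ext] theorem ext' {I J : PairTuple n r} (hi : I.i = J.i) (hj : I.j = J.j) : I = J := by
  cases I
  cases J
  subst hi hj
  rfl

/-- The pairs of `I` whose numbers are the values of the increasing map `a`. -/
def sub {s : ℕ} (a : Fin s → Fin r) (ha : StrictMono a) : PairTuple n s where
  i u := I.i (a u)
  j u := I.j (a u)
  lt _ := I.lt _
  strictMono_i := I.strictMono_i.comp ha
  injective_j := I.injective_j.comp ha.injective
  disjoint _ _ := I.disjoint _ _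

/-- A tuple whose pairs are all pairs of `I` consists of some of the pairs of `I`. -/
theorem exists_eq_sub {s : ℕ} {J : PairTuple n s} (h : ∀ u, I.rel (J.i u) (J.j u)) :
    ∃ (a : Fin s → Fin r) (ha : StrictMono a), J = I.sub a ha := by
  have h' : ∀ u, ∃ v, J.i u = I.i v ∧ J.j u = I.j v := by
    intro u
    obtain ⟨v, h1 | h1⟩ := h u
    · exact ⟨v, h1⟩
    · have h2 := J.lt u
      rw [h1.1, h1.2] at h2
      exact absurd h2 (I.lt v).not_gt
  choose f hf using h'
  have hmono : StrictMono f := fun a b hab => by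
    have := J.strictMono_i hab
    rw [(hf a).1, (hf b).1] at this
    exact I.strictMono_i.lt_iff_lt.1 this
  exact ⟨f, hmono, ext' (funext fun u => (hf u).1) (funext fun u => (hf u).2)⟩

/-- A tuple of `r` pairs whose pairs are all pairs of `I` is equal to `I`. -/
theorem eq_of_rel {J : PairTuple n r} (h : ∀ u, I.rel (J.i u) (J.j u)) : J = I := by
  obtain ⟨f, hmono, rfl⟩ := I.exists_eq_sub h
  have hid : f = id := (hmono.range_inj strictMono_id).1 (by
    rw [Set.range_id, (Finite.injective_iff_surjective.1 hmono.injective).range_eq])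
  subst hid
  rfl

theorem mem_compl_iff {x : Fin n} : x ∈ I.compl ↔ (∀ u, x ≠ I.i u) ∧ ∀ u, x ≠ I.j u := by
  simp [compl, eq_comm]

end PairTuple

variable [hN : Fact (Even N)] [hH : Fact (IsGradedCommutative 𝒜)] [GradedAlgebra 𝒜]

variable (𝒜 N) in
/-- The projection of the span of the classes `y · e_J` onto the part belonging to `I`. Killing the
classes `e_{xy}` for which `x`, `y` is not a pair of `I` leaves the tuples `J` which are part of
`I`, and of these `I` is the one of the right length. -/
def extract {r : ℕ} (I : PairTuple n r) : CT 𝒜 N n →ₗ[k] CT 𝒜 N n :=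
  (homogProj 𝒜 N n 0 1 r).comp (restrict 𝒜 N I.isBlockRel_rel).toLinearMap

theorem pAlg_le_homog {y : CT 𝒜 N n} (hy : y ∈ pAlg 𝒜 N n) :
    y ∈ homog 𝒜 N n 0 1 0 := by
  induction hy using Algebra.adjoin_induction with
  | mem x hx =>
    obtain ⟨i, a, rfl⟩ := hx
    exact pt_mem_homog_zero 1 i a
  | algebraMap c =>
    rw [Algebra.algebraMap_eq_smul_one]
    exact Submodule.smul_mem _ _ (one_mem_homog 0 1)
  | add x y _ _ hx hy => exact add_mem hx hy
  | mul x y _ _ hx hy => simpa using mul_mem_homog hx hy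

omit [GradedAlgebra 𝒜] in
theorem restrict_of_mem_pAlg {c : Fin n → Fin n → Prop} (hc : IsBlockRel c) {y : CT 𝒜 N n}
    (hy : y ∈ pAlg 𝒜 N n) : restrict 𝒜 N hc y = y := by
  induction hy using Algebra.adjoin_induction with
  | mem x hx =>
    obtain ⟨i, a, rfl⟩ := hx
    exact restrict_pt hc i a
  | algebraMap c => exact AlgHom.commutes _ _
  | add x y _ _ hx hy => rw [map_add, hx, hy]
  | mul x y _ _ hx hy => rw [map_mul, hx, hy]

theorem eP_mem_homog {r : ℕ} (w v : ℤ) (I : PairTuple n r) :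
    eP 𝒜 N I ∈ homog 𝒜 N n w v (r * v) := by
  have := list_prod_mem_homog (𝒜 := 𝒜) (N := N) (w := w) (d := v)
    (l := List.ofFn fun u => eg 𝒜 N (I.i u) (I.j u)) (by
      intro x hx
      obtain ⟨u, rfl⟩ := (List.mem_ofFn' _ _).1 hx
      exact eg_mem_homog _ _ _ _)
  rwa [List.length_ofFn] at this

theorem extract_self {r : ℕ} (I : PairTuple n r) {y : CT 𝒜 N n} (hy : y ∈ pAlg 𝒜 N n) :
    extract 𝒜 N I (y * eP 𝒜 N I) = y * eP 𝒜 N I := by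
  have h : restrict 𝒜 N I.isBlockRel_rel (eP 𝒜 N I) = eP 𝒜 N I := by
    rw [eP, map_list_prod, List.map_ofFn]
    congr 2
    funext u
    rw [Function.comp_apply, restrict_eg, if_pos ⟨u, Or.inl ⟨rfl, rfl⟩⟩]
  rw [extract, LinearMap.comp_apply, AlgHom.toLinearMap_apply, map_mul, h,
    restrict_of_mem_pAlg _ hy,
    homogProj_of_mem (mul_mem_homog (pAlg_le_homog hy) (eP_mem_homog 0 1 I)), if_pos (by ring)]

theorem extract_of_not_rel {r s : ℕ} (I : PairTuple n r) (J : PairTuple n s)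
    {u : Fin s} (hu : ¬ I.rel (J.i u) (J.j u)) (y : CT 𝒜 N n) :
    extract 𝒜 N I (y * eP 𝒜 N J) = 0 := by
  have h : restrict 𝒜 N I.isBlockRel_rel (eP 𝒜 N J) = 0 := by
    rw [eP, map_list_prod, List.map_ofFn]
    refine List.prod_eq_zero ((List.mem_ofFn' _ _).2 ⟨u, ?_⟩)
    rw [Function.comp_apply, restrict_eg, if_neg hu]
  rw [extract, LinearMap.comp_apply, AlgHom.toLinearMap_apply, map_mul, h, mul_zero, map_zero]

theorem extract_of_ne {r : ℕ} (I J : PairTuple n r) (hIJ : J ≠ I) (y : CT 𝒜 N n) :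
    extract 𝒜 N I (y * eP 𝒜 N J) = 0 := by
  obtain ⟨u, hu⟩ := not_forall.1 fun h => hIJ (I.eq_of_rel h)
  exact extract_of_not_rel I J hu y

theorem extract_of_card_ne {r s : ℕ} (I : PairTuple n r) (J : PairTuple n s) (hrs : s ≠ r)
    {y : CT 𝒜 N n} (hy : y ∈ pAlg 𝒜 N n) : extract 𝒜 N I (y * eP 𝒜 N J) = 0 := by
  by_cases h : ∀ u, I.rel (J.i u) (J.j u)
  · have h' : restrict 𝒜 N I.isBlockRel_rel (eP 𝒜 N J) = eP 𝒜 N J := by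
      rw [eP, map_list_prod, List.map_ofFn]
      congr 2
      funext u
      rw [Function.comp_apply, restrict_eg, if_pos (h u)]
    rw [extract, LinearMap.comp_apply, AlgHom.toLinearMap_apply, map_mul, h',
      restrict_of_mem_pAlg _ hy,
      homogProj_of_mem (mul_mem_homog (pAlg_le_homog hy) (eP_mem_homog 0 1 J)), if_neg]
    intro h''
    exact hrs (by exact_mod_cast (by simpa using h'' : (s : ℤ) = r))
  · obtain ⟨u, hu⟩ := not_forall.1 h
    exact extract_of_not_rel I J hu y

/-- A combination of classes `y · e_I` is determined by its parts belonging to the tuples `I`. -/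
theorem eq_zero_of_extract {S : Finset (Fin n)} {x : CT 𝒜 N n} (hx : x ∈ pairSpan 𝒜 N S)
    (h : ∀ (t : Fin (n / 2 + 1)) (I : PairTuple n t), extract 𝒜 N I x = 0) : x = 0 := by
  have key : x = (∑ t : Fin (n / 2 + 1), ∑ I : PairTuple n t, extract 𝒜 N I) x := by
    clear h
    induction hx using Submodule.span_induction with
    | mem z hz =>
      obtain ⟨r, J, -, y, hy, rfl⟩ := hz
      have hr : r < n / 2 + 1 := by
        have := J.two_mul_le
        omega
      simp only [LinearMap.sum_apply]
      rw [Finset.sum_eq_single ⟨r, hr⟩, Finset.sum_eq_single J, extract_self J hy]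
      · exact fun I _ hI => extract_of_ne I J (Ne.symm hI) y
      · simp
      · exact fun t _ ht => Finset.sum_eq_zero fun I _ =>
          extract_of_card_ne I J (fun h => ht (Fin.ext h.symm)) hy
      · simp
    | zero => simp
    | add x y _ _ hx hy => rw [map_add, ← hx, ← hy]
    | smul c x _ hx => rw [map_smul, ← hx]
  rw [key]
  simp [h]

/-! ### The summand belonging to a tuple of pairs -/

omit hN hH [GradedAlgebra 𝒜] in
theorem placeC_mem_pAlg {m : ℕ} (c : Fin m → Fin n) (t : ⨂[k]^m H) :
    placeC 𝒜 N c t ∈ pAlg 𝒜 N n := by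
  have : (pAlg 𝒜 N n).toSubmodule.mkQ.comp (placeC 𝒜 N c) = 0 := by
    refine PiTensorProduct.ext (MultilinearMap.ext fun x => ?_)
    simp only [LinearMap.compMultilinearMap_apply, LinearMap.comp_apply, placeC, letters_tprod,
      LinearMap.zero_apply, Submodule.mkQ_apply, Submodule.Quotient.mk_eq_zero]
    refine (pAlg 𝒜 N n).list_prod_mem fun y hy => ?_
    obtain ⟨u, rfl⟩ := (List.mem_ofFn' _ _).1 hy
    exact pt_mem_pAlg _ _
  have := LinearMap.congr_fun this t
  rwa [LinearMap.comp_apply, LinearMap.zero_apply, Submodule.mkQ_apply,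
    Submodule.Quotient.mk_eq_zero] at this

/-- The sign by which `ψ_I` differs from the insertion of a tensor followed by `e_I`. -/
def edgeWeight (k : Type u) [Field k] (r : ℕ) (N : ℕ) (ε : Fin r → Fin 2) : k :=
  sgn k (((N : ℤ) - 1) * ∑ u : Fin r, (((u : ℕ) : ℤ) + 1) * ((ε u : ℕ) : ℤ))

theorem edgeC_eq {r : ℕ} (I : PairTuple n r) (β : ⨂[k]^r H) :
    edgeC 𝒜 N I.i I.j β = placeC 𝒜 N I.i (weightOp 𝒜 (edgeWeight k r N) β) * eP 𝒜 N I := by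
  have h1 : toCT 𝒜 N n (eProd 𝒜 N I) = eP 𝒜 N I := by
    rw [eProd, map_list_prod, List.map_ofFn, eP]
    congr 2
    funext u
    rw [eg_of_ne (I.lt u).ne]
    rfl
  rw [← toCT_psi, psi, LinearMap.comp_apply, LinearMap.comp_apply, LinearMap.mulRight_apply,
    map_mul, h1]
  exact congrArg (· * _) (algHom_letters (toCT 𝒜 N n).toAlgHom _ _)

theorem summand_eq {r : ℕ} (I : PairTuple n r) (z : (⨂[k]^(n - 2 * r) H) ⊗[k] (⨂[k]^r H)) :
    ∃ y ∈ pAlg 𝒜 N n, summand 𝒜 N I z = y * eP 𝒜 N I := by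
  suffices h : summand 𝒜 N I z ∈
      (pAlg 𝒜 N n).toSubmodule.map (LinearMap.mulRight k (eP 𝒜 N I)) by
    obtain ⟨y, hy, h⟩ := h
    exact ⟨y, hy, h.symm⟩
  induction z with
  | zero => rw [map_zero]; exact zero_mem _
  | add x y hx hy => rw [map_add]; exact add_mem hx hy
  | tmul α β =>
    refine ⟨placeC 𝒜 N (I.compl.orderEmbOfFin I.card_compl) α *
      placeC 𝒜 N I.i (weightOp 𝒜 (edgeWeight k r N) β),
      (pAlg 𝒜 N n).mul_mem (placeC_mem_pAlg _ _) (placeC_mem_pAlg _ _), ?_⟩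
    rw [LinearMap.mulRight_apply, summand_tmul, edgeC_eq, mul_assoc]

theorem extract_summand_self {r : ℕ} (I : PairTuple n r)
    (z : (⨂[k]^(n - 2 * r) H) ⊗[k] (⨂[k]^r H)) :
    extract 𝒜 N I (summand 𝒜 N I z) = summand 𝒜 N I z := by
  obtain ⟨y, hy, h⟩ := summand_eq (𝒜 := 𝒜) (N := N) I z
  rw [h, extract_self I hy]

theorem extract_summand_of_ne {r : ℕ} (I J : PairTuple n r) (hIJ : J ≠ I)
    (z : (⨂[k]^(n - 2 * r) H) ⊗[k] (⨂[k]^r H)) : extract 𝒜 N I (summand 𝒜 N J z) = 0 := by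
  obtain ⟨y, -, h⟩ := summand_eq (𝒜 := 𝒜) (N := N) J z
  rw [h, extract_of_ne I J hIJ]

theorem extract_summand_of_card_ne {r s : ℕ} (I : PairTuple n r) (J : PairTuple n s) (hrs : s ≠ r)
    (z : (⨂[k]^(n - 2 * s) H) ⊗[k] (⨂[k]^s H)) : extract 𝒜 N I (summand 𝒜 N J z) = 0 := by
  obtain ⟨y, hy, h⟩ := summand_eq (𝒜 := 𝒜) (N := N) J z
  rw [h, extract_of_card_ne I J hrs hy]

theorem summand_mem_pairSpan {r : ℕ} (I : PairTuple n r)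
    (z : (⨂[k]^(n - 2 * r) H) ⊗[k] (⨂[k]^r H)) :
    summand 𝒜 N I z ∈ pairSpan 𝒜 N Finset.univ := by
  obtain ⟨y, hy, h⟩ := summand_eq (𝒜 := 𝒜) (N := N) I z
  exact Submodule.subset_span ⟨r, I, fun u => by simp, y, hy, h⟩

omit hN hH [GradedAlgebra 𝒜] in
theorem pt_eq_placeC {m : ℕ} (c : Fin m → Fin n) (u : Fin m) (a : H) :
    pt 𝒜 N (c u) a =
      placeC 𝒜 N c (PiTensorProduct.tprod k (Function.update (fun _ => 1) u a)) := by
  rw [placeC, letters_tprod]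
  induction m with
  | zero => exact u.elim0
  | succ m ih =>
    rw [List.ofFn_succ, List.prod_cons]
    induction u using Fin.cases with
    | zero => simp [pt_one, Fin.succ_ne_zero]
    | succ u =>
      rw [ih (fun i => c i.succ) u]
      have h0 : Function.update (fun _ => (1 : H)) u.succ a 0 = 1 :=
        Function.update_of_ne (Fin.succ_ne_zero u).symm _ _
      rw [h0, pt_one, one_mul]
      congr 3
      funext i
      simp [Function.update_apply]

omit hN hH in
theorem isSuper_ofFn_prod [Fact (Even N)] [Fact (IsGradedCommutative 𝒜)] {m : ℕ} {d : Fin m → ℤ}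
    {a : Fin m → CT 𝒜 N n} (h : ∀ u, IsSuper 𝒜 N n (d u) (a u)) :
    IsSuper 𝒜 N n (∑ u, d u) (List.ofFn a).prod := by
  induction m with
  | zero => simpa using IsSuper.one
  | succ m ih =>
    rw [List.ofFn_succ, List.prod_cons, Fin.sum_univ_succ]
    exact (h 0).mul (ih fun u => h u.succ)

theorem isSuper_placeC_tprod {m : ℕ} (c : Fin m → Fin n) {ε : Fin m → Fin 2} {x : Fin m → H}
    (hx : ∀ u, HasParity 𝒜 (ε u) (x u)) :
    IsSuper 𝒜 N n (∑ u, ((ε u : ℕ) : ℤ)) (placeC 𝒜 N c (PiTensorProduct.tprod k x)) := by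
  rw [placeC, letters_tprod]
  exact isSuper_ofFn_prod fun u => isSuper_pt _ (hx u)

/-- On `e_I`, the two points of a pair of `I` are identified. -/
theorem pt_j_mul_mul_eP {r : ℕ} (I : PairTuple n r) (u : Fin r) (a : H) (x : CT 𝒜 N n) :
    pt 𝒜 N (I.j u) a * (x * eP 𝒜 N I) = pt 𝒜 N (I.i u) a * (x * eP 𝒜 N I) := by
  obtain ⟨m, rfl⟩ : ∃ m, r = m + 1 := ⟨r - 1, by have := u.2; omega⟩
  have h := ofFn_prod_pull (k := k) (fun v => eg 𝒜 N (I.i v) (I.j v)) u (fun _ => 1 * 1)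
    fun v _ => (isSuper_eg _ _).comm (isSuper_eg _ _)
  rw [eP, h, mul_smul_comm, mul_smul_comm, mul_smul_comm, ← mul_assoc x, ← mul_assoc,
    ← pt_mul_mul_eg, mul_assoc]

/-- The range of `summand I` is stable under the classes `p_i^*(a)`: such a class acts on the first
tensor if `i` is not in a pair of `I`, and on the second one otherwise. -/
theorem pt_mul_summand_mem {r : ℕ} (I : PairTuple n r) (w : Fin n) (a : H)
    (z : (⨂[k]^(n - 2 * r) H) ⊗[k] (⨂[k]^r H)) :
    pt 𝒜 N w a * summand 𝒜 N I z ∈ LinearMap.range (summand 𝒜 N I) := by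
  induction z with
  | zero => rw [map_zero, mul_zero]; exact zero_mem _
  | add x y hx hy => rw [map_add, mul_add]; exact add_mem hx hy
  | tmul α β =>
  by_cases hw : w ∈ I.compl
  · obtain ⟨u, rfl⟩ : ∃ u, I.compl.orderEmbOfFin I.card_compl u = w := by
      have : w ∈ Set.range (I.compl.orderEmbOfFin I.card_compl) := by
        rw [Finset.range_orderEmbOfFin]
        exact hw
      exact this
    rw [pt_eq_placeC, summand_tmul, ← mul_assoc, placeC_mul_placeC, ← summand_tmul]
    exact LinearMap.mem_range_self _ _
  · have key : ∀ u, pt 𝒜 N (I.i u) a * summand 𝒜 N I (α ⊗ₜ β) ∈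
        LinearMap.range (summand 𝒜 N I) := by
      intro u
      suffices h : ∀ (ε : Fin 2) (a : H), HasParity 𝒜 ε a →
          (LinearMap.range (summand 𝒜 N I)).mkQ.comp
            ((LinearMap.mulLeft k (pt 𝒜 N (I.i u) a)).comp ((summand 𝒜 N I).comp
              ((TensorProduct.mk k _ _).flip β))) = 0 by
        have h' : ∀ (ε : Fin 2) (a : H), HasParity 𝒜 ε a →
            pt 𝒜 N (I.i u) a * summand 𝒜 N I (α ⊗ₜ β) ∈
              LinearMap.range (summand 𝒜 N I) := by
          intro ε a ha
          have := LinearMap.congr_fun (h ε a ha) α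
          rwa [LinearMap.comp_apply, LinearMap.zero_apply, Submodule.mkQ_apply,
            Submodule.Quotient.mk_eq_zero] at this
        rw [← parityProj_add 𝒜 a, map_add, add_mul]
        exact add_mem (h' 0 _ (hasParity_parityProj 𝒜 _ _))
          (h' 1 _ (hasParity_parityProj 𝒜 _ _))
      intro ε a ha
      refine tensor_ext_parity 𝒜 fun δ x hx => ?_
      rw [LinearMap.zero_apply, LinearMap.comp_apply, Submodule.mkQ_apply,
        Submodule.Quotient.mk_eq_zero]
      simp only [LinearMap.comp_apply, LinearMap.mulLeft_apply, LinearMap.flip_apply,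
        TensorProduct.mk_apply]
      rw [summand_tmul, ← mul_assoc, (isSuper_pt _ ha).comm (isSuper_placeC_tprod _ hx),
        smul_mul_assoc, mul_assoc, pt_eq_placeC, placeC_mul_edgeC, ← summand_tmul]
      exact Submodule.smul_mem _ _ (LinearMap.mem_range_self _ _)
    rw [I.mem_compl_iff, not_and_or, not_forall, not_forall] at hw
    obtain ⟨u, hu⟩ | ⟨u, hu⟩ := hw
    · rw [not_not.1 hu]
      exact key u
    · obtain ⟨y, -, hy⟩ := summand_eq (𝒜 := 𝒜) (N := N) I (α ⊗ₜ β)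
      have := key u
      rw [hy] at this
      rw [not_not.1 hu, hy, pt_j_mul_mul_eP]
      exact this

theorem mul_eP_mem_range_summand {r : ℕ} (I : PairTuple n r) {y : CT 𝒜 N n}
    (hy : y ∈ pAlg 𝒜 N n) : y * eP 𝒜 N I ∈ LinearMap.range (summand 𝒜 N I) := by
  have key : ∀ z ∈ LinearMap.range (summand 𝒜 N I), y * z ∈ LinearMap.range (summand 𝒜 N I) := by
    induction hy using Algebra.adjoin_induction with
    | mem x hx =>
      obtain ⟨i, a, rfl⟩ := hx
      rintro _ ⟨z, rfl⟩
      exact pt_mul_summand_mem I i a z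
    | algebraMap c =>
      intro z hz
      rw [← Algebra.smul_def]
      exact Submodule.smul_mem _ _ hz
    | add x y _ _ hx hy =>
      intro z hz
      rw [add_mul]
      exact add_mem (hx z hz) (hy z hz)
    | mul x y _ _ hx hy =>
      intro z hz
      rw [mul_assoc]
      exact hx _ (hy z hz)
  refine key _ ⟨PiTensorProduct.tprod k (fun _ => 1) ⊗ₜ PiTensorProduct.tprod k (fun _ => 1), ?_⟩
  rw [summand_tmul, placeC, edgeC, letters_tprod, letters_tprod]
  simp only [pt_one, edge_apply, mul_one]
  rw [List.prod_eq_one, one_mul, eP]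
  intro x hx
  obtain ⟨u, rfl⟩ := (List.mem_ofFn' _ _).1 hx
  rfl

/-- The part belonging to `I` of a combination of classes `y · e_J` is a value of `summand I`. -/
theorem extract_mem_range_summand {S : Finset (Fin n)} {x : CT 𝒜 N n}
    (hx : x ∈ pairSpan 𝒜 N S) {t : ℕ} (I : PairTuple n t) :
    extract 𝒜 N I x ∈ LinearMap.range (summand 𝒜 N I) := by
  induction hx using Submodule.span_induction with
  | mem z hz =>
    obtain ⟨r, J, -, y, hy, rfl⟩ := hz
    by_cases hr : r = t
    · subst hr
      by_cases hJ : J = I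
      · subst hJ
        rw [extract_self J hy]
        exact mul_eP_mem_range_summand J hy
      · rw [extract_of_ne I J hJ]
        exact zero_mem _
    · rw [extract_of_card_ne I J hr hy]
      exact zero_mem _
  | zero => rw [map_zero]; exact zero_mem _
  | add x y _ _ hx hy => rw [map_add]; exact add_mem hx hy
  | smul c x _ hx => rw [map_smul]; exact Submodule.smul_mem _ _ hx

end Extraction

/-! ### A representation of `E₁` on tensors -/

section Representation

variable {k : Type u} {H : Type v} [Field k] [Ring H] [Algebra k H]
  {𝒜 : ℤ → Submodule k H} {N n : ℕ} [GradedAlgebra 𝒜]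

variable (𝒜) in
/-- The operator `x ↦ (-1)^{s|x|} x` of `H`. -/
def twist (s : ℤ) : Module.End k H := if Even s then 1 else (parityInv 𝒜).toLinearMap

theorem twist_of_mem (s : ℤ) {t : ℤ} {a : H} (ha : a ∈ 𝒜 t) : twist 𝒜 s a = sgn k (s * t) • a := by
  rw [twist]
  split_ifs with h
  · rw [sgn_of_even (h.mul_right t), one_smul, Module.End.one_apply]
  · rw [AlgHom.toLinearMap_apply, parityInv_of_mem ha]
    congr 1
    obtain ⟨c, rfl⟩ := Int.not_even_iff_odd.1 h
    exact sgn_congr ⟨-c * t, by ring⟩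

theorem twist_zero : twist 𝒜 0 = 1 := if_pos Even.zero

theorem twist_mul (s t : ℤ) : twist 𝒜 s * twist 𝒜 t = twist 𝒜 (s + t) :=
  linearMap_ext_homogeneous 𝒜 fun d a ha => by
    rw [Module.End.mul_apply, twist_of_mem t ha, map_smul, twist_of_mem s ha, twist_of_mem _ ha,
      smul_smul, ← sgn_add]
    congr 2
    ring

theorem twist_mul_mulLeft (s : ℤ) {t : ℤ} {a : H} (ha : a ∈ 𝒜 t) :
    twist 𝒜 s * LinearMap.mulLeft k a = sgn k (s * t) • (LinearMap.mulLeft k a * twist 𝒜 s) :=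
  linearMap_ext_homogeneous 𝒜 fun d b hb => by
    rw [Module.End.mul_apply, LinearMap.mulLeft_apply,
      twist_of_mem s (SetLike.GradedMul.mul_mem ha hb), LinearMap.smul_apply,
      Module.End.mul_apply, twist_of_mem s hb, LinearMap.mulLeft_apply, mul_smul_comm, smul_smul,
      ← sgn_add, mul_add]

variable (𝒜) in
/-- The operators whose tensor product is the multiplication by `1 ⊗ ⋯ ⊗ a ⊗ ⋯ ⊗ 1`, with `a` of
degree `s` in place `i`: in the places before `i` there is a sign. -/
def placeOp {m : ℕ} (i : Fin m) (s : ℤ) (a : H) (j : Fin m) : Module.End k H :=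
  if j < i then twist 𝒜 s else if j = i then LinearMap.mulLeft k a else 1

theorem placeOp_eq_update {m : ℕ} (i : Fin m) (s : ℤ) (a : H) :
    placeOp 𝒜 i s a = Function.update (placeOp 𝒜 i s 0) i (LinearMap.mulLeft k a) := by
  funext j
  rw [Function.update_apply, placeOp, placeOp]
  split_ifs with h1 h2 h3
  · exact absurd h1 (h2 ▸ lt_irrefl _)
  all_goals rfl

variable (𝒜) in
/-- Left multiplication by `1 ⊗ ⋯ ⊗ a ⊗ ⋯ ⊗ 1` on `T^m(H)`, for `a` of degree `s`. -/
def placeEnd {m : ℕ} (i : Fin m) (s : ℤ) : H →ₗ[k] Module.End k (⨂[k]^m H) :=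
  ((PiTensorProduct.mapMultilinear k (fun _ : Fin m => H) (fun _ => H)).toLinearMap
    (placeOp 𝒜 i s 0) i).comp (LinearMap.mul k H)

theorem placeEnd_apply {m : ℕ} (i : Fin m) (s : ℤ) (a : H) :
    placeEnd 𝒜 i s a = PiTensorProduct.map (placeOp 𝒜 i s a) := by
  rw [placeOp_eq_update]
  rfl

variable (𝒜) in
/-- Left multiplication by `1 ⊗ ⋯ ⊗ a ⊗ ⋯ ⊗ 1` on `T^m(H)`, as a linear map in `a`. -/
def placeLin {m : ℕ} (i : Fin m) : H →ₗ[k] Module.End k (⨂[k]^m H) :=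
  (DirectSum.toModule k ℤ _ fun s => (placeEnd 𝒜 i s).comp (𝒜 s).subtype).comp
    (DirectSum.decomposeLinearEquiv 𝒜).toLinearMap

theorem placeLin_of_mem {m : ℕ} (i : Fin m) {s : ℤ} {a : H} (ha : a ∈ 𝒜 s) :
    placeLin 𝒜 i a = PiTensorProduct.map (placeOp 𝒜 i s a) := by
  rw [placeLin, LinearMap.comp_apply, LinearEquiv.coe_coe,
    DirectSum.decomposeLinearEquiv_apply, DirectSum.decompose_of_mem 𝒜 ha,
    ← DirectSum.lof_eq_of k, DirectSum.toModule_lof, ← placeEnd_apply]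
  rfl

theorem placeOp_mul {m : ℕ} (i : Fin m) (s t : ℤ) (a b : H) :
    placeOp 𝒜 i s a * placeOp 𝒜 i t b = placeOp 𝒜 i (s + t) (a * b) := by
  funext j
  simp only [Pi.mul_apply, placeOp]
  split_ifs
  · exact twist_mul s t
  · rw [LinearMap.mulLeft_mul]
    rfl
  · rfl

variable (𝒜) in
/-- The morphism of algebras `a ↦ 1 ⊗ ⋯ ⊗ a ⊗ ⋯ ⊗ 1`, with values in the operators of `T^m(H)`. -/
def placeHom {m : ℕ} (i : Fin m) : H →ₐ[k] Module.End k (⨂[k]^m H) :=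
  AlgHom.ofLinearMap (placeLin 𝒜 i)
    (by
      rw [placeLin_of_mem i (SetLike.GradedOne.one_mem : (1 : H) ∈ 𝒜 0)]
      have : placeOp 𝒜 i 0 (1 : H) = fun _ => LinearMap.id := by
        funext j
        rw [placeOp, twist_zero, LinearMap.mulLeft_one]
        split_ifs <;> rfl
      rw [this, PiTensorProduct.map_id]
      rfl)
    (by
      suffices h : (LinearMap.mul k H).compr₂ (placeLin 𝒜 i) =
          (LinearMap.mul k _).compl₁₂ (placeLin 𝒜 i) (placeLin 𝒜 i) from
        fun x y => LinearMap.congr_fun (LinearMap.congr_fun h x) y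
      refine linearMap_ext_homogeneous 𝒜 fun s a ha => linearMap_ext_homogeneous 𝒜
        fun t b hb => ?_
      rw [LinearMap.compr₂_apply, LinearMap.compl₁₂_apply, LinearMap.mul_apply',
        LinearMap.mul_apply', placeLin_of_mem i ha, placeLin_of_mem i hb,
        placeLin_of_mem i (SetLike.GradedMul.mul_mem ha hb), ← PiTensorProduct.map_mul,
        ← placeOp_mul]
      rfl)

theorem placeHom_of_mem {m : ℕ} (i : Fin m) {s : ℤ} {a : H} (ha : a ∈ 𝒜 s) :
    placeHom 𝒜 i a = PiTensorProduct.map (placeOp 𝒜 i s a) := placeLin_of_mem i ha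

theorem placeHom_comm_of_lt {m : ℕ} {i j : Fin m} (hij : i < j) {s t : ℤ} {a b : H}
    (ha : a ∈ 𝒜 s) (hb : b ∈ 𝒜 t) :
    placeHom 𝒜 j b * placeHom 𝒜 i a = sgn k (s * t) • (placeHom 𝒜 i a * placeHom 𝒜 j b) := by
  have key : placeOp 𝒜 j t b * placeOp 𝒜 i s a =
      Function.update (placeOp 𝒜 i s a * placeOp 𝒜 j t b) i
        (sgn k (s * t) • (placeOp 𝒜 i s a * placeOp 𝒜 j t b) i) := by
    funext l
    rw [Function.update_apply]
    split_ifs with hl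
    · subst hl
      simp only [Pi.mul_apply, placeOp, if_pos hij, lt_irrefl, if_false, if_true]
      rw [twist_mul_mulLeft t ha, mul_comm s t]
    · simp only [Pi.mul_apply, placeOp, if_neg hl]
      rcases lt_or_gt_of_ne hl with h | h
      · rw [if_pos h, if_pos (h.trans hij), twist_mul, twist_mul, add_comm]
      · rw [if_neg h.not_gt, mul_one, one_mul]
  rw [placeHom_of_mem i ha, placeHom_of_mem j hb, ← PiTensorProduct.map_mul,
    ← PiTensorProduct.map_mul]
  change PiTensorProduct.map (placeOp 𝒜 j t b * placeOp 𝒜 i s a) =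
    sgn k (s * t) • PiTensorProduct.map (placeOp 𝒜 i s a * placeOp 𝒜 j t b)
  rw [key, PiTensorProduct.map_update_smul, Function.update_eq_self]

theorem placeHom_comm [hH : Fact (IsGradedCommutative 𝒜)] {m : ℕ} (i j : Fin m) {s t : ℤ} {a b : H}
    (ha : a ∈ 𝒜 s) (hb : b ∈ 𝒜 t) :
    placeHom 𝒜 i a * placeHom 𝒜 j b = sgn k (s * t) • (placeHom 𝒜 j b * placeHom 𝒜 i a) := by
  rcases lt_trichotomy i j with h | rfl | h
  · rw [placeHom_comm_of_lt h ha hb, smul_smul, sgn_mul_self, one_smul]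
  · rw [← map_mul, ← map_mul, hH.out s t a b ha hb, map_smul]
  · rw [placeHom_comm_of_lt h hb ha, mul_comm]

/-- A product of operators of which the first ones are `1` and the last ones fix `1`. -/
theorem ofFn_prod_apply_one {m : ℕ} (g : Fin m → Module.End k H) (j : Fin m)
    (h : ∀ i, i < j → g i = 1) (h' : ∀ i, j < i → g i 1 = 1) : (List.ofFn g).prod 1 = g j 1 := by
  have key : ∀ (m : ℕ) (g : Fin m → Module.End k H), (∀ i, g i 1 = 1) →
      (List.ofFn g).prod 1 = 1 := by
    intro m g hg
    induction m with
    | zero => simp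
    | succ m ih =>
      rw [List.ofFn_succ, List.prod_cons, Module.End.mul_apply, ih _ fun i => hg _, hg]
  induction m with
  | zero => exact j.elim0
  | succ m ih =>
    rw [List.ofFn_succ, List.prod_cons, Module.End.mul_apply]
    induction j using Fin.cases with
    | zero => rw [key _ _ fun i => h' _ (Fin.succ_pos i)]
    | succ j =>
      rw [h 0 (Fin.succ_pos j), Module.End.one_apply, ih (fun i => g i.succ) j
        (fun i hi => h _ (Fin.succ_lt_succ_iff.2 hi))
        (fun i hi => h' _ (Fin.succ_lt_succ_iff.2 hi))]

theorem letters_placeHom_apply_one {m : ℕ} (t : ⨂[k]^m H) :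
    letters (fun i => (placeHom 𝒜 i).toLinearMap) t
      (PiTensorProduct.tprod k fun _ => (1 : H)) = t := by
  have hspan := span_tprod_homogeneous 𝒜 m
  have ht : t ∈ Submodule.span k {t : ⨂[k]^m H | ∃ (e : Fin m → ℤ) (x : Fin m → H),
      (∀ i, x i ∈ 𝒜 (e i)) ∧ t = PiTensorProduct.tprod k x} := hspan ▸ Submodule.mem_top
  induction ht using Submodule.span_induction with
  | mem t ht =>
    obtain ⟨e, x, hx, rfl⟩ := ht
    have hmap : (List.ofFn fun i => (placeHom 𝒜 i).toLinearMap (x i)).prod =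
        PiTensorProduct.map (R := k)
          fun j => (List.ofFn fun i => placeOp 𝒜 i (e i) (x i) j).prod := by
      have h1 : (fun j => (List.ofFn fun i => placeOp 𝒜 i (e i) (x i) j).prod) =
          (List.ofFn fun i => placeOp 𝒜 i (e i) (x i)).prod := by
        funext j
        rw [Pi.list_prod_apply, List.map_ofFn]
        rfl
      rw [h1, ← PiTensorProduct.mapMonoidHom_apply, map_list_prod, List.map_ofFn]
      congr 2
      funext i
      exact placeHom_of_mem i (hx i)
    rw [letters_tprod, hmap, PiTensorProduct.map_tprod]
    congr 1
    funext j
    rw [ofFn_prod_apply_one _ j]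
    · simp [placeOp]
    · intro i hi
      rw [placeOp, if_neg hi.not_gt, if_neg hi.ne']
    · intro i hi
      rw [placeOp, if_pos hi, twist_of_mem _ (SetLike.GradedOne.one_mem : (1 : H) ∈ 𝒜 0),
        mul_zero, sgn_zero, one_smul]
  | zero => simp
  | add x y _ _ hx hy => rw [map_add, LinearMap.add_apply, hx, hy]
  | smul c x _ hx => rw [map_smul, LinearMap.smul_apply, hx]

variable [hN : Fact (Even N)] [hH : Fact (IsGradedCommutative 𝒜)]

theorem isRep_place {m : ℕ} (f : Fin n → Fin m) :
    IsRep 𝒜 (fun x => placeHom 𝒜 (f x)) (fun _ _ => 0) where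
  p_comm _ _ _ _ _ _ _ ha hb := placeHom_comm _ _ ha hb
  e_p _ _ _ _ _ _ _ := by simp
  e_comm _ _ _ _ _ _ := by simp
  arnold _ _ _ _ _ _ := by simp
  sq _ _ _ := by simp
  symm _ _ _ := rfl
  p_e _ _ _ _ := by simp

/-- Insertion of a tensor in distinct places is injective: the class obtained acts on tensors, and
its value on `1 ⊗ ⋯ ⊗ 1` recovers the tensor. -/
theorem placeC_injective {m : ℕ} {c : Fin m → Fin n} {f : Fin n → Fin m}
    (hf : Function.LeftInverse f c) : Function.Injective (placeC 𝒜 N c) := by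
  refine Function.LeftInverse.injective
    (g := fun y => liftE N (isRep_place (𝒜 := 𝒜) f) y (PiTensorProduct.tprod k fun _ => (1 : H)))
    fun t => ?_
  change liftE N (isRep_place (𝒜 := 𝒜) f) (letters _ t) _ = t
  rw [algHom_letters]
  refine Eq.trans ?_ (letters_placeHom_apply_one (𝒜 := 𝒜) t)
  congr 3
  funext i
  ext a
  rw [LinearMap.comp_apply, AlgHom.toLinearMap_apply, liftE_pt, hf]
  rfl

/-! ### Injectivity on the summand of a tuple of pairs -/

omit [GradedAlgebra 𝒜] in
theorem relabel_placeC {m : ℕ} (f : Fin n → Fin n) (c : Fin m → Fin n) (t : ⨂[k]^m H) :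
    relabel 𝒜 N f (placeC 𝒜 N c t) = placeC 𝒜 N (fun u => f (c u)) t := by
  rw [placeC, algHom_letters]
  congr 2
  funext u
  ext a
  simp

omit [GradedAlgebra 𝒜] in
theorem relabel_edgeC {r : ℕ} (f : Fin n → Fin n) (i j : Fin r → Fin n) (t : ⨂[k]^r H) :
    relabel 𝒜 N f (edgeC 𝒜 N i j t) = edgeC 𝒜 N (fun u => f (i u)) (fun u => f (j u)) t := by
  rw [edgeC, algHom_letters]
  congr 2
  funext u
  ext a
  simp [edge_apply]

theorem res_of_mem_pAlg (a b : Fin n) {y : CT 𝒜 N n} (hy : y ∈ pAlg 𝒜 N n) :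
    res 𝒜 N a b y = 0 := by
  induction hy using Algebra.adjoin_induction with
  | mem x hx =>
    obtain ⟨i, c, rfl⟩ := hx
    exact res_pt a b i c
  | algebraMap c => rw [Algebra.algebraMap_eq_smul_one, map_smul, res_one, smul_zero]
  | add x y _ _ hx hy => rw [map_add, hx, hy, add_zero]
  | mul x y _ _ hx hy => rw [res_mul, hx, hy, mul_zero, zero_mul, add_zero]

/-- The classes `e_{i_uj_u}` of disjoint pairs can be cancelled by taking residues, from a class `y`
which has no residues along these pairs and does not change when their points collide. -/
theorem eq_zero_of_mul_edges {r : ℕ} {i j : Fin r → Fin n} (hj : Function.Injective j)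
    (hij : ∀ u v, i u ≠ j v) {y : CT 𝒜 N n} (hy : ∀ u, res 𝒜 N (i u) (j u) y = 0)
    (hy' : ∀ u, relabel 𝒜 N (collapse (i u) (j u)) y = y)
    (h : y * (List.ofFn fun u => eg 𝒜 N (i u) (j u)).prod = 0) : y = 0 := by
  induction r with
  | zero => simpa using h
  | succ r ih =>
    refine ih (i := fun u => i u.succ) (j := fun u => j u.succ)
      (fun u v huv => Fin.succ_injective _ (hj huv)) (fun u v => hij _ _) (fun u => hy _)
      (fun u => hy' _) ?_
    set E := (List.ofFn fun u : Fin r => eg 𝒜 N (i u.succ) (j u.succ)).prod with hE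
    have h1 : IsSuper 𝒜 N n (∑ u : Fin r, 1) E := isSuper_ofFn_prod fun u => isSuper_eg _ _
    have h2 : relabel 𝒜 N (collapse (i 0) (j 0)) E = E := by
      rw [hE, map_list_prod, List.map_ofFn]
      congr 2
      funext u
      rw [Function.comp_apply, relabel_eg, collapse_of_ne (hij _ _),
        collapse_of_ne (hj.ne (Fin.succ_ne_zero u))]
    rw [List.ofFn_succ, List.prod_cons] at h
    -- The residue along the first pair removes the first factor, up to a sign.
    have h3 := congrArg (res 𝒜 N (i 0) (j 0)) h
    rw [map_zero, res_mul, hy 0, zero_mul, add_zero, hy' 0, res_eg_mul _ _ _ _ (hij _ _),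
      collapse_self, collapse_of_ne (hij _ _), eg_self, zero_mul, delta,
      if_pos (Or.inl ⟨rfl, rfl⟩), h2, h1.inv_eq] at h3
    have h4 := congrArg (sgn k (∑ u : Fin r, 1) • ·) h3
    simpa [sgn_sq_smul] using h4

omit [GradedAlgebra 𝒜] hN hH in
theorem placeC_append {p q : ℕ} (c : Fin p → Fin n) (d : Fin q → Fin n) (α : ⨂[k]^p H)
    (β : ⨂[k]^q H) : placeC 𝒜 N c α * placeC 𝒜 N d β =
      placeC 𝒜 N (Fin.append c d) (TensorPower.mulEquiv (α ⊗ₜ[k] β)) := by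
  rw [placeC, placeC, placeC, letters_mulEquiv]
  simp

omit hN hH in
theorem weightOp_edgeWeight (r : ℕ) (β : ⨂[k]^r H) :
    weightOp 𝒜 (edgeWeight k r N) (weightOp 𝒜 (edgeWeight k r N) β) = β := by
  suffices h : (weightOp 𝒜 (edgeWeight k r N)).comp (weightOp 𝒜 (edgeWeight k r N)) =
      LinearMap.id from LinearMap.congr_fun h β
  refine tensor_ext_parity 𝒜 fun ε x hx => ?_
  rw [LinearMap.comp_apply, weightOp_tprod _ hx, map_smul, weightOp_tprod _ hx, smul_smul,
    edgeWeight, sgn_mul_self, one_smul, LinearMap.id_apply]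

/-- Up to invertible signs, `summand I` inserts a tensor in distinct places and multiplies it by
`e_I`; both operations are injective. -/
theorem summand_injective {r : ℕ} (I : PairTuple n r) :
    Function.Injective (summand 𝒜 N I) := by
  let c : Fin (n - 2 * r) → Fin n := fun u => I.compl.orderEmbOfFin I.card_compl u
  have hmem : ∀ u, c u ∈ I.compl := fun u => Finset.orderEmbOfFin_mem _ _ u
  have hinj : Function.Injective (Fin.append c I.i) := by
    intro a b hab
    induction a using Fin.addCases with
    | left a =>
      induction b using Fin.addCases with
      | left b =>
        rw [Fin.append_left, Fin.append_left] at hab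
        rw [(I.compl.orderEmbOfFin I.card_compl).injective hab]
      | right b =>
        rw [Fin.append_left, Fin.append_right] at hab
        exact absurd hab ((I.mem_compl_iff.1 (hmem a)).1 b)
    | right a =>
      induction b using Fin.addCases with
      | left b =>
        rw [Fin.append_left, Fin.append_right] at hab
        exact absurd hab.symm ((I.mem_compl_iff.1 (hmem b)).1 a)
      | right b =>
        rw [Fin.append_right, Fin.append_right] at hab
        rw [I.strictMono_i.injective hab]
  have hne : ∀ a v, Fin.append c I.i a ≠ I.j v := by
    intro a v
    induction a using Fin.addCases with
    | left a =>
      rw [Fin.append_left]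
      exact (I.mem_compl_iff.1 (hmem a)).2 v
    | right a =>
      rw [Fin.append_right]
      exact I.disjoint _ _
  obtain ⟨f, hf⟩ : ∃ f : Fin n → Fin (n - 2 * r + r), Function.LeftInverse f (Fin.append c I.i) := by
    have h2 := I.two_mul_le
    rcases Nat.eq_zero_or_pos n with h0 | h0
    · exact ⟨fun x => absurd x.2 (by omega), fun x => absurd x.2 (by omega)⟩
    · have : Nonempty (Fin (n - 2 * r + r)) := ⟨⟨0, by omega⟩⟩
      exact ⟨Function.invFun _, Function.leftInverse_invFun hinj⟩
  let W : (⨂[k]^r H) →ₗ[k] (⨂[k]^r H) := weightOp 𝒜 (edgeWeight k r N)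
  let Q : (⨂[k]^(n - 2 * r) H) ⊗[k] (⨂[k]^r H) →ₗ[k] ⨂[k]^(n - 2 * r + r) H :=
    TensorPower.mulEquiv.toLinearMap.comp (TensorProduct.map LinearMap.id W)
  have hQ : Function.Injective Q := by
    refine TensorPower.mulEquiv.injective.comp (Function.LeftInverse.injective
      (g := TensorProduct.map LinearMap.id W) fun z => ?_)
    rw [← LinearMap.comp_apply, ← TensorProduct.map_comp]
    have : W.comp W = LinearMap.id := LinearMap.ext fun β => weightOp_edgeWeight r β
    rw [this]
    simp
  have hsum : ∀ z, summand 𝒜 N I z = placeC 𝒜 N (Fin.append c I.i) (Q z) * eP 𝒜 N I := by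
    intro z
    induction z with
    | zero => simp
    | add x y hx hy => rw [map_add, map_add, map_add, add_mul, hx, hy]
    | tmul α β =>
      rw [summand_tmul, edgeC_eq, ← mul_assoc]
      exact congrArg (· * _) (placeC_append c I.i α (W β))
  rw [injective_iff_map_eq_zero]
  intro z hz
  rw [hsum] at hz
  refine hQ (placeC_injective (𝒜 := 𝒜) (N := N) hf ?_)
  rw [map_zero, map_zero]
  refine eq_zero_of_mul_edges I.injective_j I.disjoint
    (fun u => res_of_mem_pAlg _ _ (placeC_mem_pAlg _ _)) (fun u => ?_) hz
  rw [relabel_placeC]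
  congr 2
  funext a
  exact collapse_of_ne (hne a u)

end Representation

/-! ### Tensors which are invariant in each factor -/

section InvariantTensors

variable {k : Type u} {V W : Type*} [Field k] [AddCommGroup V] [Module k V] [AddCommGroup W]
  [Module k W]

/-- A tensor fixed by `f ⊗ 1` for each `f` of a family of operators of `V`, and by `1 ⊗ g` for each
`g` of a family of operators of `W`, comes from the tensor product of the subspaces of fixed
vectors. -/
theorem mem_range_mapIncl_of_fixed {ι κ : Type*} (f : ι → V →ₗ[k] V) (g : κ → W →ₗ[k] W)
    {z : V ⊗[k] W} (hf : ∀ a, TensorProduct.map (f a) LinearMap.id z = z)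
    (hg : ∀ b, TensorProduct.map LinearMap.id (g b) z = z) :
    z ∈ LinearMap.range (TensorProduct.mapIncl (⨅ a, LinearMap.eqLocus (f a) LinearMap.id)
      (⨅ b, LinearMap.eqLocus (g b) LinearMap.id)) := by
  set P : Submodule k V := ⨅ a, LinearMap.eqLocus (f a) LinearMap.id with hP
  set Q : Submodule k W := ⨅ b, LinearMap.eqLocus (g b) LinearMap.id with hQ
  -- In a basis of `W` the coefficients of `z` are fixed by each `f a`.
  have step1 : ∃ z' : P ⊗[k] W, TensorProduct.map P.subtype LinearMap.id z' = z := by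
    let B := Module.Free.chooseBasis k W
    have hnat : ∀ (h : V →ₗ[k] V) (y : V ⊗[k] W) i,
        TensorProduct.equivFinsuppOfBasisRight B (TensorProduct.map h LinearMap.id y) i =
          h (TensorProduct.equivFinsuppOfBasisRight B y i) := by
      intro h y i
      induction y with
      | zero => simp
      | tmul v w =>
        rw [TensorProduct.map_tmul, TensorProduct.equivFinsuppOfBasisRight_apply_tmul_apply,
          TensorProduct.equivFinsuppOfBasisRight_apply_tmul_apply, map_smul]
        rfl
      | add a b ha hb => simp only [map_add, Finsupp.add_apply, ha, hb]
    have hmem : ∀ i, TensorProduct.equivFinsuppOfBasisRight B z i ∈ P := by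
      intro i
      rw [hP, Submodule.mem_iInf]
      intro a
      rw [LinearMap.mem_eqLocus, ← hnat, hf, LinearMap.id_apply]
    refine ⟨∑ i ∈ (TensorProduct.equivFinsuppOfBasisRight B z).support,
      (⟨_, hmem i⟩ : P) ⊗ₜ B i, ?_⟩
    rw [map_sum]
    conv_rhs => rw [← (TensorProduct.equivFinsuppOfBasisRight B).symm_apply_apply z,
      TensorProduct.equivFinsuppOfBasisRight_symm_apply]
    rfl
  obtain ⟨z', hz'⟩ := step1
  have hinj : Function.Injective (TensorProduct.map P.subtype (LinearMap.id : W →ₗ[k] W)) :=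
    Module.Flat.rTensor_preserves_injective_linearMap _ P.subtype_injective
  have hg' : ∀ b, TensorProduct.map LinearMap.id (g b) z' = z' := by
    intro b
    apply hinj
    rw [hz', ← hg b, ← hz', ← LinearMap.comp_apply, ← LinearMap.comp_apply,
      ← TensorProduct.map_comp, ← TensorProduct.map_comp]
    simp only [LinearMap.comp_id, LinearMap.id_comp]
  -- In a basis of the space `P` of fixed vectors of `V` the coefficients of `z` are fixed by each
  -- `g b`.
  let B := Module.Free.chooseBasis k P
  have hnat : ∀ (h : W →ₗ[k] W) (y : P ⊗[k] W) i,
      TensorProduct.equivFinsuppOfBasisLeft B (TensorProduct.map LinearMap.id h y) i =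
        h (TensorProduct.equivFinsuppOfBasisLeft B y i) := by
    intro h y i
    induction y with
    | zero => simp
    | tmul v w =>
      rw [TensorProduct.map_tmul, TensorProduct.equivFinsuppOfBasisLeft_apply_tmul_apply,
        TensorProduct.equivFinsuppOfBasisLeft_apply_tmul_apply, map_smul]
      rfl
    | add a b ha hb => simp only [map_add, Finsupp.add_apply, ha, hb]
  have hmem : ∀ i, TensorProduct.equivFinsuppOfBasisLeft B z' i ∈ Q := by
    intro i
    rw [hQ, Submodule.mem_iInf]
    intro b
    rw [LinearMap.mem_eqLocus, ← hnat, hg', LinearMap.id_apply]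
  refine ⟨∑ i ∈ (TensorProduct.equivFinsuppOfBasisLeft B z').support,
    B i ⊗ₜ (⟨_, hmem i⟩ : Q), ?_⟩
  rw [map_sum, ← hz']
  conv_rhs => rw [← (TensorProduct.equivFinsuppOfBasisLeft B).symm_apply_apply z',
    TensorProduct.equivFinsuppOfBasisLeft_symm_apply, Finsupp.sum, map_sum]
  rfl

end InvariantTensors

/-! ### Moving tuples of pairs by permutations -/

namespace PairTuple

variable {n r : ℕ}

/-- The increasing enumeration of the points which do not belong to the pairs of `I`. -/
def rest (I : PairTuple n r) : Fin (n - 2 * r) → Fin n := I.compl.orderEmbOfFin I.card_compl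

theorem rest_injective (I : PairTuple n r) : Function.Injective I.rest :=
  (I.compl.orderEmbOfFin I.card_compl).injective

theorem rest_mem (I : PairTuple n r) (u : Fin (n - 2 * r)) : I.rest u ∈ I.compl :=
  Finset.orderEmbOfFin_mem _ _ u

theorem exists_rest_eq (I : PairTuple n r) {x : Fin n} (hx : x ∈ I.compl) : ∃ u, I.rest u = x := by
  have : x ∈ Set.range (I.compl.orderEmbOfFin I.card_compl) := by
    rw [Finset.range_orderEmbOfFin]
    exact hx
  exact this

/-- `σ` carries the points of `I` to those of `J`: the remaining points according to `τ`, and the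
pairs according to `ρ`, regardless of their orientation. -/
structure Transports (σ : Equiv.Perm (Fin n)) (I J : PairTuple n r)
    (τ : Equiv.Perm (Fin (n - 2 * r))) (ρ : Equiv.Perm (Fin r)) : Prop where
  rest : ∀ u, σ (I.rest u) = J.rest (τ u)
  pair : ∀ u, (σ (I.i u) = J.i (ρ u) ∧ σ (I.j u) = J.j (ρ u)) ∨
    (σ (I.i u) = J.j (ρ u) ∧ σ (I.j u) = J.i (ρ u))

theorem Transports.rel_iff {σ : Equiv.Perm (Fin n)} {I J : PairTuple n r}
    {τ : Equiv.Perm (Fin (n - 2 * r))} {ρ : Equiv.Perm (Fin r)} (h : Transports σ I J τ ρ)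
    (x y : Fin n) : J.rel (σ x) (σ y) ↔ I.rel x y := by
  constructor
  · rintro ⟨u, hu⟩
    obtain ⟨v, rfl⟩ := ρ.surjective u
    refine ⟨v, ?_⟩
    rcases h.pair v with ⟨h1, h2⟩ | ⟨h1, h2⟩ <;> rw [← h1, ← h2] at hu <;>
      simp only [σ.injective.eq_iff] at hu <;> tauto
  · rintro ⟨u, hu⟩
    refine ⟨ρ u, ?_⟩
    rcases h.pair u with ⟨h1, h2⟩ | ⟨h1, h2⟩ <;> rw [← h1, ← h2] <;>
      simp only [σ.injective.eq_iff] <;> tauto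

/-- The points of `I`, in the order: remaining points, first points and last points of pairs. -/
def points (I : PairTuple n r) : Fin (n - 2 * r) ⊕ (Fin r ⊕ Fin r) ≃ Fin n :=
  Equiv.ofBijective (Sum.elim I.rest (Sum.elim I.i I.j)) (by
    rw [Fintype.bijective_iff_injective_and_card]
    refine ⟨Function.Injective.sumElim I.rest_injective
      (Function.Injective.sumElim I.strictMono_i.injective I.injective_j I.disjoint) ?_, ?_⟩
    · rintro u (v | v)
      · exact (I.mem_compl_iff.1 (I.rest_mem u)).1 v
      · exact (I.mem_compl_iff.1 (I.rest_mem u)).2 v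
    · have := I.two_mul_le
      simp only [Fintype.card_sum, Fintype.card_fin]
      omega)

theorem exists_transports (I J : PairTuple n r) (τ : Equiv.Perm (Fin (n - 2 * r)))
    (ρ : Equiv.Perm (Fin r)) : ∃ σ, Transports σ I J τ ρ := by
  refine ⟨I.points.symm.trans ((Equiv.sumCongr τ (Equiv.sumCongr ρ ρ)).trans J.points), ?_, ?_⟩
  · intro u
    have : I.points.symm (I.rest u) = Sum.inl u := I.points.symm_apply_eq.2 rfl
    rw [Equiv.trans_apply, Equiv.trans_apply, this]
    rfl
  · intro u
    have h1 : I.points.symm (I.i u) = Sum.inr (Sum.inl u) := I.points.symm_apply_eq.2 rfl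
    have h2 : I.points.symm (I.j u) = Sum.inr (Sum.inr u) := I.points.symm_apply_eq.2 rfl
    rw [Equiv.trans_apply, Equiv.trans_apply, Equiv.trans_apply, Equiv.trans_apply, h1, h2]
    exact Or.inl ⟨rfl, rfl⟩

/-- Tuples of pairs can be moved by permutations: the image pairs are sorted. -/
theorem exists_image (I : PairTuple n r) (σ : Equiv.Perm (Fin n)) :
    ∃ (J : PairTuple n r) (τ : Equiv.Perm (Fin (n - 2 * r))) (ρ : Equiv.Perm (Fin r)),
      Transports σ I J τ ρ := by
  let a : Fin r → Fin n := fun u => min (σ (I.i u)) (σ (I.j u))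
  let b : Fin r → Fin n := fun u => max (σ (I.i u)) (σ (I.j u))
  have hab : ∀ u, (σ (I.i u) = a u ∧ σ (I.j u) = b u) ∨ (σ (I.i u) = b u ∧ σ (I.j u) = a u) := by
    intro u
    rcases le_total (σ (I.i u)) (σ (I.j u)) with h | h
    · exact Or.inl ⟨(min_eq_left h).symm, (max_eq_right h).symm⟩
    · exact Or.inr ⟨(max_eq_left h).symm, (min_eq_right h).symm⟩
  have hlt : ∀ u, a u < b u := fun u => min_lt_max.2 (σ.injective.ne (I.lt u).ne)
  have ha : ∀ u, a u = σ (I.i u) ∨ a u = σ (I.j u) := fun u => min_choice _ _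
  have hb : ∀ u, b u = σ (I.i u) ∨ b u = σ (I.j u) := fun u => max_choice _ _
  have huniq : ∀ u v x, (x = σ (I.i u) ∨ x = σ (I.j u)) → (x = σ (I.i v) ∨ x = σ (I.j v)) →
      u = v := by
    rintro u v x (rfl | rfl) (h | h)
    · exact I.strictMono_i.injective (σ.injective h)
    · exact absurd (σ.injective h) (I.disjoint _ _)
    · exact absurd (σ.injective h).symm (I.disjoint _ _)
    · exact I.injective_j (σ.injective h)
  have hainj : Function.Injective a := fun u v huv => huniq u v _ (ha u) (huv ▸ ha v)
  have hbinj : Function.Injective b := fun u v huv => huniq u v _ (hb u) (huv ▸ hb v)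
  -- The image pairs, oriented by `min` and `max`, are sorted by their first points.
  let ρ := Tuple.sort a
  let J : PairTuple n r :=
    { i := a ∘ ρ
      j := b ∘ ρ
      lt := fun u => hlt _
      strictMono_i := (Tuple.monotone_sort a).strictMono_of_injective
        (hainj.comp ρ.injective)
      injective_j := hbinj.comp ρ.injective
      disjoint := fun u v huv => by
        have huv' : a (ρ u) = b (ρ v) := huv
        have := huniq _ _ _ (ha (ρ u)) (huv' ▸ hb (ρ v))
        rw [this] at huv'
        exact (hlt _).ne huv' }
  have hpair : ∀ u, (σ (I.i u) = J.i (ρ.symm u) ∧ σ (I.j u) = J.j (ρ.symm u)) ∨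
      (σ (I.i u) = J.j (ρ.symm u) ∧ σ (I.j u) = J.i (ρ.symm u)) := by
    intro u
    have h1 : J.i (ρ.symm u) = a u := congrArg a (ρ.apply_symm_apply u)
    have h2 : J.j (ρ.symm u) = b u := congrArg b (ρ.apply_symm_apply u)
    rw [h1, h2]
    exact hab u
  have hrest : ∀ u, ∃ v, J.rest v = σ (I.rest u) := by
    intro u
    refine J.exists_rest_eq (J.mem_compl_iff.2 ?_)
    have h := I.mem_compl_iff.1 (I.rest_mem u)
    refine ⟨fun v hv => ?_, fun v hv => ?_⟩
    · rcases ha (ρ v) with h' | h'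
      · exact h.1 _ (σ.injective (hv.trans h'))
      · exact h.2 _ (σ.injective (hv.trans h'))
    · rcases hb (ρ v) with h' | h'
      · exact h.1 _ (σ.injective (hv.trans h'))
      · exact h.2 _ (σ.injective (hv.trans h'))
  choose τ hτ using hrest
  have hτinj : Function.Injective τ := fun u v huv => by
    have := (hτ u).symm.trans ((congrArg J.rest huv).trans (hτ v))
    exact I.rest_injective (σ.injective this)
  exact ⟨J, Equiv.ofBijective τ (Finite.injective_iff_bijective.1 hτinj), ρ.symm,
    fun u => (hτ u).symm, hpair⟩

end PairTuple

section Transport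

variable {k : Type u} {H : Type v} [Field k] [Ring H] [Algebra k H]
  {𝒜 : ℤ → Submodule k H} {N n : ℕ}
  [hN : Fact (Even N)] [hH : Fact (IsGradedCommutative 𝒜)] [GradedAlgebra 𝒜]

omit hH in
theorem parityProj_susp (ε : Fin 2) :
    parityProj (susp 𝒜 ((N : ℤ) - 1)) ε = parityProj 𝒜 (1 - ε) := by
  refine linearMap_ext_homogeneous 𝒜 fun i x hx => ?_
  have hx' : x ∈ susp 𝒜 ((N : ℤ) - 1) (i + ((N : ℤ) - 1)) := by
    rw [susp, add_sub_cancel_right]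
    exact hx
  rw [parityProj_of_mem _ hx', parityProj_of_mem _ hx]
  obtain ⟨c, hc⟩ := odd_pred N
  rw [hc]
  fin_cases ε <;> simp <;> congr 1 <;> simp <;> omega

/-- In the suspension, the parity of `x` is the parity of the class `e_{ij} p_i^*(x)`. -/
theorem isSuper_edge_susp (i j : Fin n) {ε : Fin 2} {x : H}
    (hx : HasParity (susp 𝒜 ((N : ℤ) - 1)) ε x) :
    IsSuper 𝒜 N n ((ε : ℕ) : ℤ) (edge 𝒜 N i j x) := by
  rw [HasParity, parityProj_susp] at hx
  refine (isSuper_edge i j hx).congr ?_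
  fin_cases ε
  · exact ⟨1, rfl⟩
  · exact ⟨0, rfl⟩

theorem placeC_perm {m : ℕ} (c : Fin m → Fin n) (τ : Equiv.Perm (Fin m)) (t : ⨂[k]^m H) :
    placeC 𝒜 N (fun u => c (τ u)) t = placeC 𝒜 N c (permAct 𝒜 τ t) :=
  letters_perm 𝒜 (fun u => pt 𝒜 N (c u))
    (fun _ _ _ _ _ _ _ hx hy => (isSuper_pt _ hx).comm (isSuper_pt _ hy)) τ t

theorem edgeC_perm {r : ℕ} (i j : Fin r → Fin n) (ρ : Equiv.Perm (Fin r)) (t : ⨂[k]^r H) :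
    edgeC 𝒜 N (fun u => i (ρ u)) (fun u => j (ρ u)) t =
      edgeC 𝒜 N i j (permAct (susp 𝒜 ((N : ℤ) - 1)) ρ t) :=
  letters_perm (susp 𝒜 ((N : ℤ) - 1)) (fun u => edge 𝒜 N (i u) (j u))
    (fun _ _ _ _ _ _ _ hx hy => (isSuper_edge_susp _ _ hx).comm (isSuper_edge_susp _ _ hy)) ρ t

omit hH in
/-- The class `e_{ij} p_i^*(x)` does not depend on the orientation of the pair, since `N` is even.
-/
theorem edge_symm (i j : Fin n) (x : H) : edge 𝒜 N i j x = edge 𝒜 N j i x := by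
  suffices h : edge 𝒜 N i j = edge 𝒜 N j i from LinearMap.congr_fun h x
  refine linearMap_ext_homogeneous 𝒜 fun s a ha => ?_
  rw [edge_apply, edge_apply, eg_mul_pt _ _ _ ha, eg_mul_pt _ _ _ ha, pt_mul_eg, eg_symm i j]

/-- A permutation of the points permutes the summands, and acts on the tensors by the permutations
of the remaining points and of the pairs. -/
theorem relabel_summand {r : ℕ} {σ : Equiv.Perm (Fin n)} {I J : PairTuple n r}
    {τ : Equiv.Perm (Fin (n - 2 * r))} {ρ : Equiv.Perm (Fin r)}
    (h : PairTuple.Transports σ I J τ ρ) (z : (⨂[k]^(n - 2 * r) H) ⊗[k] (⨂[k]^r H)) :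
    relabel 𝒜 N σ (summand 𝒜 N I z) =
      summand 𝒜 N J (TensorProduct.map (permAct 𝒜 τ) (permAct (susp 𝒜 ((N : ℤ) - 1)) ρ) z) := by
  induction z with
  | zero => simp
  | add x y hx hy => simp only [map_add, hx, hy]
  | tmul α β =>
    rw [TensorProduct.map_tmul, summand_tmul, summand_tmul, map_mul, relabel_placeC,
      relabel_edgeC, ← placeC_perm, ← edgeC_perm]
    congr 1
    · exact congrArg (fun c => placeC 𝒜 N c α) (funext fun u => h.rest u)
    · rw [edgeC, edgeC]
      congr 2
      funext u
      rcases h.pair u with ⟨h1, h2⟩ | ⟨h1, h2⟩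
      · rw [h1, h2]
      · rw [h1, h2]
        exact LinearMap.ext fun x => edge_symm _ _ x

end Transport

/-! ### The map `Φ` and the invariants of `E₁` -/

section Phi

variable {k : Type u} {H : Type v} [Field k] [Ring H] [Algebra k H]
  {𝒜 : ℤ → Submodule k H} {N n : ℕ} [GradedAlgebra 𝒜]

theorem permAct_one {V : Type*} [AddCommGroup V] [Module k V] (𝒱 : ℤ → Submodule k V)
    [DirectSum.Decomposition 𝒱] (m : ℕ) : permAct 𝒱 (1 : Equiv.Perm (Fin m)) = LinearMap.id := by
  refine tensor_ext_parity 𝒱 fun ε x hx => ?_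
  have : koszulSign k (1 : Equiv.Perm (Fin m)) ε = 1 := by
    rw [koszulSign, Finset.sum_eq_zero, sgn_zero]
    intro i _
    refine Finset.sum_eq_zero fun j _ => if_neg ?_
    rintro ⟨h1, h2⟩
    exact lt_asymm h1 h2
  rw [permAct_tprod _ hx, this, one_smul]
  rfl

theorem permAct_of_mem_Gam {V : Type*} [AddCommGroup V] [Module k V] {𝒱 : ℤ → Submodule k V}
    [DirectSum.Decomposition 𝒱] {m : ℕ} {t : ⨂[k]^m V} (ht : t ∈ Gam 𝒱 m)
    (σ : Equiv.Perm (Fin m)) : permAct 𝒱 σ t = t :=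
  (Submodule.mem_iInf _).1 ht σ

theorem map_permAct_mapIncl {p q : ℕ} (y : Gam 𝒜 p ⊗[k] Gam (susp 𝒜 ((N : ℤ) - 1)) q)
    (τ : Equiv.Perm (Fin p)) (ρ : Equiv.Perm (Fin q)) :
    TensorProduct.map (permAct 𝒜 τ) (permAct (susp 𝒜 ((N : ℤ) - 1)) ρ)
      (TensorProduct.mapIncl (Gam 𝒜 p) (Gam (susp 𝒜 ((N : ℤ) - 1)) q) y) =
      TensorProduct.mapIncl (Gam 𝒜 p) (Gam (susp 𝒜 ((N : ℤ) - 1)) q) y := by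
  induction y with
  | zero => simp
  | add x y hx hy => simp only [map_add, hx, hy]
  | tmul a b =>
    rw [TensorProduct.mapIncl, TensorProduct.map_tmul, TensorProduct.map_tmul,
      Submodule.subtype_apply, Submodule.subtype_apply, permAct_of_mem_Gam a.2,
      permAct_of_mem_Gam b.2]

variable [hN : Fact (Even N)] [hH : Fact (IsGradedCommutative 𝒜)]

theorem homogProj_mul_of_mem {w v d : ℤ} {x : CT 𝒜 N n} (hx : x ∈ homog 𝒜 N n w v d) (e : ℤ)
    (y : CT 𝒜 N n) : homogProj 𝒜 N n w v e (x * y) = x * homogProj 𝒜 N n w v (-d + e) y := by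
  change (gradeHom 𝒜 N n w v (x * y)).coeff e = x * (gradeHom 𝒜 N n w v y).coeff (-d + e)
  rw [map_mul, mem_homog.1 hx, AddMonoidAlgebra.coeff_single_mul_apply]

theorem homogProj_relabel (w v d : ℤ) (f : Fin n → Fin n) (x : CT 𝒜 N n) :
    homogProj 𝒜 N n w v d (relabel 𝒜 N f x) = relabel 𝒜 N f (homogProj 𝒜 N n w v d x) := by
  induction x using eOne_induction generalizing d with
  | one =>
    rw [map_one, homogProj_of_mem (one_mem_homog w v)]
    split_ifs <;> simp
  | add x y hx hy => rw [map_add, map_add, hx, hy, map_add, map_add]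
  | smul c x hx => rw [map_smul, map_smul, hx, map_smul, map_smul]
  | p_mul i s a ha x hx =>
    rw [map_mul, relabel_pt, homogProj_mul_of_mem (pt_mem_homog w v _ ha),
      homogProj_mul_of_mem (pt_mem_homog w v _ ha), map_mul, relabel_pt, hx]
  | e_mul i j h x hx =>
    rw [map_mul, relabel_eg, homogProj_mul_of_mem (eg_mem_homog w v _ _),
      homogProj_mul_of_mem (eg_mem_homog w v _ _), map_mul, relabel_eg, hx]

theorem extract_relabel {r : ℕ} {σ : Equiv.Perm (Fin n)} {I J : PairTuple n r}
    (h : ∀ x y, J.rel (σ x) (σ y) ↔ I.rel x y) (x : CT 𝒜 N n) :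
    extract 𝒜 N J (relabel 𝒜 N σ x) = relabel 𝒜 N σ (extract 𝒜 N I x) := by
  have : (restrict 𝒜 N J.isBlockRel_rel).comp (relabel 𝒜 N σ) =
      (relabel 𝒜 N σ).comp (restrict 𝒜 N I.isBlockRel_rel) :=
    eOne_algHom_ext (fun i s a _ => by simp) fun i j _ => by
      rw [AlgHom.comp_apply, AlgHom.comp_apply, relabel_eg, restrict_eg, restrict_eg]
      by_cases hij : I.rel i j
      · rw [if_pos ((h i j).2 hij), if_pos hij, relabel_eg]
      · rw [if_neg (mt (h i j).1 hij), if_neg hij, map_zero]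
  rw [extract, extract, LinearMap.comp_apply, LinearMap.comp_apply, AlgHom.toLinearMap_apply,
    AlgHom.toLinearMap_apply, ← homogProj_relabel]
  exact congrArg _ (AlgHom.congr_fun this x)

variable (𝒜 N n) in
/-- The map `Φ`, extended to all tensors. -/
def PhiAmb : Ambient k H n →ₗ[k] CT 𝒜 N n :=
  DirectSum.toModule k _ _ fun r : Fin (n / 2 + 1) => ∑ I : PairTuple n r, summand 𝒜 N I

omit [GradedAlgebra 𝒜] hN hH in
theorem PhiAmb_lof (r : Fin (n / 2 + 1)) (z) :
    PhiAmb 𝒜 N n (DirectSum.lof k (Fin (n / 2 + 1))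
      (fun t => (⨂[k]^(n - 2 * (t : ℕ)) H) ⊗[k] (⨂[k]^(t : ℕ) H)) r z) =
      ∑ I : PairTuple n r, summand 𝒜 N I z := by
  rw [PhiAmb, DirectSum.toModule_lof, LinearMap.sum_apply]

theorem toCT_Phi (x : GamSum 𝒜 N n) :
    toCT 𝒜 N n (Phi 𝒜 N n x) = PhiAmb 𝒜 N n (incl 𝒜 N n x) := by
  suffices h : (toCT 𝒜 N n).toLinearMap.comp (Phi 𝒜 N n) =
      (PhiAmb 𝒜 N n).comp (incl 𝒜 N n) from LinearMap.congr_fun h x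
  refine DirectSum.linearMap_ext _ fun r => TensorProduct.ext' fun a b => ?_
  simp only [LinearMap.comp_apply]
  rw [Phi, DirectSum.toModule_lof, incl, DirectSum.lmap_lof, PhiAmb_lof, PhiComponent,
    TensorProduct.lift.tmul, LinearMap.sum_apply, LinearMap.sum_apply, AlgEquiv.toLinearMap_apply,
    map_sum]
  refine Finset.sum_congr rfl fun I _ => ?_
  rw [LinearMap.compl₁₂_apply, LinearMap.mul_apply', map_mul, TensorProduct.mapIncl,
    TensorProduct.map_tmul, summand_tmul, LinearMap.comp_apply, LinearMap.comp_apply, toCT_phi,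
    toCT_psi]

theorem extract_PhiAmb (t : Fin (n / 2 + 1)) (I : PairTuple n t) (z : Ambient k H n) :
    extract 𝒜 N I (PhiAmb 𝒜 N n z) = summand 𝒜 N I (z t) := by
  induction z using DirectSum.induction_on with
  | zero => simp
  | add x y hx hy => rw [map_add, map_add, hx, hy, DirectSum.add_apply, map_add]
  | of r y =>
    rw [← DirectSum.lof_eq_of k, PhiAmb_lof, map_sum]
    by_cases hr : r = t
    · subst hr
      rw [Finset.sum_eq_single I, extract_summand_self, DirectSum.lof_apply]
      · exact fun J _ hJ => extract_summand_of_ne I J hJ y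
      · simp
    · rw [DirectSum.lof_eq_of, DirectSum.of_eq_of_ne _ _ _ (Ne.symm hr), map_zero]
      exact Finset.sum_eq_zero fun J _ =>
        extract_summand_of_card_ne I J (fun h => hr (Fin.ext h)) y

theorem PhiAmb_mem_pairSpan (z : Ambient k H n) :
    PhiAmb 𝒜 N n z ∈ pairSpan 𝒜 N Finset.univ := by
  induction z using DirectSum.induction_on with
  | zero => rw [map_zero]; exact zero_mem _
  | add x y hx hy => rw [map_add]; exact add_mem hx hy
  | of r y =>
    rw [← DirectSum.lof_eq_of k, PhiAmb_lof]
    exact Submodule.sum_mem _ fun I _ => summand_mem_pairSpan I y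

/-- The tuple of the last `t` pairs of consecutive points. -/
def PairTuple.last (n t : ℕ) (h : 2 * t ≤ n) : PairTuple n t where
  i u := ⟨n - 2 * t + 2 * u, by omega⟩
  j u := ⟨n - 2 * t + (2 * u + 1), by omega⟩
  lt u := by simp
  strictMono_i u v huv := by simpa using huv
  injective_j u v huv := by simpa [Fin.ext_iff] using huv
  disjoint u v huv := by
    rw [Fin.mk.injEq] at huv
    omega

theorem two_mul_le_of_fin (t : Fin (n / 2 + 1)) : 2 * (t : ℕ) ≤ n := by omega

/-- A tensor is determined by the value of `Φ`, even by its parts belonging to one tuple of pairs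
of each size. -/
theorem eq_of_extract_PhiAmb {z z' : Ambient k H n}
    (h : ∀ t : Fin (n / 2 + 1), extract 𝒜 N (PairTuple.last n t (two_mul_le_of_fin t))
      (PhiAmb 𝒜 N n z) = extract 𝒜 N (PairTuple.last n t (two_mul_le_of_fin t))
        (PhiAmb 𝒜 N n z')) : z = z' := by
  refine DFinsupp.ext fun t => summand_injective (𝒜 := 𝒜) (N := N)
    (PairTuple.last n t (two_mul_le_of_fin t)) ?_
  rw [← extract_PhiAmb, ← extract_PhiAmb, h]

theorem PhiAmb_injective : Function.Injective (PhiAmb 𝒜 N n) := fun z z' h =>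
  eq_of_extract_PhiAmb (𝒜 := 𝒜) (N := N) fun t => by rw [h]

/-- The values of `Φ` are invariant: a permutation permutes the summands. -/
theorem relabel_PhiAmb_incl (σ : Equiv.Perm (Fin n)) (x : GamSum 𝒜 N n) :
    relabel 𝒜 N σ (PhiAmb 𝒜 N n (incl 𝒜 N n x)) = PhiAmb 𝒜 N n (incl 𝒜 N n x) := by
  induction x using DirectSum.induction_on with
  | zero => simp
  | add x y hx hy => simp only [map_add, hx, hy]
  | of r y =>
    rw [← DirectSum.lof_eq_of k, incl, DirectSum.lmap_lof, PhiAmb_lof, map_sum]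
    choose J τ ρ hJ using fun I : PairTuple n r => I.exists_image σ
    have hinj : Function.Injective J := by
      intro I I' h
      refine PairTuple.eq_of_rel _ fun u => ?_
      rw [← (hJ I').rel_iff, ← h, (hJ I).rel_iff]
      exact ⟨u, Or.inl ⟨rfl, rfl⟩⟩
    refine (Finset.sum_congr rfl fun I _ => ?_).trans
      ((Finite.injective_iff_bijective.1 hinj).sum_comp fun J => summand 𝒜 N J _)
    rw [relabel_summand (hJ I), map_permAct_mapIncl]

/-- Each invariant class of `E₁` is a value of `Φ`. -/
theorem exists_PhiAmb_incl_eq (h3 : (3 : k) ≠ 0 ∨ n ≤ 2) {x : CT 𝒜 N n}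
    (hx : ∀ σ : Equiv.Perm (Fin n), relabel 𝒜 N σ x = x) :
    ∃ w : GamSum 𝒜 N n, PhiAmb 𝒜 N n (incl 𝒜 N n w) = x := by
  have hmem := mem_pairSpan_of_invariant h3 hx
  let K : ∀ t : Fin (n / 2 + 1), PairTuple n t := fun t => PairTuple.last n t (two_mul_le_of_fin t)
  choose z hz using fun t => extract_mem_range_summand hmem (K t)
  have hfix : ∀ t τ ρ, TensorProduct.map (permAct 𝒜 τ) (permAct (susp 𝒜 ((N : ℤ) - 1)) ρ) (z t) =
      z t := by
    intro t τ ρ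
    -- `τ` and `ρ` are realized by a permutation of the points which preserves the tuple.
    obtain ⟨σ, hσ⟩ := (K t).exists_transports (K t) τ ρ
    apply summand_injective (𝒜 := 𝒜) (N := N) (K t)
    rw [← relabel_summand hσ, hz, ← extract_relabel hσ.rel_iff, hx]
  have hrange : ∀ t : Fin (n / 2 + 1), ∃ w, TensorProduct.mapIncl (Gam 𝒜 (n - 2 * (t : ℕ)))
      (Gam (susp 𝒜 ((N : ℤ) - 1)) (t : ℕ)) w = z t := fun t => by
    refine mem_range_mapIncl_of_fixed _ _ (fun τ => ?_) (fun ρ => ?_)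
    · have := hfix t τ 1
      rwa [permAct_one] at this
    · have := hfix t 1 ρ
      rwa [permAct_one] at this
  choose w hw using hrange
  have hincl : ∀ t, incl 𝒜 N n (DFinsupp.equivFunOnFintype.symm w) t = z t := by
    intro t
    rw [← hw t, incl, DirectSum.lmap_apply]
    rfl
  refine ⟨DFinsupp.equivFunOnFintype.symm w, sub_eq_zero.1 (eq_zero_of_extract
    (sub_mem (PhiAmb_mem_pairSpan _) hmem) fun t I => ?_)⟩
  -- By invariance the parts belonging to the other tuples are determined by those belonging to `K
  -- t`.
  obtain ⟨σ, hσ⟩ := (K t).exists_transports I 1 1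
  rw [map_sub, extract_PhiAmb, hincl, ← hx σ, extract_relabel hσ.rel_iff, ← hz,
    relabel_summand hσ, hfix, sub_self]

/-- The algebra of invariants is the range of `Φ`. -/
theorem mem_invariants_iff (h3 : (3 : k) ≠ 0 ∨ n ≤ 2) {x : EOne 𝒜 N n} :
    x ∈ invariants 𝒜 N n ↔ ∃ w, Phi 𝒜 N n w = x := by
  have h : x ∈ invariants 𝒜 N n ↔
      ∀ σ : Equiv.Perm (Fin n), relabel 𝒜 N σ (toCT 𝒜 N n x) = toCT 𝒜 N n x := by
    rw [invariants, Algebra.mem_iInf]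
    refine forall_congr' fun σ => ?_
    rw [AlgHom.mem_equalizer, ← toCT_permEOne, (toCT 𝒜 N n).injective.eq_iff]
    rfl
  rw [h]
  constructor
  · intro hx
    obtain ⟨w, hw⟩ := exists_PhiAmb_incl_eq h3 hx
    exact ⟨w, (toCT 𝒜 N n).injective ((toCT_Phi w).trans hw)⟩
  · rintro ⟨w, rfl⟩ σ
    rw [toCT_Phi, relabel_PhiAmb_incl]

end Phi

/-! ### Products of summands -/

namespace PairTuple

variable {n r : ℕ}

/-- The points of the pairs of `I`, in the order `i₁, j₁, i₂, j₂, …`. -/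
def pairPoints (I : PairTuple n r) (q : Fin (2 * r)) : Fin n :=
  if (q : ℕ) % 2 = 0 then I.i ⟨(q : ℕ) / 2, by omega⟩ else I.j ⟨(q : ℕ) / 2, by omega⟩

theorem rest_last (t : ℕ) (h : 2 * t ≤ n) (u : Fin (n - 2 * t)) :
    ((last n t h).rest u : ℕ) = u := by
  have : (fun u : Fin (n - 2 * t) => Fin.castLE (Nat.sub_le n (2 * t)) u) = (last n t h).rest := by
    refine Finset.orderEmbOfFin_unique _ (fun x => ?_) fun a b hab => hab
    rw [mem_compl_iff]
    refine ⟨fun v hv => ?_, fun v hv => ?_⟩ <;>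
      · have := congrArg Fin.val hv
        simp only [last, Fin.val_castLE] at this
        omega
  rw [← this]
  rfl

/-- The points outside a sub-tuple of the tuple of the last pairs, in increasing order: first those
which belong to none of the last pairs, then those of the complementary pairs, pair by pair. -/
theorem rest_sub_last {r s t : ℕ} (h : 2 * t ≤ n) {a : Fin r → Fin t}
    {b : Fin s → Fin t} (ha : StrictMono a) (hb : StrictMono b) (hab : ∀ u v, a u ≠ b v)
    (hl : n - 2 * r = (n - 2 * t) + 2 * s) (x : Fin (n - 2 * r)) :
    ((last n t h).sub a ha).rest x =
      Fin.append (last n t h).rest ((last n t h).sub b hb).pairPoints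
        (Fin.cast hl x) := by
  set K := last n t h with hK
  have h1 : ∀ u, (K.rest u : ℕ) = u := rest_last _ h
  have h2 : ∀ q, ((K.sub b hb).pairPoints q : ℕ) =
      n - 2 * t + 2 * (b ⟨(q : ℕ) / 2, by omega⟩ : ℕ) + (q : ℕ) % 2 := by
    intro q
    rw [pairPoints]
    split_ifs with hq
    · rw [hq]
      rfl
    · have hq' : (q : ℕ) % 2 = 1 := by omega
      rw [hq']
      rfl
  -- The increasing enumeration of a finite set is unique.
  have hmono : StrictMono (Fin.append K.rest (K.sub b hb).pairPoints) := by
    intro x y hxy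
    rw [Fin.lt_def]
    induction x using Fin.addCases with
    | left x =>
      induction y using Fin.addCases with
      | left y =>
        rw [Fin.append_left, Fin.append_left, h1, h1]
        exact hxy
      | right y =>
        rw [Fin.append_left, Fin.append_right, h1, h2]
        have := x.2
        omega
    | right x =>
      induction y using Fin.addCases with
      | left y =>
        have := y.2
        rw [Fin.lt_def, Fin.val_natAdd, Fin.val_castAdd] at hxy
        omega
      | right y =>
        rw [Fin.append_right, Fin.append_right, h2, h2]
        have hxy' : (x : ℕ) < y := by
          rw [Fin.lt_def, Fin.val_natAdd, Fin.val_natAdd] at hxy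
          omega
        rcases (Nat.div_le_div_right hxy'.le : (x : ℕ) / 2 ≤ y / 2).lt_or_eq with hd | hd
        · have : b ⟨(x : ℕ) / 2, by omega⟩ < b ⟨(y : ℕ) / 2, by omega⟩ := hb hd
          rw [Fin.lt_def] at this
          omega
        · simp only [hd]
          omega
  have : (fun x => Fin.append K.rest (K.sub b hb).pairPoints (Fin.cast hl x)) =
      (K.sub a ha).rest := by
    refine Finset.orderEmbOfFin_unique _ (fun x => ?_) fun x y hxy => hmono hxy
    rw [mem_compl_iff]
    generalize Fin.cast hl x = x
    have hki : ∀ u, ((K.sub a ha).i u : ℕ) = n - 2 * t + 2 * (a u : ℕ) := fun u => rfl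
    have hkj : ∀ u, ((K.sub a ha).j u : ℕ) = n - 2 * t + (2 * (a u : ℕ) + 1) := fun u => rfl
    induction x using Fin.addCases with
    | left x =>
      rw [Fin.append_left]
      have := x.2
      refine ⟨fun v hv => ?_, fun v hv => ?_⟩ <;>
        · have := congrArg Fin.val hv
          simp only [h1, hki, hkj] at this
          omega
    | right x =>
      rw [Fin.append_right]
      refine ⟨fun v hv => ?_, fun v hv => ?_⟩ <;>
        · have h3 := congrArg Fin.val hv
          have h4 := hab v ⟨(x : ℕ) / 2, by omega⟩
          rw [Ne, Fin.ext_iff] at h4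
          simp only [h2, hki, hkj] at h3
          omega
  exact (congrFun this x).symm

end PairTuple

section Products

variable {k : Type u} {H : Type v} [Field k] [Ring H] [Algebra k H]
  {𝒜 : ℤ → Submodule k H} {N n : ℕ} [GradedAlgebra 𝒜]

theorem totalParity_tprod {V : Type*} [AddCommGroup V] [Module k V] {𝒱 : ℤ → Submodule k V}
    [DirectSum.Decomposition 𝒱] {m : ℕ} (c : Fin 2) {ε : Fin m → Fin 2} {x : Fin m → V}
    (hx : ∀ i, HasParity 𝒱 (ε i) (x i)) :
    totalParity 𝒱 m c (PiTensorProduct.tprod k x) =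
      if (∑ i, (ε i : ℕ)) % 2 = (c : ℕ) then PiTensorProduct.tprod k x else 0 := by
  rw [totalParity, weightOp_tprod _ hx]
  split_ifs <;> simp

theorem sum_totalParity {V : Type*} [AddCommGroup V] [Module k V] (𝒱 : ℤ → Submodule k V)
    [DirectSum.Decomposition 𝒱] {m : ℕ} (t : ⨂[k]^m V) : ∑ c, totalParity 𝒱 m c t = t := by
  suffices h : ∑ c, totalParity 𝒱 m c = LinearMap.id by
    rw [← LinearMap.sum_apply, h, LinearMap.id_apply]
  refine tensor_ext_parity 𝒱 fun ε x hx => ?_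
  rw [LinearMap.sum_apply, Fin.sum_univ_two, totalParity_tprod _ hx, totalParity_tprod _ hx]
  rcases Nat.mod_two_eq_zero_or_one (∑ i, (ε i : ℕ)) with h | h <;> simp [h]

variable [hN : Fact (Even N)] [hH : Fact (IsGradedCommutative 𝒜)]

/-- Evaluation on letters of pure parity is compatible with the total parity. -/
theorem isSuper_letters_totalParity {V : Type*} [AddCommGroup V] [Module k V]
    {𝒱 : ℤ → Submodule k V} [DirectSum.Decomposition 𝒱] {m : ℕ} {g : Fin m → V →ₗ[k] CT 𝒜 N n}
    (hg : ∀ u ε x, HasParity 𝒱 ε x → IsSuper 𝒜 N n ((ε : ℕ) : ℤ) (g u x)) (c : Fin 2)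
    (t : ⨂[k]^m V) : IsSuper 𝒜 N n ((c : ℕ) : ℤ) (letters g (totalParity 𝒱 m c t)) := by
  let S : Submodule k (CT 𝒜 N n) :=
    { carrier := {y | IsSuper 𝒜 N n ((c : ℕ) : ℤ) y}
      add_mem' := fun hx hy => hx.add hy
      zero_mem' := IsSuper.zero
      smul_mem' := fun a _ hx => hx.smul a }
  have : S.mkQ.comp ((letters g).comp (totalParity 𝒱 m c)) = 0 := by
    refine tensor_ext_parity 𝒱 fun ε x hx => ?_
    rw [LinearMap.zero_apply, LinearMap.comp_apply, Submodule.mkQ_apply,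
      Submodule.Quotient.mk_eq_zero, LinearMap.comp_apply, totalParity_tprod _ hx]
    split_ifs with h
    · rw [letters_tprod]
      refine (isSuper_ofFn_prod fun u => hg u _ _ (hx u)).congr ?_
      rw [← h]
      exact ⟨(∑ i, (ε i : ℕ) : ℕ) / 2, by push_cast; omega⟩
    · rw [map_zero]
      exact zero_mem S
  have h := LinearMap.congr_fun this t
  rwa [LinearMap.comp_apply, LinearMap.zero_apply, Submodule.mkQ_apply,
    Submodule.Quotient.mk_eq_zero] at h

theorem isSuper_placeC_totalParity {m : ℕ} (c : Fin m → Fin n) (d : Fin 2) (t : ⨂[k]^m H) :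
    IsSuper 𝒜 N n ((d : ℕ) : ℤ) (placeC 𝒜 N c (totalParity 𝒜 m d t)) :=
  isSuper_letters_totalParity (fun _ _ _ hx => isSuper_pt _ hx) d t

theorem isSuper_edgeC_totalParity {r : ℕ} (i j : Fin r → Fin n) (d : Fin 2) (t : ⨂[k]^r H) :
    IsSuper 𝒜 N n ((d : ℕ) : ℤ)
      (edgeC 𝒜 N i j (totalParity (susp 𝒜 ((N : ℤ) - 1)) r d t)) :=
  isSuper_letters_totalParity (fun _ _ _ hx => isSuper_edge_susp _ _ hx) d t

omit [GradedAlgebra 𝒜] hN hH in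
theorem placeC_mul_congr {m : ℕ} {c c' : Fin m → Fin n} {z : CT 𝒜 N n}
    (h : ∀ u a x, pt 𝒜 N (c u) a * (x * z) = pt 𝒜 N (c' u) a * (x * z)) (t : ⨂[k]^m H)
    (x : CT 𝒜 N n) : placeC 𝒜 N c t * (x * z) = placeC 𝒜 N c' t * (x * z) := by
  suffices h : (LinearMap.mulRight k (x * z)).comp (placeC 𝒜 N c) =
      (LinearMap.mulRight k (x * z)).comp (placeC 𝒜 N c') from LinearMap.congr_fun h t
  refine PiTensorProduct.ext (MultilinearMap.ext fun y => ?_)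
  simp only [LinearMap.compMultilinearMap_apply, LinearMap.comp_apply, LinearMap.mulRight_apply,
    placeC, letters_tprod]
  induction m with
  | zero => simp
  | succ m ih =>
    rw [List.ofFn_succ, List.ofFn_succ, List.prod_cons, List.prod_cons, mul_assoc, mul_assoc,
      ih (fun u => h u.succ) (PiTensorProduct.tprod k fun u => y u.succ) (fun u => y u.succ),
      ← mul_assoc _ x, h, mul_assoc]

/-- On `e_I`, inserting a tensor at all the points of the pairs of `I` amounts to inserting its
reduction at the first points. -/
theorem placeC_pairPoints_mul_edgeC {r : ℕ} (I : PairTuple n r) (γ : ⨂[k]^(2 * r) H)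
    (β : ⨂[k]^r H) : placeC 𝒜 N I.pairPoints γ * edgeC 𝒜 N I.i I.j β =
      edgeC 𝒜 N I.i I.j (nuBar 𝒜 r (red k H r γ) β) := by
  have h1 : placeC 𝒜 N (fun q : Fin (2 * r) => I.i ⟨(q : ℕ) / 2, by omega⟩) γ =
      placeC 𝒜 N I.i (red k H r γ) := by
    suffices h : placeC 𝒜 N (fun q : Fin (2 * r) => I.i ⟨(q : ℕ) / 2, by omega⟩) =
        (placeC 𝒜 N I.i).comp (red k H r) from LinearMap.congr_fun h γ
    refine PiTensorProduct.ext (MultilinearMap.ext fun x => ?_)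
    simp only [LinearMap.compMultilinearMap_apply, LinearMap.comp_apply, red,
      PiTensorProduct.lift.tprod, redMultilinear, MultilinearMap.mk'_apply, placeC, letters_tprod]
    rw [List.ofFn_mul', List.prod_flatten, List.map_ofFn]
    congr 2
    funext u
    have e0 : (2 * (u : ℕ) + 0) / 2 = u := by omega
    have e1 : (2 * (u : ℕ) + 1) / 2 = u := by omega
    simp [pt_mul, List.ofFn_succ, e1]
  rw [← placeC_mul_edgeC, edgeC_eq, ← h1]
  refine placeC_mul_congr (fun q a x => ?_) γ _
  rw [PairTuple.pairPoints]
  split_ifs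
  · rfl
  · exact pt_j_mul_mul_eP I _ a x

omit [GradedAlgebra 𝒜] hN hH in
theorem edgeC_append {p q : ℕ} (i j : Fin (p + q) → Fin n) (α : ⨂[k]^p H) (β : ⨂[k]^q H) :
    edgeC 𝒜 N (fun u => i (Fin.castAdd q u)) (fun u => j (Fin.castAdd q u)) α *
      edgeC 𝒜 N (fun u => i (Fin.natAdd p u)) (fun u => j (Fin.natAdd p u)) β =
      edgeC 𝒜 N i j (TensorPower.mulEquiv (α ⊗ₜ[k] β)) := by
  rw [edgeC, edgeC, edgeC, letters_mulEquiv]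

end Products

/-! ### `Φ` is multiplicative -/

section Multiplicative

variable {k : Type u} {H : Type v} [Field k] [Ring H] [Algebra k H]
  {𝒜 : ℤ → Submodule k H} {N n : ℕ} [GradedAlgebra 𝒜]
  [hN : Fact (Even N)] [hH : Fact (IsGradedCommutative 𝒜)]

instance (r s : ℕ) : Fintype {σ // IsShuffle r s σ} := Fintype.ofFinite _

/-- The pairs of `K` numbered by the first values of a shuffle. -/
def PairTuple.subLeft {r s : ℕ} (K : PairTuple n (r + s)) (σ : {σ // IsShuffle r s σ}) :
    PairTuple n r :=
  K.sub (fun u => σ.1 (Fin.castAdd s u)) σ.2.1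

/-- The pairs of `K` numbered by the last values of a shuffle. -/
def PairTuple.subRight {r s : ℕ} (K : PairTuple n (r + s)) (σ : {σ // IsShuffle r s σ}) :
    PairTuple n s :=
  K.sub (fun u => σ.1 (Fin.natAdd r u)) σ.2.2

omit hN hH [GradedAlgebra 𝒜] in
theorem summand_tmul' {r : ℕ} (I : PairTuple n r) (α : ⨂[k]^(n - 2 * r) H) (β : ⨂[k]^r H) :
    summand 𝒜 N I (α ⊗ₜ β) = placeC 𝒜 N I.rest α * edgeC 𝒜 N I.i I.j β := summand_tmul I α β

/-- The sign of the reordering of six factors; only the four factors which change places need to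
have a parity. It is the sign `ε` in the definition of `μ`. -/
theorem six_factors {a b c c' : ℤ} {A₁ A₂ B C₁ C₂ D : CT 𝒜 N n} (hA : IsSuper 𝒜 N n a A₂)
    (hB : IsSuper 𝒜 N n b B) (hC : IsSuper 𝒜 N n c C₁) (hC' : IsSuper 𝒜 N n c' C₂) :
    A₁ * A₂ * B * (C₁ * C₂ * D) =
      sgn k ((c + c') * (a + b) + a * b) • (A₁ * C₁ * ((C₂ * B) * (A₂ * D))) := by
  have h1 := (hA.mul hB).comm (hC.mul hC')
  have h2 := hA.comm hB
  calc A₁ * A₂ * B * (C₁ * C₂ * D) = A₁ * ((A₂ * B) * (C₁ * C₂)) * D := by simp only [mul_assoc]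
    _ = _ := by
      rw [h1, h2, sgn_add, mul_comm (c + c')]
      simp only [mul_smul_comm, smul_mul_assoc, smul_smul, mul_assoc]

/-- The product of two summands belonging to complementary parts of the tuple `K`, after projection
of the tensors to pure parity. The points of `K` in the complement of one part are those of the
pairs of the other part, where they are reduced by `red`. -/
theorem product_of_parity {r s : ℕ} (K : PairTuple n (r + s)) (σ : {σ // IsShuffle r s σ})
    {m : ℕ} (e : Fin m → Fin n) (α γ : ⨂[k]^m H) (α' : ⨂[k]^(2 * s) H) (β : ⨂[k]^r H)
    (γ' : ⨂[k]^(2 * r) H) (δ : ⨂[k]^s H) (a' b c c' : Fin 2) :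
    placeC 𝒜 N e α * placeC 𝒜 N (K.subRight σ).pairPoints (totalParity 𝒜 (2 * s) a' α') *
        edgeC 𝒜 N (K.subLeft σ).i (K.subLeft σ).j
          (totalParity (susp 𝒜 ((N : ℤ) - 1)) r b β) *
      (placeC 𝒜 N e (totalParity 𝒜 m c γ) *
        placeC 𝒜 N (K.subLeft σ).pairPoints (totalParity 𝒜 (2 * r) c' γ') *
        edgeC 𝒜 N (K.subRight σ).i (K.subRight σ).j δ) =
    sgn k ((((c : ℕ) : ℤ) + ((c' : ℕ) : ℤ)) * (((a' : ℕ) : ℤ) + ((b : ℕ) : ℤ)) +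
        ((a' : ℕ) : ℤ) * ((b : ℕ) : ℤ)) •
      (placeC 𝒜 N e (nu 𝒜 m α (totalParity 𝒜 m c γ)) *
        edgeC 𝒜 N K.i K.j (permAct (susp 𝒜 ((N : ℤ) - 1)) σ.1 (TensorPower.mulEquiv
          (nuBar 𝒜 r (red k H r (totalParity 𝒜 (2 * r) c' γ'))
              (totalParity (susp 𝒜 ((N : ℤ) - 1)) r b β) ⊗ₜ[k]
            nuBar 𝒜 s (red k H s (totalParity 𝒜 (2 * s) a' α')) δ)))) := by
  rw [six_factors (isSuper_placeC_totalParity _ a' α') (isSuper_edgeC_totalParity _ _ b β)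
    (isSuper_placeC_totalParity _ c γ) (isSuper_placeC_totalParity _ c' γ'), placeC_mul_placeC,
    placeC_pairPoints_mul_edgeC, placeC_pairPoints_mul_edgeC, ← edgeC_perm, ← edgeC_append]
  rfl

/-- The products of the summands belonging to complementary parts of a tuple, expressed by the
components of `μ`. -/
theorem sum_product_eq {r s : ℕ} (K : PairTuple n (r + s))
    (z : (⨂[k]^(n - 2 * (r + s)) H) ⊗[k] (⨂[k]^(2 * s) H)) (β : ⨂[k]^r H)
    (w : (⨂[k]^(n - 2 * (r + s)) H) ⊗[k] (⨂[k]^(2 * r) H)) (δ : ⨂[k]^s H) :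
    ∑ σ : {σ // IsShuffle r s σ},
      LinearMap.mul' k _ (TensorProduct.map (placeC 𝒜 N K.rest)
          (placeC 𝒜 N (K.subRight σ).pairPoints) z) *
        edgeC 𝒜 N (K.subLeft σ).i (K.subLeft σ).j β *
        (LinearMap.mul' k _ (TensorProduct.map (placeC 𝒜 N K.rest)
          (placeC 𝒜 N (K.subLeft σ).pairPoints) w) *
          edgeC 𝒜 N (K.subRight σ).i (K.subRight σ).j δ) =
      ∑ a' : Fin 2, ∑ b : Fin 2, ∑ c : Fin 2, ∑ c' : Fin 2,
        sgn k ((((c : ℕ) : ℤ) + ((c' : ℕ) : ℤ)) * (((a' : ℕ) : ℤ) + ((b : ℕ) : ℤ)) +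
          ((a' : ℕ) : ℤ) * ((b : ℕ) : ℤ)) •
        summand 𝒜 N K (muUnsigned 𝒜 N (n - 2 * (r + s)) r s
          (TensorProduct.map LinearMap.id (totalParity 𝒜 (2 * s) a') z ⊗ₜ
            totalParity (susp 𝒜 ((N : ℤ) - 1)) r b β)
          (TensorProduct.map (totalParity 𝒜 (n - 2 * (r + s)) c)
            (totalParity 𝒜 (2 * r) c') w ⊗ₜ δ)) := by
  induction z with
  | zero => simp
  | add x y hx hy =>
    simp only [map_add, add_mul, TensorProduct.add_tmul, LinearMap.add_apply, smul_add,
      Finset.sum_add_distrib, hx, hy]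
  | tmul α α' =>
  induction w with
  | zero => simp
  | add x y hx hy =>
    simp only [map_add, add_mul, mul_add, TensorProduct.add_tmul, smul_add,
      Finset.sum_add_distrib, hx, hy]
  | tmul γ γ' =>
  have hsum : ∀ a' b c c', summand 𝒜 N K (muUnsigned 𝒜 N (n - 2 * (r + s)) r s
        (TensorProduct.map LinearMap.id (totalParity 𝒜 (2 * s) a') (α ⊗ₜ α') ⊗ₜ
          totalParity (susp 𝒜 ((N : ℤ) - 1)) r b β)
        (TensorProduct.map (totalParity 𝒜 (n - 2 * (r + s)) c)
          (totalParity 𝒜 (2 * r) c') (γ ⊗ₜ γ') ⊗ₜ δ)) =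
      ∑ σ : {σ // IsShuffle r s σ},
        placeC 𝒜 N K.rest (nu 𝒜 _ α (totalParity 𝒜 _ c γ)) *
        edgeC 𝒜 N K.i K.j (permAct (susp 𝒜 ((N : ℤ) - 1)) σ.1 (TensorPower.mulEquiv
          (nuBar 𝒜 r (red k H r (totalParity 𝒜 (2 * r) c' γ'))
              (totalParity (susp 𝒜 ((N : ℤ) - 1)) r b β) ⊗ₜ[k]
            nuBar 𝒜 s (red k H s (totalParity 𝒜 (2 * s) a' α')) δ))) := by
    intro a' b c c'
    rw [TensorProduct.map_tmul, TensorProduct.map_tmul, muUnsigned_tmul, summand_tmul',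
      LinearMap.id_apply, shuffle, LinearMap.comp_apply, LinearMap.sum_apply, map_sum,
      Finset.mul_sum, Finset.sum_subtype _ (p := IsShuffle r s) (by simp)]
    rfl
  simp only [hsum, Finset.smul_sum, ← product_of_parity]
  have hα' := sum_totalParity 𝒜 α'
  have hβ := sum_totalParity (susp 𝒜 ((N : ℤ) - 1)) β
  have hγ := sum_totalParity 𝒜 γ
  have hγ' := sum_totalParity 𝒜 γ'
  rw [Fin.sum_univ_two] at hα' hβ hγ hγ'
  simp only [TensorProduct.map_tmul, LinearMap.mul'_apply, Fin.sum_univ_two,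
    ← Finset.sum_add_distrib]
  refine Finset.sum_congr rfl fun σ _ => ?_
  conv_lhs => rw [← hα', ← hβ, ← hγ, ← hγ']
  simp only [map_add, mul_add, add_mul]
  abel

/-- The products of the summands belonging to complementary parts of the tuple of the last pairs
add up to the component of `μ`. -/
theorem sum_summand_mul_summand {r s : ℕ} (h : 2 * (r + s) ≤ n)
    (y : (⨂[k]^(n - 2 * r) H) ⊗[k] (⨂[k]^r H)) (y' : (⨂[k]^(n - 2 * s) H) ⊗[k] (⨂[k]^s H)) :
    ∑ σ : {σ // IsShuffle r s σ},
      summand 𝒜 N ((PairTuple.last n (r + s) h).subLeft σ) y *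
        summand 𝒜 N ((PairTuple.last n (r + s) h).subRight σ) y' =
      summand 𝒜 N (PairTuple.last n (r + s) h) (muComponent 𝒜 N n r s h y y') := by
  induction y with
  | zero => simp
  | add x y hx hy =>
    simp only [map_add, add_mul, LinearMap.add_apply, Finset.sum_add_distrib, hx, hy]
  | tmul α β =>
  induction y' with
  | zero => simp
  | add x y hx hy => simp only [map_add, mul_add, Finset.sum_add_distrib, hx, hy]
  | tmul γ δ =>
  set K := PairTuple.last n (r + s) h with hK
  have hl : n - 2 * r = n - 2 * (r + s) + 2 * s := by omega
  have hl' : n - 2 * s = n - 2 * (r + s) + 2 * r := by omega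
  have hne : ∀ (σ : {σ // IsShuffle r s σ}) (u : Fin r) (v : Fin s),
      σ.1 (Fin.castAdd s u) ≠ σ.1 (Fin.natAdd r v) := fun σ u v huv => by
    have := congrArg Fin.val (σ.1.injective huv)
    rw [Fin.val_castAdd, Fin.val_natAdd] at this
    omega
  -- The points outside a part of `K` are the first points followed by those of the other part, so
  -- that inserting `α` amounts to inserting the factors of its deconcatenation.
  have h1 : ∀ σ, placeC 𝒜 N (K.subLeft σ).rest α =
      LinearMap.mul' k _ (TensorProduct.map (placeC 𝒜 N K.rest)
        (placeC 𝒜 N (K.subRight σ).pairPoints) (deconcat k H hl α)) := fun σ => by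
    rw [placeC, ← letters_deconcat hl]
    congr 3
    · exact congrArg letters (funext fun u => congrArg (pt 𝒜 N) ((PairTuple.rest_sub_last h
        σ.2.1 σ.2.2 (hne σ) hl _).trans (Fin.append_left _ _ _)).symm).symm
    · exact congrArg letters (funext fun u => congrArg (pt 𝒜 N) ((PairTuple.rest_sub_last h
        σ.2.1 σ.2.2 (hne σ) hl _).trans (Fin.append_right _ _ _)).symm).symm
  have h2 : ∀ σ, placeC 𝒜 N (K.subRight σ).rest γ =
      LinearMap.mul' k _ (TensorProduct.map (placeC 𝒜 N K.rest)
        (placeC 𝒜 N (K.subLeft σ).pairPoints) (deconcat k H hl' γ)) := fun σ => by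
    rw [placeC, ← letters_deconcat hl']
    congr 3
    · exact congrArg letters (funext fun u => congrArg (pt 𝒜 N) ((PairTuple.rest_sub_last h σ.2.2
        σ.2.1 (fun u v => (hne σ v u).symm) hl' _).trans (Fin.append_left _ _ _)).symm).symm
    · exact congrArg letters (funext fun u => congrArg (pt 𝒜 N) ((PairTuple.rest_sub_last h σ.2.2
        σ.2.1 (fun u v => (hne σ v u).symm) hl' _).trans (Fin.append_right _ _ _)).symm).symm
  simp only [summand_tmul', h1, h2]
  rw [sum_product_eq, muComponent]
  simp only [map_sum, map_smul, LinearMap.sum_apply, LinearMap.smul_apply,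
    LinearMap.compl₁₂_apply, TensorProduct.map_tmul, LinearMap.comp_apply, LinearMap.id_apply]

theorem restrict_summand {r : ℕ} {c : Fin n → Fin n → Prop} (hc : IsBlockRel c)
    (I : PairTuple n r) (y : (⨂[k]^(n - 2 * r) H) ⊗[k] (⨂[k]^r H)) (h : ∀ u, c (I.i u) (I.j u)) :
    restrict 𝒜 N hc (summand 𝒜 N I y) = summand 𝒜 N I y := by
  obtain ⟨x, hx, e⟩ := summand_eq (𝒜 := 𝒜) (N := N) I y
  rw [e, map_mul, restrict_of_mem_pAlg _ hx, eP, map_list_prod, List.map_ofFn]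
  congr 3
  funext u
  rw [Function.comp_apply, restrict_eg, if_pos (h u)]

theorem restrict_summand_eq_zero {r : ℕ} {c : Fin n → Fin n → Prop} (hc : IsBlockRel c)
    (I : PairTuple n r) (y : (⨂[k]^(n - 2 * r) H) ⊗[k] (⨂[k]^r H)) {u : Fin r}
    (h : ¬ c (I.i u) (I.j u)) : restrict 𝒜 N hc (summand 𝒜 N I y) = 0 := by
  obtain ⟨x, -, e⟩ := summand_eq (𝒜 := 𝒜) (N := N) I y
  rw [e, map_mul, eP, map_list_prod, List.map_ofFn, List.prod_eq_zero, mul_zero]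
  refine (List.mem_ofFn' _ _).2 ⟨u, ?_⟩
  rw [Function.comp_apply, restrict_eg, if_neg h]

theorem summand_mem_homog {r : ℕ} (I : PairTuple n r)
    (y : (⨂[k]^(n - 2 * r) H) ⊗[k] (⨂[k]^r H)) : summand 𝒜 N I y ∈ homog 𝒜 N n 0 1 r := by
  obtain ⟨x, hx, e⟩ := summand_eq (𝒜 := 𝒜) (N := N) I y
  rw [e]
  have := mul_mem_homog (pAlg_le_homog hx) (eP_mem_homog 0 1 I)
  rwa [zero_add, mul_one] at this

theorem exists_eP_eq_mul {r : ℕ} (I : PairTuple n r) (u : Fin r) :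
    ∃ y, eP 𝒜 N I = eg 𝒜 N (I.i u) (I.j u) * y := by
  obtain ⟨m, rfl⟩ : ∃ m, r = m + 1 := ⟨r - 1, by have := u.2; omega⟩
  have h := ofFn_prod_pull (k := k) (fun v => eg 𝒜 N (I.i v) (I.j v)) u (fun _ => 1 * 1)
    fun v _ => (isSuper_eg _ _).comm (isSuper_eg _ _)
  rw [eP, h, ← mul_smul_comm]
  exact ⟨_, rfl⟩

/-- The product of two summands with a common pair vanishes. -/
theorem summand_mul_summand_eq_zero {r s : ℕ} {I : PairTuple n r} {J : PairTuple n s} {u : Fin r}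
    {v : Fin s} (hi : I.i u = J.i v) (hj : I.j u = J.j v)
    (y : (⨂[k]^(n - 2 * r) H) ⊗[k] (⨂[k]^r H)) (y' : (⨂[k]^(n - 2 * s) H) ⊗[k] (⨂[k]^s H)) :
    summand 𝒜 N I y * summand 𝒜 N J y' = 0 := by
  obtain ⟨x, -, hx⟩ := summand_eq (𝒜 := 𝒜) (N := N) I y
  obtain ⟨x', -, hx'⟩ := summand_eq (𝒜 := 𝒜) (N := N) J y'
  obtain ⟨z, hz⟩ := exists_eP_eq_mul (𝒜 := 𝒜) (N := N) I u
  obtain ⟨z', hz'⟩ := exists_eP_eq_mul (𝒜 := 𝒜) (N := N) J v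
  have h := (isSuper_eg (𝒜 := 𝒜) (N := N) (J.i v) (J.j v)).mul_eq (z * x')
  have h' : eg 𝒜 N (J.i v) (J.j v) * (z * (x' * (eg 𝒜 N (J.i v) (J.j v) * z'))) = 0 := by
    rw [← mul_assoc z, ← mul_assoc, h, mul_assoc, ← mul_assoc (eg 𝒜 N _ _), eg_sq, zero_mul,
      mul_zero]
  rw [hx, hx', hz, hz', hi, hj, mul_assoc, mul_assoc, h', mul_zero]

theorem extract_summand_mul_of_card_ne {r s t : ℕ} (K : PairTuple n t) (I : PairTuple n r)
    (J : PairTuple n s) (ht : r + s ≠ t) (y : (⨂[k]^(n - 2 * r) H) ⊗[k] (⨂[k]^r H))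
    (y' : (⨂[k]^(n - 2 * s) H) ⊗[k] (⨂[k]^s H)) :
    extract 𝒜 N K (summand 𝒜 N I y * summand 𝒜 N J y') = 0 := by
  rw [extract, LinearMap.comp_apply, AlgHom.toLinearMap_apply, map_mul]
  by_cases hI : ∀ u, K.rel (I.i u) (I.j u)
  · by_cases hJ : ∀ u, K.rel (J.i u) (J.j u)
    · rw [restrict_summand _ I y hI, restrict_summand _ J y' hJ,
        homogProj_of_mem (mul_mem_homog (summand_mem_homog I y) (summand_mem_homog J y')),
        if_neg (by exact_mod_cast ht)]
    · obtain ⟨u, hu⟩ := not_forall.1 hJ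
      rw [restrict_summand_eq_zero _ J y' hu, mul_zero, map_zero]
  · obtain ⟨u, hu⟩ := not_forall.1 hI
    rw [restrict_summand_eq_zero _ I y hu, zero_mul, map_zero]

/-- The part of a product of two values of `Φ` belonging to the tuple `K` of the last pairs: only
complementary parts of `K` contribute, and these are in bijection with shuffles. -/
theorem extract_sum_mul_sum {r s : ℕ} (h : 2 * (r + s) ≤ n)
    (y : (⨂[k]^(n - 2 * r) H) ⊗[k] (⨂[k]^r H)) (y' : (⨂[k]^(n - 2 * s) H) ⊗[k] (⨂[k]^s H)) :
    extract 𝒜 N (PairTuple.last n (r + s) h)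
      ((∑ I : PairTuple n r, summand 𝒜 N I y) * ∑ J : PairTuple n s, summand 𝒜 N J y') =
      summand 𝒜 N (PairTuple.last n (r + s) h) (muComponent 𝒜 N n r s h y y') := by
  set K := PairTuple.last n (r + s) h with hK
  rw [Finset.sum_mul_sum, ← Finset.sum_product', map_sum, ← sum_summand_mul_summand h, ← hK]
  symm
  have hsub : ∀ {q : ℕ} (a : Fin q → Fin (r + s)) (ha : StrictMono a) (u : Fin q),
      K.rel ((K.sub a ha).i u) ((K.sub a ha).j u) := fun a _ u => ⟨a u, Or.inl ⟨rfl, rfl⟩⟩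
  refine Finset.sum_of_injOn (fun σ => (K.subLeft σ, K.subRight σ)) ?_ (fun _ _ => by simp) ?_ ?_
  · intro σ _ σ' _ hσ
    rw [Prod.mk.injEq] at hσ
    refine Subtype.ext (Equiv.ext fun x => K.strictMono_i.injective ?_)
    induction x using Fin.addCases with
    | left u => exact congrFun (congrArg PairTuple.i hσ.1) u
    | right v => exact congrFun (congrArg PairTuple.i hσ.2) v
  · rintro ⟨I, J⟩ - hIJ
    change extract 𝒜 N K (summand 𝒜 N I y * summand 𝒜 N J y') = 0
    by_cases hI : ∀ u, K.rel (I.i u) (I.j u)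
    swap
    · obtain ⟨u, hu⟩ := not_forall.1 hI
      rw [extract, LinearMap.comp_apply, AlgHom.toLinearMap_apply, map_mul,
        restrict_summand_eq_zero _ I y hu, zero_mul, map_zero]
    by_cases hJ : ∀ u, K.rel (J.i u) (J.j u)
    swap
    · obtain ⟨u, hu⟩ := not_forall.1 hJ
      rw [extract, LinearMap.comp_apply, AlgHom.toLinearMap_apply, map_mul,
        restrict_summand_eq_zero _ J y' hu, mul_zero, map_zero]
    -- Both tuples consist of pairs of `K`: the product vanishes if they have a common pair, and
    -- otherwise the two numberings combine to a shuffle.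
    obtain ⟨a, ha, rfl⟩ := K.exists_eq_sub hI
    obtain ⟨b, hb, rfl⟩ := K.exists_eq_sub hJ
    by_cases hab : ∃ u v, a u = b v
    · obtain ⟨u, v, huv⟩ := hab
      rw [summand_mul_summand_eq_zero (u := u) (v := v) (congrArg K.i huv) (congrArg K.j huv),
        map_zero]
    · refine absurd ?_ hIJ
      push Not at hab
      have hinj : Function.Injective (Fin.append a b) :=
        Fin.append_injective_iff.2 ⟨ha.injective, hb.injective, hab⟩
      refine ⟨⟨Equiv.ofBijective _ (Finite.injective_iff_bijective.1 hinj), ?_, ?_⟩,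
        Finset.mem_coe.2 (Finset.mem_univ _), ?_⟩
      · intro u v huv
        simpa using ha huv
      · intro u v huv
        simpa using hb huv
      · refine Prod.ext (PairTuple.ext' ?_ ?_) (PairTuple.ext' ?_ ?_) <;> funext u <;>
          simp [PairTuple.subLeft, PairTuple.subRight, PairTuple.sub]
  -- The product of the summands of complementary parts already belongs to `K`.
  · intro σ _
    dsimp only
    rw [extract, LinearMap.comp_apply, AlgHom.toLinearMap_apply, map_mul,
      restrict_summand _ (K.subLeft σ) y (hsub _ _), restrict_summand _ (K.subRight σ) y' (hsub _ _),
      homogProj_of_mem (mul_mem_homog (summand_mem_homog _ y) (summand_mem_homog _ y')),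
      if_pos (by push_cast; rfl)]

omit hN hH in
theorem mu_lof (r s : Fin (n / 2 + 1)) (y) (y') :
    mu 𝒜 N n (DirectSum.lof k (Fin (n / 2 + 1))
        (fun t => (⨂[k]^(n - 2 * (t : ℕ)) H) ⊗[k] (⨂[k]^(t : ℕ) H)) r y)
      (DirectSum.lof k (Fin (n / 2 + 1))
        (fun t => (⨂[k]^(n - 2 * (t : ℕ)) H) ⊗[k] (⨂[k]^(t : ℕ) H)) s y') =
    if h : (r : ℕ) + (s : ℕ) < n / 2 + 1 then
      DirectSum.lof k (Fin (n / 2 + 1))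
        (fun t => (⨂[k]^(n - 2 * (t : ℕ)) H) ⊗[k] (⨂[k]^(t : ℕ) H)) ⟨(r : ℕ) + (s : ℕ), h⟩
        (muComponent 𝒜 N n r s (by omega) y y')
    else 0 := by
  rw [mu, DirectSum.toModule_lof, LinearMap.flip_apply, DirectSum.toModule_lof]
  split_ifs <;> rfl

/-- The parts of a product of values of `Φ` belonging to the tuples of the last pairs are given by
`μ`. -/
theorem extract_PhiAmb_mul (t : Fin (n / 2 + 1)) (z w : Ambient k H n) :
    extract 𝒜 N (PairTuple.last n t (two_mul_le_of_fin t))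
      (PhiAmb 𝒜 N n z * PhiAmb 𝒜 N n w) =
    extract 𝒜 N (PairTuple.last n t (two_mul_le_of_fin t)) (PhiAmb 𝒜 N n (mu 𝒜 N n z w)) := by
  induction z using DirectSum.induction_on with
  | zero => simp
  | add x y hx hy => simp only [map_add, add_mul, LinearMap.add_apply, hx, hy]
  | of r y =>
  induction w using DirectSum.induction_on with
  | zero => simp
  | add x y hx hy => simp only [map_add, mul_add, hx, hy]
  | of s y' =>
    rw [← DirectSum.lof_eq_of k, ← DirectSum.lof_eq_of k, PhiAmb_lof, PhiAmb_lof, mu_lof]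
    by_cases hrs : (r : ℕ) + s = t
    · obtain ⟨t, ht⟩ := t
      simp only at hrs
      subst hrs
      rw [dif_pos ht, extract_PhiAmb, DirectSum.lof_apply]
      exact extract_sum_mul_sum _ y y'
    · have h1 : extract 𝒜 N (PairTuple.last n t (two_mul_le_of_fin t))
          ((∑ I : PairTuple n r, summand 𝒜 N I y) * ∑ J : PairTuple n s, summand 𝒜 N J y') = 0 := by
        rw [Finset.sum_mul_sum, map_sum]
        refine Finset.sum_eq_zero fun I _ => ?_
        rw [map_sum]
        exact Finset.sum_eq_zero fun J _ => extract_summand_mul_of_card_ne _ I J hrs y y'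
      rw [h1]
      split_ifs with h
      · rw [extract_PhiAmb, DirectSum.lof_eq_of, DirectSum.of_eq_of_ne, map_zero]
        rintro rfl
        exact hrs rfl
      · rw [map_zero, map_zero]

end Multiplicative

/-! ### Homogeneous parts of tensors -/

section TensorDegree

variable {k : Type u} {V : Type v} [Field k] [AddCommGroup V] [Module k V]
  (𝒱 : ℤ → Submodule k V) [DirectSum.Decomposition 𝒱]

/-- The coaction `x ↦ ∑_s x_s T^s` of a graded vector space, with values in the tensor algebra. -/
def tensorCoaction : V →ₗ[k] AddMonoidAlgebra (TensorAlgebra k V) ℤ :=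
  (DirectSum.toModule k ℤ _ fun s =>
    (AddMonoidAlgebra.lsingle s).comp ((TensorAlgebra.ι k).comp (𝒱 s).subtype)).comp
    (DirectSum.decomposeLinearEquiv 𝒱).toLinearMap

theorem tensorCoaction_of_mem {s : ℤ} {x : V} (hx : x ∈ 𝒱 s) :
    tensorCoaction 𝒱 x = AddMonoidAlgebra.single s (TensorAlgebra.ι k x) := by
  rw [tensorCoaction, LinearMap.comp_apply, LinearEquiv.coe_coe,
    DirectSum.decomposeLinearEquiv_apply, DirectSum.decompose_of_mem 𝒱 hx,
    ← DirectSum.lof_eq_of k, DirectSum.toModule_lof]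
  rfl

/-- The projection of `T^m(V)` onto its part of total degree `d`. -/
def tensorDegProj (m : ℕ) (d : ℤ) : (⨂[k]^m V) →ₗ[k] (⨂[k]^m V) :=
  (DirectSum.component k ℕ (fun i => ⨂[k]^i V) m).comp
    (TensorAlgebra.toDirectSum.toLinearMap.comp
      ({ toFun := fun t => (letters (fun _ => tensorCoaction 𝒱) t).coeff d
         map_add' := fun x y => by rw [map_add]; rfl
         map_smul' := fun c x => by rw [map_smul]; rfl } :
        (⨂[k]^m V) →ₗ[k] TensorAlgebra k V))

theorem tensorDegProj_tprod {m : ℕ} {e : Fin m → ℤ} {x : Fin m → V} (hx : ∀ i, x i ∈ 𝒱 (e i))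
    (d : ℤ) : tensorDegProj 𝒱 m d (PiTensorProduct.tprod k x) =
      if ∑ i, e i = d then PiTensorProduct.tprod k x else 0 := by
  have h : ∀ (m : ℕ) (e : Fin m → ℤ) (x : Fin m → V), (∀ i, x i ∈ 𝒱 (e i)) →
      (List.ofFn fun i => tensorCoaction 𝒱 (x i)).prod =
        AddMonoidAlgebra.single (∑ i, e i) (TensorAlgebra.tprod k V m x) := by
    intro m
    induction m with
    | zero =>
      intro e x _
      rw [List.ofFn_zero, List.prod_nil, TensorAlgebra.tprod_apply, List.ofFn_zero, List.prod_nil,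
        Finset.univ_eq_empty, Finset.sum_empty]
      rfl
    | succ m ih =>
      intro e x hx
      rw [List.ofFn_succ, List.prod_cons, ih (fun i => e i.succ) _ fun i => hx _,
        tensorCoaction_of_mem 𝒱 (hx 0), AddMonoidAlgebra.single_mul_single, Fin.sum_univ_succ,
        TensorAlgebra.tprod_apply, TensorAlgebra.tprod_apply, List.ofFn_succ, List.prod_cons]
  change DirectSum.component k ℕ (fun i => ⨂[k]^i V) m (TensorAlgebra.toDirectSum
    ((letters (fun _ => tensorCoaction 𝒱) (PiTensorProduct.tprod k x)).coeff d)) = _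
  rw [letters_tprod, h m e x hx, AddMonoidAlgebra.coeff_single, Finsupp.single_apply]
  split_ifs
  · rw [TensorAlgebra.toDirectSum_tensorPower_tprod, ← DirectSum.lof_eq_of k,
      DirectSum.component.lof_self]
  · rw [map_zero, map_zero]

theorem tensor_induction {m : ℕ} {C : (⨂[k]^m V) → Prop} (zero : C 0)
    (add : ∀ x y, C x → C y → C (x + y)) (smul : ∀ (c : k) x, C x → C (c • x))
    (tprod : ∀ (e : Fin m → ℤ) (x : Fin m → V), (∀ i, x i ∈ 𝒱 (e i)) →
      C (PiTensorProduct.tprod k x)) (t : ⨂[k]^m V) : C t := by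
  have ht : t ∈ Submodule.span k {t : ⨂[k]^m V | ∃ (e : Fin m → ℤ) (x : Fin m → V),
      (∀ i, x i ∈ 𝒱 (e i)) ∧ t = PiTensorProduct.tprod k x} :=
    span_tprod_homogeneous 𝒱 m ▸ Submodule.mem_top
  induction ht using Submodule.span_induction with
  | mem t ht =>
    obtain ⟨e, x, hx, rfl⟩ := ht
    exact tprod e x hx
  | zero => exact zero
  | add x y _ _ hx hy => exact add x y hx hy
  | smul c x _ hx => exact smul c x hx

theorem tensorDegProj_mem {m : ℕ} (d : ℤ) (t : ⨂[k]^m V) :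
    tensorDegProj 𝒱 m d t ∈ tensorDeg 𝒱 m d := by
  induction t using tensor_induction 𝒱 with
  | zero => rw [map_zero]; exact zero_mem _
  | add x y hx hy => rw [map_add]; exact add_mem hx hy
  | smul c x hx => rw [map_smul]; exact Submodule.smul_mem _ _ hx
  | tprod e x hx =>
    rw [tensorDegProj_tprod 𝒱 hx]
    split_ifs with h
    · exact Submodule.subset_span ⟨x, e, hx, h, rfl⟩
    · exact zero_mem _

theorem exists_sum_tensorDegProj {m : ℕ} (t : ⨂[k]^m V) :
    ∃ S : Finset ℤ, ∀ S', S ⊆ S' → ∑ d ∈ S', tensorDegProj 𝒱 m d t = t := by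
  classical
  induction t using tensor_induction 𝒱 with
  | zero => exact ⟨∅, fun S' _ => by simp⟩
  | add x y hx hy =>
    obtain ⟨S, hS⟩ := hx
    obtain ⟨T, hT⟩ := hy
    refine ⟨S ∪ T, fun S' h => ?_⟩
    simp only [map_add, Finset.sum_add_distrib]
    rw [hS S' (Finset.union_subset_left h), hT S' (Finset.union_subset_right h)]
  | smul c x hx =>
    obtain ⟨S, hS⟩ := hx
    refine ⟨S, fun S' h => ?_⟩
    simp only [map_smul, ← Finset.smul_sum]
    rw [hS S' h]
  | tprod e x hx =>
    refine ⟨{∑ i, e i}, fun S' h => ?_⟩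
    simp only [tensorDegProj_tprod 𝒱 hx]
    rw [Finset.sum_ite_eq, if_pos (h (Finset.mem_singleton_self _))]

theorem exists_hasParity {s : ℤ} {x : V} (hx : x ∈ 𝒱 s) : ∃ ε, HasParity 𝒱 ε x := by
  rcases Int.emod_two_eq_zero_or_one s with h | h
  · exact ⟨0, hasParity_of_mem hx h⟩
  · exact ⟨1, hasParity_of_mem hx h⟩

theorem tensorDegProj_permAct {m : ℕ} (d : ℤ) (σ : Equiv.Perm (Fin m)) (t : ⨂[k]^m V) :
    tensorDegProj 𝒱 m d (permAct 𝒱 σ t) = permAct 𝒱 σ (tensorDegProj 𝒱 m d t) := by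
  induction t using tensor_induction 𝒱 with
  | zero => simp
  | add x y hx hy => simp only [map_add, hx, hy]
  | smul c x hx => simp only [map_smul, hx]
  | tprod e x hx =>
    choose ε hε using fun i => exists_hasParity 𝒱 (hx i)
    rw [tensorDegProj_tprod 𝒱 hx, permAct_tprod σ hε, map_smul,
      tensorDegProj_tprod 𝒱 (e := fun i => e (σ.symm i)) fun i => hx _, Equiv.sum_comp σ.symm]
    split_ifs
    · rw [permAct_tprod σ hε]
    · rw [smul_zero, map_zero]

/-- Invariant tensors are sums of homogeneous invariant tensors. -/
theorem span_homogeneous_Gam (m : ℕ) :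
    Submodule.span k {a : Gam 𝒱 m | ∃ d, (a : ⨂[k]^m V) ∈ tensorDeg 𝒱 m d} = ⊤ := by
  rw [eq_top_iff]
  rintro ⟨t, ht⟩ -
  have hmem : ∀ d, tensorDegProj 𝒱 m d t ∈ Gam 𝒱 m := fun d => by
    rw [Gam, Submodule.mem_iInf]
    intro σ
    rw [LinearMap.mem_eqLocus, ← tensorDegProj_permAct, permAct_of_mem_Gam ht,
      LinearMap.id_apply]
  obtain ⟨S, hS⟩ := exists_sum_tensorDegProj 𝒱 t
  have : (⟨t, ht⟩ : Gam 𝒱 m) = ∑ d ∈ S, ⟨tensorDegProj 𝒱 m d t, hmem d⟩ := by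
    refine Subtype.ext ?_
    rw [AddSubmonoidClass.coe_finsetSum]
    exact (hS S subset_rfl).symm
  rw [this]
  exact Submodule.sum_mem _ fun d _ => Submodule.subset_span ⟨d, tensorDegProj_mem 𝒱 d t⟩

end TensorDegree

/-! ### `Φ` preserves degrees -/

section Degrees

variable {k : Type u} {H : Type v} [Field k] [Ring H] [Algebra k H]
  {𝒜 : ℤ → Submodule k H} {N n : ℕ} [GradedAlgebra 𝒜]

theorem iSup_gamDeg : ⨆ d, gamDeg 𝒜 N n d = ⊤ := by
  rw [eq_top_iff]
  rintro x -
  induction x using DirectSum.induction_on with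
  | zero => exact zero_mem _
  | add x y hx hy => exact add_mem hx hy
  | of r y =>
    rw [← DirectSum.lof_eq_of k]
    induction y with
    | zero => rw [map_zero]; exact zero_mem _
    | add x y hx hy => rw [map_add]; exact add_mem hx hy
    | tmul a b =>
    have ha : a ∈ Submodule.span k _ :=
      span_homogeneous_Gam 𝒜 (n - 2 * (r : ℕ)) ▸ Submodule.mem_top
    have hb : b ∈ Submodule.span k _ :=
      span_homogeneous_Gam (susp 𝒜 ((N : ℤ) - 1)) (r : ℕ) ▸ Submodule.mem_top
    induction ha using Submodule.span_induction with
    | zero => rw [TensorProduct.zero_tmul, map_zero]; exact zero_mem _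
    | add x y _ _ hx hy => rw [TensorProduct.add_tmul, map_add]; exact add_mem hx hy
    | smul c x _ hx =>
      rw [← TensorProduct.smul_tmul', map_smul]
      exact Submodule.smul_mem _ _ hx
    | mem a ha =>
    induction hb using Submodule.span_induction with
    | zero => rw [TensorProduct.tmul_zero, map_zero]; exact zero_mem _
    | add x y _ _ hx hy => rw [TensorProduct.tmul_add, map_add]; exact add_mem hx hy
    | smul c x _ hx =>
      rw [TensorProduct.tmul_smul, map_smul]
      exact Submodule.smul_mem _ _ hx
    | mem b hb =>
      obtain ⟨p, hp⟩ := ha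
      obtain ⟨q, hq⟩ := hb
      exact Submodule.mem_iSup_of_mem (p + q)
        (Submodule.subset_span ⟨r, p, q, a, b, hp, hq, rfl, rfl⟩)

variable [hN : Fact (Even N)] [hH : Fact (IsGradedCommutative 𝒜)]

theorem ofFn_prod_mem_homog {w v : ℤ} {m : ℕ} {d : Fin m → ℤ} {a : Fin m → CT 𝒜 N n}
    (h : ∀ i, a i ∈ homog 𝒜 N n w v (d i)) :
    (List.ofFn a).prod ∈ homog 𝒜 N n w v (∑ i, d i) := by
  induction m with
  | zero => simpa using one_mem_homog w v
  | succ m ih =>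
    rw [List.ofFn_succ, List.prod_cons, Fin.sum_univ_succ]
    exact mul_mem_homog (h 0) (ih fun i => h i.succ)

/-- Evaluation on homogeneous letters is homogeneous. -/
theorem letters_mem_homog {V : Type*} [AddCommGroup V] [Module k V] {𝒱 : ℤ → Submodule k V}
    {w v : ℤ} {m : ℕ} {g : Fin m → V →ₗ[k] CT 𝒜 N n}
    (hg : ∀ u s x, x ∈ 𝒱 s → g u x ∈ homog 𝒜 N n w v s) {d : ℤ} {t : ⨂[k]^m V}
    (ht : t ∈ tensorDeg 𝒱 m d) : letters g t ∈ homog 𝒜 N n w v d := by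
  induction ht using Submodule.span_induction with
  | mem t ht =>
    obtain ⟨x, e, hx, rfl, rfl⟩ := ht
    rw [letters_tprod]
    exact ofFn_prod_mem_homog fun i => hg i _ _ (hx i)
  | zero => rw [map_zero]; exact zero_mem _
  | add x y _ _ hx hy => rw [map_add]; exact add_mem hx hy
  | smul c x _ hx => rw [map_smul]; exact Submodule.smul_mem _ _ hx

theorem PhiAmb_incl_mem_homog {d : ℤ} {x : GamSum 𝒜 N n} (hx : x ∈ gamDeg 𝒜 N n d) :
    PhiAmb 𝒜 N n (incl 𝒜 N n x) ∈ homog 𝒜 N n 1 ((N : ℤ) - 1) d := by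
  induction hx using Submodule.span_induction with
  | mem x hx =>
    obtain ⟨r, p, q, a, b, ha, hb, rfl, rfl⟩ := hx
    rw [incl, DirectSum.lmap_lof, PhiAmb_lof]
    refine Submodule.sum_mem _ fun I _ => ?_
    rw [TensorProduct.mapIncl, TensorProduct.map_tmul, summand_tmul]
    refine mul_mem_homog (letters_mem_homog (fun u s x hx => ?_) ha)
      (letters_mem_homog (fun u s x hx => ?_) hb)
    · have := pt_mem_homog (N := N) 1 ((N : ℤ) - 1)
        (I.compl.orderEmbOfFin I.card_compl u) hx
      rwa [one_mul] at this
    · have := mul_mem_homog (eg_mem_homog 1 ((N : ℤ) - 1) (I.i u) (I.j u))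
        (pt_mem_homog (N := N) 1 ((N : ℤ) - 1)
        (I.i u) (show x ∈ 𝒜 (s - ((N : ℤ) - 1)) from hx))
      rwa [one_mul, add_sub_cancel] at this
  | zero => rw [map_zero, map_zero]; exact zero_mem _
  | add x y _ _ hx hy => rw [map_add, map_add]; exact add_mem hx hy
  | smul c x _ hx => rw [map_smul, map_smul]; exact Submodule.smul_mem _ _ hx

omit [GradedAlgebra 𝒜] hN hH in
theorem pGen_mul_mem_eOneDeg (i : Fin n) {s d : ℤ} {a : H} (ha : a ∈ 𝒜 s) {z : EOne 𝒜 N n}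
    (hz : z ∈ eOneDeg 𝒜 N n d) : pGen 𝒜 N i a * z ∈ eOneDeg 𝒜 N n (s + d) := by
  induction hz using Submodule.span_induction with
  | mem z hz =>
    obtain ⟨t, q, rfl, hz⟩ := hz
    exact Submodule.subset_span ⟨s + t, q, add_assoc _ _ _, hz.p_mul i s a ha t q z⟩
  | zero => rw [mul_zero]; exact zero_mem _
  | add x y _ _ hx hy => rw [mul_add]; exact add_mem hx hy
  | smul c x _ hx => rw [mul_smul_comm]; exact Submodule.smul_mem _ _ hx

omit [GradedAlgebra 𝒜] hN hH in
theorem eGen_mul_mem_eOneDeg (i j : Fin n) (h : i ≠ j) {d : ℤ} {z : EOne 𝒜 N n}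
    (hz : z ∈ eOneDeg 𝒜 N n d) : eGen 𝒜 N i j h * z ∈ eOneDeg 𝒜 N n (((N : ℤ) - 1) + d) := by
  induction hz using Submodule.span_induction with
  | mem z hz =>
    obtain ⟨t, q, rfl, hz⟩ := hz
    exact Submodule.subset_span ⟨t, ((N : ℤ) - 1) + q, by ring, hz.e_mul i j h t q z⟩
  | zero => rw [mul_zero]; exact zero_mem _
  | add x y _ _ hx hy => rw [mul_add]; exact add_mem hx hy
  | smul c x _ hx => rw [mul_smul_comm]; exact Submodule.smul_mem _ _ hx

/-- The parts of `E₁` of given degree are those of the grading defined by the coaction. -/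
theorem mem_eOneDeg_iff {d : ℤ} {x : EOne 𝒜 N n} :
    x ∈ eOneDeg 𝒜 N n d ↔ toCT 𝒜 N n x ∈ homog 𝒜 N n 1 ((N : ℤ) - 1) d := by
  constructor
  · intro hx
    induction hx using Submodule.span_induction with
    | mem x hx =>
      obtain ⟨t, q, rfl, hx⟩ := hx
      induction hx with
      | one => rw [map_one]; exact one_mem_homog _ _
      | p_mul i s a ha t q x _ hx =>
        have := mul_mem_homog (pt_mem_homog (N := N) 1 ((N : ℤ) - 1) i ha) hx
        rw [one_mul, ← add_assoc] at this
        rw [map_mul]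
        exact this
      | e_mul i j h t q x _ hx =>
        have := mul_mem_homog (eg_mem_homog 1 ((N : ℤ) - 1) i j) hx
        rw [eg_of_ne h, ← add_assoc, add_comm ((N : ℤ) - 1), add_assoc] at this
        rw [map_mul]
        exact this
    | zero => rw [map_zero]; exact zero_mem _
    | add x y _ _ hx hy => rw [map_add]; exact add_mem hx hy
    | smul c x _ hx => rw [map_smul]; exact Submodule.smul_mem _ _ hx
  · have key : ∀ (y : CT 𝒜 N n) (d : ℤ), (toCT 𝒜 N n).symm
        (homogProj 𝒜 N n 1 ((N : ℤ) - 1) d y) ∈ eOneDeg 𝒜 N n d := by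
      intro y
      induction y using eOne_induction with
      | one =>
        intro d
        rw [homogProj_of_mem (one_mem_homog _ _)]
        split_ifs with h
        · rw [map_one]
          exact Submodule.subset_span ⟨0, 0, by rw [add_zero, h], IsMonomial.one⟩
        · rw [map_zero]
          exact zero_mem _
      | add x y hx hy =>
        intro d
        rw [map_add, map_add]
        exact add_mem (hx d) (hy d)
      | smul c x hx =>
        intro d
        rw [map_smul, map_smul]
        exact Submodule.smul_mem _ _ (hx d)
      | p_mul i s a ha x hx =>
        intro d
        rw [homogProj_mul_of_mem (pt_mem_homog 1 _ i ha), map_mul]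
        have := pGen_mul_mem_eOneDeg i ha (hx (-(1 * s) + d))
        rw [one_mul, add_neg_cancel_left] at this
        rw [one_mul]
        exact this
      | e_mul i j h x hx =>
        intro d
        rw [homogProj_mul_of_mem (eg_mem_homog 1 _ i j), map_mul, eg_of_ne h]
        have := eGen_mul_mem_eOneDeg i j h (hx (-((N : ℤ) - 1) + d))
        rw [add_neg_cancel_left] at this
        exact this
    intro hx
    have := key (toCT 𝒜 N n x) d
    rwa [homogProj_of_mem hx, if_pos rfl, AlgEquiv.symm_apply_apply] at this

/-- `Φ` reflects degrees: it is injective, and its values on elements of degree `d` contain the part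
of degree `d` of each of its values. -/
theorem mem_gamDeg_of_PhiAmb_incl {d : ℤ} {x : GamSum 𝒜 N n}
    (hx : PhiAmb 𝒜 N n (incl 𝒜 N n x) ∈ homog 𝒜 N n 1 ((N : ℤ) - 1) d) :
    x ∈ gamDeg 𝒜 N n d := by
  have key : ∀ x : GamSum 𝒜 N n, ∃ y ∈ gamDeg 𝒜 N n d, PhiAmb 𝒜 N n (incl 𝒜 N n y) =
      homogProj 𝒜 N n 1 ((N : ℤ) - 1) d (PhiAmb 𝒜 N n (incl 𝒜 N n x)) := by
    intro x
    have hx : x ∈ ⨆ d, gamDeg 𝒜 N n d := iSup_gamDeg (𝒜 := 𝒜) (N := N) (n := n) ▸ Submodule.mem_top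
    induction hx using Submodule.iSup_induction' with
    | mem e x hx =>
      rw [homogProj_of_mem (PhiAmb_incl_mem_homog hx)]
      split_ifs with h
      · exact ⟨x, h ▸ hx, rfl⟩
      · exact ⟨0, zero_mem _, by simp⟩
    | zero => exact ⟨0, zero_mem _, by simp⟩
    | add x y _ _ hx hy =>
      obtain ⟨x', hx', h1⟩ := hx
      obtain ⟨y', hy', h2⟩ := hy
      exact ⟨x' + y', add_mem hx' hy', by simp only [map_add, h1, h2]⟩
  obtain ⟨y, hy, h⟩ := key x
  rw [homogProj_of_mem hx, if_pos rfl] at h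
  rwa [← incl_injective 𝒜 N n (PhiAmb_injective h)]

/-- Products of values of `Φ` can be compared in the copy `CT` of `E₁`. -/
theorem Phi_mul_eq_iff {x y w : GamSum 𝒜 N n} :
    Phi 𝒜 N n w = Phi 𝒜 N n x * Phi 𝒜 N n y ↔
      PhiAmb 𝒜 N n (incl 𝒜 N n w) =
        PhiAmb 𝒜 N n (incl 𝒜 N n x) * PhiAmb 𝒜 N n (incl 𝒜 N n y) := by
  rw [← toCT_Phi, ← toCT_Phi, ← toCT_Phi]
  refine ⟨fun h => (congrArg (toCT 𝒜 N n) h).trans (map_mul (toCT 𝒜 N n) _ _), fun h =>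
    (toCT 𝒜 N n).injective (h.trans (map_mul (toCT 𝒜 N n) _ _).symm)⟩

end Degrees

end

end CohenTaylor

theorem mainTheorem6 {k : Type*} {H : Type*} [Field k] [Ring H] [Algebra k H]
    (𝒜 : ℤ → Submodule k H) [GradedAlgebra 𝒜] (hH : CohenTaylor.IsGradedCommutative 𝒜)
    (N n : ℕ) (hN : Even N) (h3 : (3 : k) ≠ 0 ∨ n ≤ 2) :
    ∃ (m : CohenTaylor.GamSum 𝒜 N n →ₗ[k] CohenTaylor.GamSum 𝒜 N n →ₗ[k] CohenTaylor.GamSum 𝒜 N n)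
      (u : CohenTaylor.GamSum 𝒜 N n),
      -- `m` is the restriction of `μ` to the spaces of invariant tensors
      (∀ x y, CohenTaylor.incl 𝒜 N n (m x y) =
        CohenTaylor.mu 𝒜 N n (CohenTaylor.incl 𝒜 N n x) (CohenTaylor.incl 𝒜 N n y)) ∧
      -- it is a graded algebra structure with unit `u`
      (∀ x y z, m (m x y) z = m x (m y z)) ∧
      (∀ x, m u x = x ∧ m x u = x) ∧
      u ∈ CohenTaylor.gamDeg 𝒜 N n 0 ∧
      (∀ (d d' : ℤ) (x y : CohenTaylor.GamSum 𝒜 N n), x ∈ CohenTaylor.gamDeg 𝒜 N n d →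
        y ∈ CohenTaylor.gamDeg 𝒜 N n d' → m x y ∈ CohenTaylor.gamDeg 𝒜 N n (d + d')) ∧
      -- `Φ` is a morphism of algebras, bijective onto the invariants, preserving degrees
      CohenTaylor.Phi 𝒜 N n u = 1 ∧
      (∀ x y, CohenTaylor.Phi 𝒜 N n (m x y) =
        CohenTaylor.Phi 𝒜 N n x * CohenTaylor.Phi 𝒜 N n y) ∧
      Function.Injective (CohenTaylor.Phi 𝒜 N n) ∧
      LinearMap.range (CohenTaylor.Phi 𝒜 N n) =
        Subalgebra.toSubmodule (CohenTaylor.invariants 𝒜 N n) ∧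
      (∀ d : ℤ, (CohenTaylor.gamDeg 𝒜 N n d).map (CohenTaylor.Phi 𝒜 N n) =
        Subalgebra.toSubmodule (CohenTaylor.invariants 𝒜 N n) ⊓ CohenTaylor.eOneDeg 𝒜 N n d) := by
  have : Fact (Even N) := ⟨hN⟩
  have : Fact (CohenTaylor.IsGradedCommutative 𝒜) := ⟨hH⟩
  have hinj : Function.Injective (CohenTaylor.Phi 𝒜 N n) := fun x y h =>
    CohenTaylor.incl_injective 𝒜 N n (CohenTaylor.PhiAmb_injective (𝒜 := 𝒜) (N := N) (by
      rw [← CohenTaylor.toCT_Phi, ← CohenTaylor.toCT_Phi, h]))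
  have hrange : ∀ x, x ∈ CohenTaylor.invariants 𝒜 N n ↔ ∃ w, CohenTaylor.Phi 𝒜 N n w = x :=
    fun x => CohenTaylor.mem_invariants_iff h3
  -- The invariants form a subalgebra, so that the product and the unit of `E₁` can be transported
  -- to `Γₙ^H` along `Φ`. Then only the comparison of this product with `μ` is left.
  have hmul : ∀ x y, ∃ w, CohenTaylor.Phi 𝒜 N n w =
      CohenTaylor.Phi 𝒜 N n x * CohenTaylor.Phi 𝒜 N n y := fun x y =>
    (hrange _).1 (mul_mem ((hrange _).2 ⟨x, rfl⟩) ((hrange _).2 ⟨y, rfl⟩))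
  choose m hm using hmul
  obtain ⟨u, hu⟩ := (hrange 1).1 (one_mem _)
  -- `Φ` preserves and reflects degrees.
  have hdeg : ∀ d x, x ∈ CohenTaylor.gamDeg 𝒜 N n d ↔
      CohenTaylor.Phi 𝒜 N n x ∈ CohenTaylor.eOneDeg 𝒜 N n d := fun d x => by
    rw [CohenTaylor.mem_eOneDeg_iff, CohenTaylor.toCT_Phi]
    exact ⟨CohenTaylor.PhiAmb_incl_mem_homog, CohenTaylor.mem_gamDeg_of_PhiAmb_incl⟩
  refine ⟨LinearMap.mk₂ k m
    (fun x y z => hinj (by rw [hm, map_add, map_add, hm, hm, add_mul]))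
    (fun c x y => hinj (by rw [hm, map_smul, map_smul, hm, smul_mul_assoc]))
    (fun x y z => hinj (by rw [hm, map_add, map_add, hm, hm, mul_add]))
    (fun c x y => hinj (by rw [hm, map_smul, map_smul, hm, mul_smul_comm])), u, ?_, ?_, ?_, ?_, ?_,
    hu, hm, hinj, ?_, ?_⟩
  · intro x y
    -- Both sides have the same parts belonging to the tuples of the last pairs.
    refine CohenTaylor.eq_of_extract_PhiAmb (𝒜 := 𝒜) (N := N) fun t => ?_
    rw [LinearMap.mk₂_apply, CohenTaylor.Phi_mul_eq_iff.1 (hm x y)]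
    exact CohenTaylor.extract_PhiAmb_mul t _ _
  · intro x y z
    exact hinj (by simp only [LinearMap.mk₂_apply, hm, mul_assoc])
  · intro x
    exact ⟨hinj (by rw [LinearMap.mk₂_apply, hm, hu, one_mul]),
      hinj (by rw [LinearMap.mk₂_apply, hm, hu, mul_one])⟩
  · rw [hdeg, hu]
    exact Submodule.subset_span ⟨0, 0, rfl, CohenTaylor.IsMonomial.one⟩
  · intro d d' x y hx hy
    rw [hdeg, CohenTaylor.mem_eOneDeg_iff] at hx hy
    rw [LinearMap.mk₂_apply, hdeg, hm, CohenTaylor.mem_eOneDeg_iff, map_mul]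
    exact CohenTaylor.mul_mem_homog hx hy
  · ext x
    exact (hrange x).symm
  · intro d
    ext x
    rw [Submodule.mem_map, Submodule.mem_inf, Subalgebra.mem_toSubmodule, hrange]
    constructor
    · rintro ⟨w, hw, rfl⟩
      exact ⟨⟨w, rfl⟩, (hdeg d w).1 hw⟩
    · rintro ⟨⟨w, rfl⟩, hw⟩
      exact ⟨w, (hdeg d w).2 hw, rfl⟩
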